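/- A metrical task system (MTS) $\mathcal M=(\mathcal X,\mathcal L)$ consists of a nonempty finite pseudo-metric space $(\mathcal X,d)$ with $N$ points (states) and diameter $D=\max_{x,y}d(x,y)$, and a set $\mathcal L\subseteq[0,1]^{\mathcal X}$ of loss vectors. In each round $t=1,\dots,T$ a randomized online algorithm, which knows the horizon $T$ in advance, first sees $l_t\in\mathcal L$ and then chooses a state $i_t\in\mathcal X$; the sequence of losses is fixed in advance (oblivious adversary). An online algorithm (one for each $T$) has competitive ratio $\alpha$ if there is $\beta>0$, independent of $T$, such that for all $T$ and all $l_1,\dots,l_T\in\mathcal L$ $$\mathbb E\Big[\sum_{t=1}^T l_t(i_t)+\sum_{t=2}^T d(i_t,i_{t-1})\Big]\le \alpha\min_{i_1^*,\dots,i_T^*\in\mathcal X}\Big(\sum_{t=1}^T l_t(i^*_t)+\sum_{t=2}^T d(i^*_t,i^*_{t-1})\Big)+\beta .$$ Its regret on an interval $I=\{t_0+1,\dots,t_0+k\}\subseteq[T]$ is at most $R$ if for all $l_1,\dots,l_T\in\mathcal L$ $$\mathbb E\Big[\sum_{t\in I} l_t(i_t)+\sum_{t\in I\setminus\{t_0+1\}}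 d(i_t,i_{t-1})\Big]\le \min_{x\in\mathcal X}\sum_{t\in I} l_t(x)+R .$$ **Corollary.** There are a universal constant $C>0$ and a single randomized procedure with the following property. Let $\mathcal A_{\mathrm{base}}$ be an online algorithm for an MTS $\mathcal M$ with competitive ratio $\alpha\ge1$. Let $\mathcal A$ be the online algorithm that runs $\mathcal A_{\mathrm{base}}$ as a black box and the procedure on top of it: in each round the procedure, which knows $N$, $T$, $D$ and has access to $d$, is given $l_t$ and the current state of $\mathcal A_{\mathrm{base}}$, and determines the state $i_t$ of $\mathcal A$. Then: 1. $\mathcal A$ has competitive ratio $\alpha$. 2. For every $T$ and every interval $I\subseteq[T]$, the regret of $\mathcal A$ on $I$ is at most $$C\Big(D\sqrt{|I|\log T}+\sqrt{(D+1)\,|I|\,\log(NT)}\Big).$$ 3. In each round the procedure (that is, the computation of $\mathcal A$ on top of that of $\mathcal A_{\mathrm{base}}$) takes at most $C\,N\log(T+1)$ units of time, for all losses and all outcomes of the randomness, on a random access machine with real and integer arrays on which arithmetic operations, comparisons, array accesses, exponentiation, the error function and the draw of a uniform number from $[0,1]$ each take one unit of time. -/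

import Mathlib

open MeasureTheory

universe u w

noncomputable section

/-! ### Metrical task systems and randomized online algorithms -/

/-- A metrical task system on the finite pseudo-metric space `X`: a collection of loss vectors in
`[0,1]^X`. Moving from `x` to `y` costs `dist x y`. -/
structure MTS (X : Type u) where
  losses : Set (X → ℝ)
  bounded : ∀ l ∈ losses, ∀ x, 0 ≤ l x ∧ l x ≤ 1

/-- A randomized online algorithm for `M`: it draws a seed `ω` before the first round, and in round
`t` (rounds are numbered from `0`) it moves to the state `act l t ω`, which may depend on the seed
and on the losses of the rounds `0, …, t` only. -/
structure OnlineAlgorithm {X : Type u} (M : MTS X) where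
  Seed : Type w
  [measurableSpace : MeasurableSpace Seed]
  law : Measure Seed
  [isProbability : IsProbabilityMeasure law]
  act : (ℕ → M.losses) → ℕ → Seed → X
  causal : ∀ (l l' : ℕ → M.losses) (t : ℕ), (∀ s ≤ t, l s = l' s) → act l t = act l' t
  measurable_act : ∀ (l : ℕ → M.losses) (t : ℕ) (x : X), MeasurableSet {ω | act l t ω = x}

attribute [instance] OnlineAlgorithm.measurableSpace OnlineAlgorithm.isProbability

/-- The cost of the state sequence `p` on the interval of the `k` rounds `a, …, a + k - 1`:
the losses of all these rounds, and the movement costs of all but the first of them. -/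
def pathCost {X : Type u} [PseudoMetricSpace X] {M : MTS X} (l : ℕ → M.losses) (p : ℕ → X)
    (a k : ℕ) : ℝ :=
  ∑ t ∈ Finset.Ico a (a + k), (l t : X → ℝ) (p t)
    + ∑ t ∈ Finset.Ico (a + 1) (a + k), dist (p t) (p (t - 1))

/-- The expected cost of an online algorithm on the rounds `a, …, a + k - 1`. -/
def OnlineAlgorithm.expectedCost {X : Type u} [PseudoMetricSpace X] {M : MTS X}
    (A : OnlineAlgorithm.{u, w} M) (l : ℕ → M.losses) (a k : ℕ) : ℝ :=
  ∫ ω, pathCost l (fun t => A.act l t ω) a k ∂A.law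

/-- `A T` is the algorithm for the (known) horizon `T`. The family has competitive ratio `α` if,
up to an additive constant independent of `T`, its expected cost on every loss sequence is at most
`α` times the cost of every (hence of the best) offline state sequence. -/
def HasCompetitiveRatio {X : Type u} [PseudoMetricSpace X] {M : MTS X}
    (A : ℕ → OnlineAlgorithm.{u, w} M) (α : ℝ) : Prop :=
  ∃ β : ℝ, 0 < β ∧ ∀ (T : ℕ) (l : ℕ → M.losses) (p : ℕ → X),
    (A T).expectedCost l 0 T ≤ α * pathCost l p 0 T + β

/-- `A` has regret at most `R` on the rounds `a, …, a + k - 1`, against every fixed state. -/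
def OnlineAlgorithm.RegretLE {X : Type u} [PseudoMetricSpace X] {M : MTS X}
    (A : OnlineAlgorithm.{u, w} M) (a k : ℕ) (R : ℝ) : Prop :=
  ∀ (l : ℕ → M.losses) (x : X),
    A.expectedCost l a k ≤ ∑ t ∈ Finset.Ico a (a + k), (l t : X → ℝ) x + R

/-! ### A randomized real random access machine

Programs work on finitely many integer arrays and finitely many real arrays (a scalar is entry `0`
of an array). Arithmetic, comparison, exponentiation, the error function, an array access and the
draw of a uniform number from `[0,1]` each take one unit of time. Real numbers are never converted
to integers. -/

/-- The memory, the number of uniform numbers drawn so far, and the time used so far. -/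
@[ext] structure Store where
  int : ℕ → ℕ → ℕ
  real : ℕ → ℕ → ℝ
  drawn : ℕ
  time : ℕ

/-- Integer expressions; `get a i` is the entry `i` of the integer array `a`. -/
inductive IExp where
  | lit (n : ℕ)
  | get (a : ℕ) (i : IExp)
  | add (i j : IExp)
  | sub (i j : IExp)
  | mul (i j : IExp)

/-- Real expressions; `get a i` is the entry `i` of the real array `a`. -/
inductive RExp where
  | ofInt (i : IExp)
  | get (a : ℕ) (i : IExp)
  | add (x y : RExp)
  | sub (x y : RExp)
  | mul (x y : RExp)
  | div (x y : RExp)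
  | exp (x : RExp)
  | pow (x y : RExp)
  | erf (x : RExp)

inductive Test where
  | intLE (i j : IExp)
  | realLE (x y : RExp)
  | not (b : Test)

/-- Programs. `draw a i` stores a fresh uniform number in entry `i` of the real array `a`;
`loop n b c` repeats `c` as long as `b` holds, but at most `n` times. -/
inductive Program where
  | skip
  | setInt (a : ℕ) (i v : IExp)
  | setReal (a : ℕ) (i : IExp) (v : RExp)
  | draw (a : ℕ) (i : IExp)
  | seq (c d : Program)
  | ite (b : Test) (c d : Program)
  | loop (n : IExp) (b : Test) (c : Program)

/-- The error function in the normalization `∫₀ˣ exp(-s²/2) ds`. -/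
def errorFunction (x : ℝ) : ℝ := ∫ s in (0 : ℝ)..x, Real.exp (-s ^ 2 / 2)

/-- `x ^ y` for a positive base `x`, and `0` otherwise. -/
def positivePow (x y : ℝ) : ℝ := if 0 < x then x ^ y else 0

def IExp.eval : IExp → Store → ℕ
  | .lit n, _ => n
  | .get a i, s => s.int a (i.eval s)
  | .add i j, s => i.eval s + j.eval s
  | .sub i j, s => i.eval s - j.eval s
  | .mul i j, s => i.eval s * j.eval s

/-- The time to evaluate an integer expression: one unit per node. -/
def IExp.cost : IExp → ℕ
  | .lit _ => 1
  | .get _ i => i.cost + 1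
  | .add i j => i.cost + j.cost + 1
  | .sub i j => i.cost + j.cost + 1
  | .mul i j => i.cost + j.cost + 1

def RExp.eval : RExp → Store → ℝ
  | .ofInt i, s => (i.eval s : ℝ)
  | .get a i, s => s.real a (i.eval s)
  | .add x y, s => x.eval s + y.eval s
  | .sub x y, s => x.eval s - y.eval s
  | .mul x y, s => x.eval s * y.eval s
  | .div x y, s => x.eval s / y.eval s
  | .exp x, s => Real.exp (x.eval s)
  | .pow x y, s => positivePow (x.eval s) (y.eval s)
  | .erf x, s => errorFunction (x.eval s)

/-- The time to evaluate a real expression: one unit per node. -/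
def RExp.cost : RExp → ℕ
  | .ofInt i => i.cost + 1
  | .get _ i => i.cost + 1
  | .add x y => x.cost + y.cost + 1
  | .sub x y => x.cost + y.cost + 1
  | .mul x y => x.cost + y.cost + 1
  | .div x y => x.cost + y.cost + 1
  | .exp x => x.cost + 1
  | .pow x y => x.cost + y.cost + 1
  | .erf x => x.cost + 1

def Test.Holds : Test → Store → Prop
  | .intLE i j, s => i.eval s ≤ j.eval s
  | .realLE x y, s => x.eval s ≤ y.eval s
  | .not b, s => ¬ b.Holds s

/-- The time to evaluate a test: one unit per node. -/
def Test.cost : Test → ℕ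
  | .intLE i j => i.cost + j.cost + 1
  | .realLE x y => x.cost + y.cost + 1
  | .not b => b.cost + 1

def Store.tick (s : Store) (k : ℕ) : Store := { s with time := s.time + k }

def Store.setInt (s : Store) (a i v : ℕ) : Store :=
  { s with int := Function.update s.int a (Function.update (s.int a) i v) }

def Store.setReal (s : Store) (a i : ℕ) (v : ℝ) : Store :=
  { s with real := Function.update s.real a (Function.update (s.real a) i v) }

open Classical in
/-- Repeat `body` while `b` holds, at most `n` times; every evaluation of `b` is paid for. -/
def whileUpTo (b : Test) (body : Store → Store) : ℕ → Store → Store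
  | 0, s => s
  | n + 1, s =>
    if b.Holds s then whileUpTo b body n (body (s.tick b.cost)) else s.tick b.cost

open Classical in
/-- The store after running a program, where `coins` is the sequence of uniform numbers that the
machine draws from. -/
def Program.exec (coins : ℕ → unitInterval) : Program → Store → Store
  | .skip, s => s.tick 1
  | .setInt a i v, s => (s.setInt a (i.eval s) (v.eval s)).tick (i.cost + v.cost + 1)
  | .setReal a i v, s => (s.setReal a (i.eval s) (v.eval s)).tick (i.cost + v.cost + 1)
  | .draw a i, s =>
    { s.setReal a (i.eval s) (coins s.drawn) with
      drawn := s.drawn + 1, time := s.time + i.cost + 1 }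
  | .seq c d, s => d.exec coins (c.exec coins s)
  | .ite b c d, s =>
    if b.Holds s then c.exec coins (s.tick b.cost) else d.exec coins (s.tick b.cost)
  | .loop n b c, s => whileUpTo b (c.exec coins) (n.eval s) (s.tick (n.cost + 1))

/-! ### Running a program on top of a base algorithm

The states are numbered `0, …, N - 1` by `e`. The integer arrays `0` and `1` hold `N` and the
horizon `T`, the real array `0` holds the diameter, and the real array `1` holds the distance matrix
(row by row). In each round the current loss vector is written to the real array `2`, and the
current state of the base algorithm to the integer array `2`; then the program is run, and it has to
leave the number of its new state in the integer array `3`. The memory is kept between rounds. -/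

section Overlay

variable {X : Type u} [Fintype X] [Nonempty X]

/-- The state with number `n`. -/
def decode (e : X ≃ Fin (Fintype.card X)) (n : ℕ) : X :=
  if h : n < Fintype.card X then e.symm ⟨n, h⟩ else Classical.arbitrary X

/-- The store before the first round. -/
def startStore [PseudoMetricSpace X] (e : X ≃ Fin (Fintype.card X)) (T : ℕ) : Store where
  int a i :=
    if a = 0 ∧ i = 0 then Fintype.card X
    else if a = 1 ∧ i = 0 then T
    else 0
  real a i :=
    if a = 0 ∧ i = 0 then Metric.diam (Set.univ : Set X)
    else if a = 1 ∧ i < Fintype.card X * Fintype.card X then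
      dist (decode e (i / Fintype.card X)) (decode e (i % Fintype.card X))
    else 0
  drawn := 0
  time := 0

/-- Write the loss vector `l` and the state `x` of the base algorithm into the store, and restart
the clock. -/
def feed (e : X ≃ Fin (Fintype.card X)) (l : X → ℝ) (x : X) (s : Store) : Store where
  int := Function.update s.int 2 (Function.update (s.int 2) 0 (e x : ℕ))
  real := Function.update s.real 2 (fun i => if i < Fintype.card X then l (decode e i) else 0)
  drawn := s.drawn
  time := 0

/-- The store at the end of the first `t` rounds, when the losses are `l 0, l 1, …` and the base
algorithm is in the states `x 0, x 1, …`. -/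
def runRounds [PseudoMetricSpace X] (P : Program) (e : X ≃ Fin (Fintype.card X)) (T : ℕ)
    (l : ℕ → X → ℝ) (x : ℕ → X) (coins : ℕ → unitInterval) : ℕ → Store
  | 0 => startStore e T
  | t + 1 => P.exec coins (feed e (l t) (x t) (runRounds P e T l x coins t))

/-- The time that the program uses in round `t`. -/
def overheadTime [PseudoMetricSpace X] (P : Program) (e : X ≃ Fin (Fintype.card X)) (T : ℕ)
    (l : ℕ → X → ℝ) (x : ℕ → X) (coins : ℕ → unitInterval) (t : ℕ) : ℕ :=
  (runRounds P e T l x coins (t + 1)).time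

end Overlay

/-! Measurability of the output of a program in the coins. -/

/-- All components of the store depend measurably on `ω`. -/
structure MeasurableStore {Ω : Type w} [MeasurableSpace Ω] (f : Ω → Store) : Prop where
  int : ∀ a i, Measurable fun ω => (f ω).int a i
  real : ∀ a i, Measurable fun ω => (f ω).real a i
  drawn : Measurable fun ω => (f ω).drawn
  time : Measurable fun ω => (f ω).time

section Measurability

variable {Ω : Type w} [MeasurableSpace Ω]

theorem measurable_pick {β : Type*} [MeasurableSpace β] {n : Ω → ℕ} {F : ℕ → Ω → β}
    (hn : Measurable n) (hF : ∀ k, Measurable (F k)) : Measurable fun ω => F (n ω) ω := by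
  have h : Measurable fun p : ℕ × Ω => F p.1 p.2 := measurable_from_prod_countable_right hF
  exact h.comp (hn.prodMk measurable_id)

theorem MeasurableStore.pick {n : Ω → ℕ} {F : ℕ → Ω → Store}
    (hn : Measurable n) (hF : ∀ k, MeasurableStore (F k)) :
    MeasurableStore fun ω => F (n ω) ω where
  int a i := measurable_pick (F := fun k ω => (F k ω).int a i) hn fun k => (hF k).int a i
  real a i := measurable_pick (F := fun k ω => (F k ω).real a i) hn fun k => (hF k).real a i
  drawn := measurable_pick (F := fun k ω => (F k ω).drawn) hn fun k => (hF k).drawn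
  time := measurable_pick (F := fun k ω => (F k ω).time) hn fun k => (hF k).time

open Classical in
theorem MeasurableStore.ite {p : Ω → Prop} {f g : Ω → Store} (hp : MeasurableSet {ω | p ω})
    (hf : MeasurableStore f) (hg : MeasurableStore g) :
    MeasurableStore fun ω => if p ω then f ω else g ω where
  int a i := by
    simpa only [apply_ite Store.int, ite_apply] using (hf.int a i).ite hp (hg.int a i)
  real a i := by
    simpa only [apply_ite Store.real, ite_apply] using (hf.real a i).ite hp (hg.real a i)
  drawn := by simpa only [apply_ite Store.drawn] using hf.drawn.ite hp hg.drawn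
  time := by simpa only [apply_ite Store.time] using hf.time.ite hp hg.time

theorem IExp.measurable_eval (i : IExp) {f : Ω → Store} (hf : MeasurableStore f) :
    Measurable fun ω => i.eval (f ω) := by
  induction i with
  | lit n => exact measurable_const
  | get a i ih => exact measurable_pick (F := fun k ω => (f ω).int a k) ih fun k => hf.int a k
  | add i j hi hj => exact hi.add hj
  | sub i j hi hj => exact hi.sub hj
  | mul i j hi hj => exact hi.mul hj

theorem continuous_errorFunction : Continuous errorFunction := by
  unfold errorFunction
  refine intervalIntegral.continuous_primitive (fun a b => ?_) 0
  exact Continuous.intervalIntegrable (by fun_prop) a b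

theorem RExp.measurable_eval (x : RExp) {f : Ω → Store} (hf : MeasurableStore f) :
    Measurable fun ω => x.eval (f ω) := by
  induction x with
  | ofInt i => exact (measurable_of_countable (fun n : ℕ => (n : ℝ))).comp (i.measurable_eval hf)
  | get a i =>
    exact measurable_pick (F := fun k ω => (f ω).real a k) (i.measurable_eval hf)
      fun k => hf.real a k
  | add x y hx hy => exact hx.add hy
  | sub x y hx hy => exact hx.sub hy
  | mul x y hx hy => exact hx.mul hy
  | div x y hx hy => exact hx.div hy
  | exp x hx => exact hx.exp
  | pow x y hx hy =>
    exact Measurable.ite (measurableSet_lt measurable_const hx) (hx.pow hy) measurable_const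
  | erf x hx => exact continuous_errorFunction.measurable.comp hx

theorem Test.measurableSet_holds (b : Test) {f : Ω → Store} (hf : MeasurableStore f) :
    MeasurableSet {ω | b.Holds (f ω)} := by
  induction b with
  | intLE i j => exact measurableSet_le (i.measurable_eval hf) (j.measurable_eval hf)
  | realLE x y => exact measurableSet_le (x.measurable_eval hf) (y.measurable_eval hf)
  | not b ih => exact ih.compl

theorem MeasurableStore.tick {f : Ω → Store} (hf : MeasurableStore f) (k : ℕ) :
    MeasurableStore fun ω => (f ω).tick k :=
  ⟨hf.int, hf.real, hf.drawn, hf.time.add measurable_const⟩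

theorem measurable_updateEntry {β : Type*} [MeasurableSpace β] {m : Ω → ℕ → ℕ → β} {n : Ω → ℕ}
    {v : Ω → β} (hm : ∀ a i, Measurable fun ω => m ω a i) (hn : Measurable n) (hv : Measurable v)
    (a b j : ℕ) :
    Measurable fun ω => Function.update (m ω) a (Function.update (m ω a) (n ω) (v ω)) b j := by
  by_cases hb : b = a
  · subst hb
    simp only [Function.update_self, Function.update_apply]
    exact Measurable.ite (measurableSet_eq_fun measurable_const hn) hv (hm b j)
  · simpa only [Function.update_of_ne hb] using hm b j

theorem MeasurableStore.setInt {f : Ω → Store} (hf : MeasurableStore f) (a : ℕ) {i v : Ω → ℕ}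
    (hi : Measurable i) (hv : Measurable v) :
    MeasurableStore fun ω => (f ω).setInt a (i ω) (v ω) :=
  ⟨fun b j => measurable_updateEntry hf.int hi hv a b j, hf.real, hf.drawn, hf.time⟩

theorem MeasurableStore.setReal {f : Ω → Store} (hf : MeasurableStore f) (a : ℕ) {i : Ω → ℕ}
    {v : Ω → ℝ} (hi : Measurable i) (hv : Measurable v) :
    MeasurableStore fun ω => (f ω).setReal a (i ω) (v ω) :=
  ⟨hf.int, fun b j => measurable_updateEntry hf.real hi hv a b j, hf.drawn, hf.time⟩

theorem MeasurableStore.whileUpTo (b : Test) {body : Ω → Store → Store}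
    (hbody : ∀ f : Ω → Store, MeasurableStore f → MeasurableStore fun ω => body ω (f ω))
    (n : ℕ) : ∀ f : Ω → Store, MeasurableStore f →
      MeasurableStore fun ω => whileUpTo b (body ω) n (f ω) := by
  induction n with
  | zero => exact fun f hf => hf
  | succ n ih =>
    intro f hf
    exact MeasurableStore.ite (b.measurableSet_holds hf)
      (ih _ (hbody _ (hf.tick b.cost))) (hf.tick b.cost)

theorem Program.measurable_exec (c : Program) {coins : Ω → ℕ → unitInterval}
    (hc : Measurable coins) : ∀ f : Ω → Store, MeasurableStore f →
      MeasurableStore fun ω => c.exec (coins ω) (f ω) := by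
  induction c with
  | skip => exact fun f hf => hf.tick 1
  | setInt a i v =>
    exact fun f hf => (hf.setInt a (i.measurable_eval hf) (v.measurable_eval hf)).tick _
  | setReal a i v =>
    exact fun f hf => (hf.setReal a (i.measurable_eval hf) (v.measurable_eval hf)).tick _
  | draw a i =>
    intro f hf
    have hv : Measurable fun ω => ((coins ω (f ω).drawn : unitInterval) : ℝ) :=
      measurable_subtype_coe.comp (measurable_pick (F := fun k ω => coins ω k) hf.drawn
        fun k => (measurable_pi_apply k).comp hc)
    have h := hf.setReal a (i.measurable_eval hf) hv
    exact ⟨h.int, h.real, hf.drawn.add measurable_const,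
      (hf.time.add measurable_const).add measurable_const⟩
  | seq c d ihc ihd => exact fun f hf => ihd _ (ihc f hf)
  | ite b c d ihc ihd =>
    exact fun f hf => MeasurableStore.ite (b.measurableSet_holds hf)
      (ihc _ (hf.tick b.cost)) (ihd _ (hf.tick b.cost))
  | loop n b c ih =>
    exact fun f hf => MeasurableStore.pick
      (F := fun k ω => _root_.whileUpTo b (c.exec (coins ω)) k ((f ω).tick (n.cost + 1)))
      (n.measurable_eval hf) fun k => MeasurableStore.whileUpTo b ih k _ (hf.tick _)

theorem measurable_runRounds {X : Type u} [Fintype X] [Nonempty X] [PseudoMetricSpace X]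
    (P : Program) (e : X ≃ Fin (Fintype.card X)) (T : ℕ) (l : ℕ → X → ℝ) {x : Ω → ℕ → X}
    (hx : ∀ t y, MeasurableSet {ω | x ω t = y}) {coins : Ω → ℕ → unitInterval}
    (hc : Measurable coins) (t : ℕ) :
    MeasurableStore fun ω => runRounds P e T l (x ω) (coins ω) t := by
  induction t with
  | zero => exact ⟨fun _ _ => measurable_const, fun _ _ => measurable_const, measurable_const,
      measurable_const⟩
  | succ t ih =>
    have hcode : Measurable fun ω => ((e (x ω t) : Fin _) : ℕ) := by
      let _ : MeasurableSpace X := ⊤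
      have h : Measurable fun ω => x ω t := measurable_to_countable' fun y => hx t y
      exact (measurable_of_countable fun y : X => ((e y : Fin _) : ℕ)).comp h
    refine P.measurable_exec hc _ ⟨fun a i => ?_, fun a i => ?_, ih.drawn, measurable_const⟩
    · exact measurable_updateEntry ih.int measurable_const hcode 2 a i
    · by_cases ha : a = 2
      · subst ha
        simp only [feed, Function.update_self]
        exact measurable_const
      · simpa only [feed, Function.update_of_ne ha] using ih.real a i

end Measurability

theorem runRounds_congr {X : Type u} [Fintype X] [Nonempty X] [PseudoMetricSpace X]
    (P : Program) (e : X ≃ Fin (Fintype.card X)) (T : ℕ) {l l' : ℕ → X → ℝ} {x x' : ℕ → X}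
    (coins : ℕ → unitInterval) (t : ℕ) (hl : ∀ s < t, l s = l' s) (hx : ∀ s < t, x s = x' s) :
    runRounds P e T l x coins t = runRounds P e T l' x' coins t := by
  induction t with
  | zero => rfl
  | succ t ih =>
    simp only [runRounds]
    rw [ih (fun s hs => hl s (by omega)) (fun s hs => hx s (by omega)), hl t (by omega),
      hx t (by omega)]

/-- The online algorithm that runs `B` as a black box, runs the program `P` on top of it with
independent uniform coins, and moves to the state that `P` outputs. -/
def overlay {X : Type u} [Fintype X] [Nonempty X] [PseudoMetricSpace X] {M : MTS X}
    (P : Program) (e : X ≃ Fin (Fintype.card X)) (T : ℕ) (B : OnlineAlgorithm.{u, w} M) :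
    OnlineAlgorithm.{u, w} M where
  Seed := B.Seed × (ℕ → unitInterval)
  law := B.law.prod (Measure.infinitePi fun _ => volume)
  act l t ω := decode e
    ((runRounds P e T (fun s => (l s : X → ℝ)) (fun s => B.act l s ω.1) ω.2 (t + 1)).int 3 0)
  causal l l' t h := by
    funext ω
    rw [runRounds_congr P e T ω.2 (t + 1) (fun s hs => by rw [h s (by omega)])
      (fun s hs => congrFun (B.causal l l' s fun r hr => h r (by omega)) ω.1)]
  measurable_act l t x := by
    have h := (measurable_runRounds P e T (fun s => (l s : X → ℝ))
      (x := fun (ω : B.Seed × (ℕ → unitInterval)) s => B.act l s ω.1) (coins := Prod.snd)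
      (fun s y => measurable_fst (B.measurable_act l s y)) measurable_snd (t + 1)).int 3 0
    exact h (MeasurableSet.of_discrete (s := {n | decode e n = x}))

end

/-!
Fix a time scale `q` and cut the rounds into windows of length `q`. On each window, follow the
perturbed leader: with a learning rate `η` and independent uniform variables `u x`, play the state
`x` that minimizes `log (u x + 1 / N)` plus `η` times its cumulative loss on the window, including
the current loss. This path competes with every fixed state on the window, and it moves rarely.

A base path `b` and an expert `e` are mixed by a bias that starts every window at a tiny weight `w`
and is multiplied by the exponential of `θ` times the current advantage of `e` over `b`. The mixture
plays `e` while the bias is at least one uniform threshold, which is drawn only once. A potential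
function of the bias measures how far it is ahead of `b` and pays for its moves between `b` and `e`.
Hence it costs in expectation at most `O((1 + D) w / θ)` per round more than `b`, and on a window at
most `O((1 + D) (log (1 / w) / θ + q θ))` more than `e`.

Starting from the base algorithm, mix in the perturbed leaders of the time scales `2 ^ j`, from the
coarsest to the finest, with `w = 1 / T ^ 3`. Each layer adds `O((1 + D) / T ^ 2)` per round to the
cost of the layers below it, and thus all of them together add a constant: the competitive ratio of
the base algorithm survives, and so does the regret of each layer on its own windows. Every interval
is a disjoint union of such windows whose lengths first grow and then shrink geometrically, and so
their regrets sum up to that of a single window of the length of the interval.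

One round updates `N` weights and one bias for each of the `O(log T)` time scales.
-/

/-! ### A uniform threshold -/

theorem measurable_ite_coe_le {β : Type*} [MeasurableSpace β] (c : ℝ) (x y : β) :
    Measurable fun u : unitInterval => if (u : ℝ) ≤ c then x else y :=
  Measurable.ite (measurableSet_le measurable_subtype_coe measurable_const) measurable_const
    measurable_const

theorem volume_real_coe_le {c : ℝ} (hc : 0 ≤ c) :
    volume.real {u : unitInterval | (u : ℝ) ≤ c} = min 1 c := by
  have hset : {u : unitInterval | (u : ℝ) ≤ c}
      = Set.Iic ⟨min 1 c, le_min zero_le_one hc, min_le_left _ _⟩ := by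
    ext u
    simp [← Subtype.coe_le_coe, u.2.2]
  rw [hset, measureReal_def, unitInterval.volume_Iic, ENNReal.toReal_ofReal (le_min zero_le_one hc)]

theorem integrable_ite_coe_le (c x y : ℝ) :
    Integrable fun u : unitInterval => if (u : ℝ) ≤ c then x else y := by
  refine Integrable.of_bound (measurable_ite_coe_le c x y).aestronglyMeasurable (max ‖x‖ ‖y‖)
    (Filter.Eventually.of_forall fun u => ?_)
  split_ifs
  exacts [le_max_left _ _, le_max_right _ _]

theorem integral_ite_coe_le {c : ℝ} (hc : 0 ≤ c) (x y : ℝ) :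
    ∫ u : unitInterval, (if (u : ℝ) ≤ c then x else y) = min 1 c * x + (1 - min 1 c) * y := by
  have hs : MeasurableSet {u : unitInterval | (u : ℝ) ≤ c} :=
    measurableSet_le measurable_subtype_coe measurable_const
  have hfun : (fun u : unitInterval => if (u : ℝ) ≤ c then x else y)
      = fun u => Set.indicator {u : unitInterval | (u : ℝ) ≤ c} (fun _ => x - y) u + y := by
    funext u
    by_cases h : (u : ℝ) ≤ c <;> simp [Set.indicator, h]
  rw [hfun, integral_add ((integrable_const _).indicator hs) (integrable_const _),
    integral_indicator_const _ hs, volume_real_coe_le hc, integral_const, probReal_univ,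
    smul_eq_mul, one_smul]
  ring

theorem integral_abs_ite_coe_le_sub {c c' : ℝ} (hc : 0 ≤ c) (hc' : 0 ≤ c') :
    ∫ u : unitInterval, |(if (u : ℝ) ≤ c' then (1 : ℝ) else 0) - (if (u : ℝ) ≤ c then 1 else 0)|
      = |min 1 c' - min 1 c| := by
  wlog h : c ≤ c' generalizing c c'
  · simpa only [abs_sub_comm] using this hc' hc (le_of_not_ge h)
  have hsign (u : unitInterval) :
      0 ≤ (if (u : ℝ) ≤ c' then (1 : ℝ) else 0) - (if (u : ℝ) ≤ c then 1 else 0) := by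
    split_ifs <;> linarith
  simp only [abs_of_nonneg (hsign _)]
  rw [integral_sub (integrable_ite_coe_le _ _ _) (integrable_ite_coe_le _ _ _),
    integral_ite_coe_le hc, integral_ite_coe_le hc',
    abs_of_nonneg (sub_nonneg.2 (min_le_min le_rfl h))]
  ring

/-! ### Periodically restarted exponential weights -/

/-- The weight `w * exp (∑ z s)`, the sum being over the rounds `s` from the last multiple of `q`
until `t`. It is the state of a multiplicative update that is restarted from `w` every `q`
rounds. -/
noncomputable def restartedExp (q : ℕ) (w : ℝ) (z : ℕ → ℝ) (t : ℕ) : ℝ :=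
  w * Real.exp (∑ s ∈ Finset.Ico (q * (t / q)) (t + 1), z s)

theorem restartedExp_of_mod_eq_zero {q : ℕ} (w : ℝ) (z : ℕ → ℝ) {t : ℕ} (h : t % q = 0) :
    restartedExp q w z t = w * Real.exp (z t) := by
  simp [restartedExp, Nat.mul_div_cancel' (Nat.dvd_of_mod_eq_zero h)]

theorem restartedExp_succ {q : ℕ} (w : ℝ) (z : ℕ → ℝ) {t : ℕ} (h : (t + 1) % q ≠ 0) :
    restartedExp q w z (t + 1) = restartedExp q w z t * Real.exp (z (t + 1)) := by
  have hdiv : (t + 1) / q = t / q := by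
    simp [Nat.succ_div, Nat.dvd_iff_mod_eq_zero, h]
  rw [restartedExp, restartedExp, hdiv,
    Finset.sum_Ico_succ_top ((Nat.mul_div_le t q).trans t.le_succ), Real.exp_add, mul_assoc]

theorem restartedExp_add {q a k : ℕ} (w : ℝ) (z : ℕ → ℝ) (ha : q ∣ a) (hk : k < q) :
    restartedExp q w z (a + k) = w * Real.exp (∑ t ∈ Finset.Ico a (a + (k + 1)), z t) := by
  have hstart : q * ((a + k) / q) = a := by
    rw [Nat.add_div_of_dvd_right ha, Nat.div_eq_of_lt hk, add_zero, Nat.mul_div_cancel' ha]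
  rw [restartedExp, hstart, add_assoc]

theorem restartedExp_pos (q : ℕ) {w : ℝ} (hw : 0 < w) (z : ℕ → ℝ) (t : ℕ) :
    0 < restartedExp q w z t :=
  mul_pos hw (Real.exp_pos _)

theorem measurable_restartedExp {Ω : Type*} [MeasurableSpace Ω] (q : ℕ) {v : Ω → ℝ}
    {z : Ω → ℕ → ℝ} (hv : Measurable v) (hz : ∀ t, Measurable fun ω => z ω t) (t : ℕ) :
    Measurable fun ω => restartedExp q (v ω) (z ω) t :=
  hv.mul (Finset.measurable_fun_sum _ fun s _ => hz s).exp

/-! ### The potential of a bias -/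

/-- The antiderivative of `x ↦ min 1 (exp x)` that vanishes at `-∞`, in terms of `y = exp x`. It is
the potential function of a mixture that plays an expert with probability `min 1 y`. -/
noncomputable def biasPotential (y : ℝ) : ℝ := if y ≤ 1 then y else 1 + Real.log y

theorem min_one_le_biasPotential (y : ℝ) : min 1 y ≤ biasPotential y := by
  unfold biasPotential
  split_ifs with h
  · exact min_le_right _ _
  · exact (min_le_left _ _).trans (by linarith [Real.log_nonneg (le_of_not_ge h)])

theorem biasPotential_eq (y : ℝ) :
    biasPotential y = min 1 y * (1 + Real.log y - Real.log (min 1 y)) := by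
  unfold biasPotential
  split_ifs with h
  · rw [min_eq_right h]
    ring
  · rw [min_eq_left (le_of_not_ge h), Real.log_one]
    ring

/- With `biasPotential_eq`, this exhibits the potential as a supremum of affine functions of
`log y`, that is, as a convex function of `log y` with derivative `min 1 y`. -/
theorem mul_one_add_log_sub_le_biasPotential {p y : ℝ} (hp : 0 < p) (hp1 : p ≤ 1) (hy : 0 < y) :
    p * (1 + Real.log y - Real.log p) ≤ biasPotential y := by
  have log_le (x : ℝ) (hx : 0 < x) : p * (Real.log x - Real.log p) ≤ x - p := by
    have h := Real.log_le_sub_one_of_pos (div_pos hx hp)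
    rw [Real.log_div hx.ne' hp.ne', div_sub_one hp.ne', le_div_iff₀ hp] at h
    linarith
  unfold biasPotential
  split_ifs with h
  · linarith [log_le y hy]
  · have hlog := mul_nonneg (sub_nonneg.2 hp1) (Real.log_nonneg (le_of_not_ge h))
    have hone := log_le 1 one_pos
    rw [Real.log_one] at hone
    linarith

theorem biasPotential_mul_exp_sub_le {y : ℝ} (hy : 0 < y) (z : ℝ) :
    biasPotential (y * Real.exp z) - biasPotential y ≤ min 1 (y * Real.exp z) * z := by
  have hpos : 0 < y * Real.exp z := mul_pos hy (Real.exp_pos z)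
  have htangent := mul_one_add_log_sub_le_biasPotential (lt_min one_pos hpos) (min_le_left _ _) hy
  rw [biasPotential_eq, Real.log_mul hy.ne' (Real.exp_pos z).ne', Real.log_exp]
  linarith

theorem abs_min_one_sub_min_one_mul_le {y r θ : ℝ} (hy : 0 ≤ y) (hθ : θ ≤ 1) (hr : |r - 1| ≤ θ) :
    |min 1 y - min 1 (y * r)| ≤ θ * min 1 y := by
  obtain ⟨hlow, hupp⟩ := abs_le.1 hr
  have hlower : (1 - θ) * min 1 y ≤ min 1 (y * r) := by
    rw [mul_min_of_nonneg _ _ (by linarith), mul_comm y r]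
    exact min_le_min (by linarith) (mul_le_mul_of_nonneg_right (by linarith) hy)
  have hupper : min 1 (y * r) ≤ (1 + θ) * min 1 y := by
    rw [mul_min_of_nonneg _ _ (by linarith), mul_comm y r]
    exact min_le_min (by linarith) (mul_le_mul_of_nonneg_right (by linarith) hy)
  rw [abs_le]
  constructor <;> linarith

theorem abs_min_one_mul_exp_sub_le {y z θ : ℝ} (hy : 0 ≤ y) (hθ : θ ≤ 1) (hz : |z| ≤ θ / 2) :
    |min 1 (y * Real.exp z) - min 1 y| ≤ θ * min 1 (y * Real.exp z) := by
  have hexp : |Real.exp (-z) - 1| ≤ θ := by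
    have h := Real.abs_exp_sub_one_le (x := -z) (by rw [abs_neg]; linarith)
    rw [abs_neg] at h
    linarith
  have h := abs_min_one_sub_min_one_mul_le (mul_nonneg hy (Real.exp_pos z).le) hθ hexp
  rwa [mul_assoc, ← Real.exp_add, add_neg_cancel, Real.exp_zero, mul_one] at h

/-! ### Path costs -/

section Loss

variable {X : Type*} {M : MTS X} (l : ℕ → M.losses)

theorem loss_nonneg (t : ℕ) (x : X) : 0 ≤ (l t : X → ℝ) x := (M.bounded _ (l t).2 x).1

theorem loss_le_one (t : ℕ) (x : X) : (l t : X → ℝ) x ≤ 1 := (M.bounded _ (l t).2 x).2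

variable [Countable X] [MeasurableSpace X] [MeasurableSingletonClass X]
  {Ω : Type*} [MeasurableSpace Ω] {p : Ω → ℕ → X}

theorem measurable_loss (hp : ∀ t, Measurable fun ω => p ω t) (t : ℕ) :
    Measurable fun ω => (l t : X → ℝ) (p ω t) :=
  (measurable_of_countable (l t : X → ℝ)).comp (hp t)

theorem integrable_loss (μ : Measure Ω) [IsFiniteMeasure μ]
    (hp : ∀ t, Measurable fun ω => p ω t) (t : ℕ) :
    Integrable (fun ω => (l t : X → ℝ) (p ω t)) μ :=
  Integrable.of_bound (measurable_loss l hp t).aestronglyMeasurable 1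
    (Filter.Eventually.of_forall fun ω => by
      rw [Real.norm_of_nonneg (loss_nonneg l t _)]
      exact loss_le_one l t _)

end Loss

/-- The diameter `D` of the space of states. -/
noncomputable abbrev diameter (X : Type*) [PseudoMetricSpace X] : ℝ :=
  Metric.diam (Set.univ : Set X)

section PathCost

variable {X : Type*} [PseudoMetricSpace X] {M : MTS X} (l : ℕ → M.losses)

theorem pathCost_zero (p : ℕ → X) (a : ℕ) : pathCost l p a 0 = 0 := by simp [pathCost]

theorem pathCost_one (p : ℕ → X) (a : ℕ) : pathCost l p a 1 = (l a : X → ℝ) (p a) := by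
  simp [pathCost]

theorem pathCost_add_two (p : ℕ → X) (a k : ℕ) :
    pathCost l p a (k + 2) = pathCost l p a (k + 1)
      + ((l (a + k + 1) : X → ℝ) (p (a + k + 1)) + dist (p (a + k + 1)) (p (a + k))) := by
  unfold pathCost
  rw [← Nat.add_assoc a (k + 1) 1, ← Nat.add_assoc a k 1,
    Finset.sum_Ico_succ_top (by omega : a ≤ a + k + 1),
    Finset.sum_Ico_succ_top (by omega : a + 1 ≤ a + k + 1), Nat.add_sub_cancel]
  ring

theorem pathCost_nonneg (p : ℕ → X) (a k : ℕ) : 0 ≤ pathCost l p a k :=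
  add_nonneg (Finset.sum_nonneg fun t _ => loss_nonneg l t _)
    (Finset.sum_nonneg fun _ _ => dist_nonneg)

variable [BoundedSpace X]

theorem dist_le_diameter (x y : X) : dist x y ≤ diameter X :=
  Metric.dist_le_diam_of_mem (Bornology.IsBounded.all _) (Set.mem_univ x) (Set.mem_univ y)

theorem pathCost_le (p : ℕ → X) (a k : ℕ) : pathCost l p a k ≤ (1 + diameter X) * k := by
  have hD : 0 ≤ diameter X := Metric.diam_nonneg
  have hloss := Finset.sum_le_card_nsmul (Finset.Ico a (a + k)) (fun t => (l t : X → ℝ) (p t)) 1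
    fun t _ => loss_le_one l t _
  have hmove := Finset.sum_le_card_nsmul (Finset.Ico (a + 1) (a + k))
    (fun t => dist (p t) (p (t - 1))) (diameter X) fun t _ => dist_le_diameter _ _
  have hcard : ((a + k - (a + 1) : ℕ) : ℝ) * diameter X ≤ k * diameter X := by
    gcongr
    omega
  rw [Nat.card_Ico, Nat.add_sub_cancel_left, nsmul_eq_mul] at hloss
  rw [Nat.card_Ico, nsmul_eq_mul] at hmove
  unfold pathCost
  linarith

theorem abs_pathCost_le (p : ℕ → X) (a k : ℕ) : |pathCost l p a k| ≤ (1 + diameter X) * k := by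
  rw [abs_of_nonneg (pathCost_nonneg l p a k)]
  exact pathCost_le l p a k

theorem pathCost_add_le (p : ℕ → X) (a k n : ℕ) :
    pathCost l p a (k + n) ≤ pathCost l p a k + pathCost l p (a + k) n + diameter X := by
  have hD : 0 ≤ diameter X := Metric.diam_nonneg
  rcases Nat.eq_zero_or_pos k with rfl | hk
  · simp [pathCost_zero, hD]
  rcases Nat.eq_zero_or_pos n with rfl | hn
  · simp [pathCost_zero, hD]
  unfold pathCost
  rw [← Nat.add_assoc a k n,
    ← Finset.sum_Ico_consecutive (fun t => (l t : X → ℝ) (p t)) (by omega : a ≤ a + k)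
      (by omega : a + k ≤ a + k + n),
    ← Finset.sum_Ico_consecutive (fun t => dist (p t) (p (t - 1))) (by omega : a + 1 ≤ a + k)
      (by omega : a + k ≤ a + k + n),
    Finset.sum_eq_sum_Ico_succ_bot (by omega : a + k < a + k + n)
      (fun t => dist (p t) (p (t - 1)))]
  linarith [dist_le_diameter (p (a + k)) (p (a + k - 1))]

end PathCost

section RandomPath

variable {X : Type*} [PseudoMetricSpace X] [Countable X] [MeasurableSpace X]
  [MeasurableSingletonClass X] {M : MTS X} (l : ℕ → M.losses)
  {Ω : Type*} [MeasurableSpace Ω] {p : Ω → ℕ → X}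

theorem measurable_dist_of_countable {x y : Ω → X} (hx : Measurable x) (hy : Measurable y) :
    Measurable fun ω => dist (x ω) (y ω) :=
  (measurable_of_countable fun z : X × X => dist z.1 z.2).comp (hx.prodMk hy)

theorem measurable_pathCost (hp : ∀ t, Measurable fun ω => p ω t) (a k : ℕ) :
    Measurable fun ω => pathCost l (p ω) a k :=
  (Finset.measurable_fun_sum _ fun t _ => measurable_loss l hp t).add
    (Finset.measurable_fun_sum _ fun t _ => measurable_dist_of_countable (hp t) (hp (t - 1)))

variable [BoundedSpace X] (μ : Measure Ω) [IsFiniteMeasure μ]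

theorem integrable_dist_of_countable {x y : Ω → X} (hx : Measurable x) (hy : Measurable y) :
    Integrable (fun ω => dist (x ω) (y ω)) μ :=
  Integrable.of_bound (measurable_dist_of_countable hx hy).aestronglyMeasurable (diameter X)
    (Filter.Eventually.of_forall fun ω => by
      rw [Real.norm_of_nonneg dist_nonneg]
      exact dist_le_diameter _ _)

theorem integrable_pathCost (hp : ∀ t, Measurable fun ω => p ω t) (a k : ℕ) :
    Integrable (fun ω => pathCost l (p ω) a k) μ :=
  Integrable.of_bound (measurable_pathCost l hp a k).aestronglyMeasurable
    ((1 + diameter X) * k) (Filter.Eventually.of_forall fun ω => abs_pathCost_le l (p ω) a k)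

theorem integral_pathCost_add_two (hp : ∀ t, Measurable fun ω => p ω t) (a k : ℕ) :
    ∫ ω, pathCost l (p ω) a (k + 2) ∂μ
      = ∫ ω, pathCost l (p ω) a (k + 1) ∂μ
        + (∫ ω, (l (a + k + 1) : X → ℝ) (p ω (a + k + 1)) ∂μ
          + ∫ ω, dist (p ω (a + k + 1)) (p ω (a + k)) ∂μ) := by
  have hloss := integrable_loss l μ hp (a + k + 1)
  have hmove := integrable_dist_of_countable μ (hp (a + k + 1)) (hp (a + k))
  have hround : Integrable (fun ω => (l (a + k + 1) : X → ℝ) (p ω (a + k + 1))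
      + dist (p ω (a + k + 1)) (p ω (a + k))) μ := hloss.add hmove
  simp only [pathCost_add_two]
  rw [integral_add (integrable_pathCost l μ hp _ _) hround, integral_add hloss hmove]

end RandomPath

/-! ### Mixing two paths -/

section Mix

variable {X : Type*} [PseudoMetricSpace X] {M : MTS X} (l : ℕ → M.losses)

/-- The cost of the path `p` in round `t`, not counting the move into a window of `q` rounds that
starts at a multiple of `q`. -/
noncomputable def windowCost (q : ℕ) (p : ℕ → X) (t : ℕ) : ℝ :=
  (l t : X → ℝ) (p t) + if t % q = 0 then 0 else dist (p t) (p (t - 1))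

/-- The gain in round `t` from playing `e` instead of `b`, less a charge for switching, scaled so
that it is at most `θ / 2` in absolute value. -/
noncomputable def advantage (q : ℕ) (θ : ℝ) (b e : ℕ → X) (t : ℕ) : ℝ :=
  θ * (windowCost l q b t - windowCost l q e t - diameter X * θ) / (4 * (1 + diameter X))

/-- The bias of a mixture of the paths `b` and `e` towards `e`. -/
noncomputable def bias (q : ℕ) (w θ : ℝ) (b e : ℕ → X) : ℕ → ℝ :=
  restartedExp q w (advantage l q θ b e)

/-- The mixture of the paths `b` and `e` with threshold `v`: it plays `e` while the bias is at least
`v`. For a uniform threshold, it plays `e` with probability `min 1` of the bias. -/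
noncomputable def mix (q : ℕ) (w θ : ℝ) (b e : ℕ → X) (v : unitInterval) (t : ℕ) : X :=
  if (v : ℝ) ≤ bias l q w θ b e t then e t else b t

/-- The amount by which a mixture of the paths `b` and `e` is ahead of `b`. -/
noncomputable def potential (q : ℕ) (w θ : ℝ) (b e : ℕ → X) (t : ℕ) : ℝ :=
  4 * (1 + diameter X) / θ * biasPotential (bias l q w θ b e t)

/-- A bound for the cost of a mixture relative to its first path, per round. -/
noncomputable def leak (X : Type*) [PseudoMetricSpace X] (w θ : ℝ) : ℝ :=
  w * (4 * (1 + diameter X) / θ + 4 * diameter X)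

theorem leak_nonneg {w θ : ℝ} (hw : 0 ≤ w) (hθ : 0 ≤ θ) : 0 ≤ leak X w θ := by
  unfold leak
  positivity

theorem windowCost_of_mod_eq_zero {q t : ℕ} (ht : t % q = 0) (p : ℕ → X) :
    windowCost l q p t = (l t : X → ℝ) (p t) := by
  simp [windowCost, ht]

theorem windowCost_of_mod_ne_zero {q t : ℕ} (ht : t % q ≠ 0) (p : ℕ → X) :
    windowCost l q p t = (l t : X → ℝ) (p t) + dist (p t) (p (t - 1)) := by
  simp [windowCost, ht]

theorem windowCost_nonneg (q : ℕ) (p : ℕ → X) (t : ℕ) : 0 ≤ windowCost l q p t := by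
  refine add_nonneg (loss_nonneg l t _) ?_
  split_ifs
  exacts [le_rfl, dist_nonneg]

theorem sum_windowCost {q a k : ℕ} (ha : q ∣ a) (hk : k ≤ q) (p : ℕ → X) :
    ∑ t ∈ Finset.Ico a (a + k), windowCost l q p t = pathCost l p a k := by
  rcases Nat.eq_zero_or_pos k with rfl | hpos
  · simp [pathCost_zero]
  have hmove : ∑ t ∈ Finset.Ico (a + 1) (a + k),
      (if t % q = 0 then 0 else dist (p t) (p (t - 1)))
        = ∑ t ∈ Finset.Ico (a + 1) (a + k), dist (p t) (p (t - 1)) := by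
    refine Finset.sum_congr rfl fun t ht => if_neg fun hmod => ?_
    obtain ⟨hat, htk⟩ := Finset.mem_Ico.1 ht
    have hle := Nat.le_of_dvd (by omega) (Nat.dvd_sub (Nat.dvd_of_mod_eq_zero hmod) ha)
    omega
  unfold windowCost pathCost
  rw [Finset.sum_add_distrib, Finset.sum_eq_sum_Ico_succ_bot (by omega : a < a + k)
    (fun t => if t % q = 0 then 0 else dist (p t) (p (t - 1))), hmove,
    if_pos (Nat.mod_eq_zero_of_dvd ha), zero_add]

section Bounded

variable [BoundedSpace X]

theorem windowCost_le (q : ℕ) (p : ℕ → X) (t : ℕ) : windowCost l q p t ≤ 1 + diameter X := by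
  refine add_le_add (loss_le_one l t _) ?_
  split_ifs
  exacts [Metric.diam_nonneg, dist_le_diameter _ _]

theorem abs_advantage_le (q : ℕ) {θ : ℝ} (hθ : 0 ≤ θ) (hθ1 : θ ≤ 1) (b e : ℕ → X) (t : ℕ) :
    |advantage l q θ b e t| ≤ θ / 2 := by
  have hD : 0 ≤ diameter X := Metric.diam_nonneg
  have hgain : |windowCost l q b t - windowCost l q e t - diameter X * θ|
      ≤ 2 * (1 + diameter X) := by
    have hcharge : diameter X * θ ≤ diameter X := mul_le_of_le_one_right hD hθ1
    have hcharge_nonneg : 0 ≤ diameter X * θ := mul_nonneg hD hθ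
    rw [abs_le]
    constructor <;> linarith [windowCost_nonneg l q b t, windowCost_nonneg l q e t,
      windowCost_le l q b t, windowCost_le l q e t]
  unfold advantage
  rw [abs_div, abs_of_pos (by linarith : (0 : ℝ) < 4 * (1 + diameter X)),
    div_le_iff₀ (by linarith), abs_mul, abs_of_nonneg hθ]
  linarith [mul_le_mul_of_nonneg_left hgain hθ]

theorem bias_le_of_mod_eq_zero {q : ℕ} {w θ : ℝ} (hw : 0 ≤ w) (hθ : 0 ≤ θ) (hθ1 : θ ≤ 1)
    (b e : ℕ → X) {t : ℕ} (ht : t % q = 0) : bias l q w θ b e t ≤ 2 * w := by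
  have hadv := abs_advantage_le l q hθ hθ1 b e t
  have hexp := (abs_le.1 (Real.abs_exp_sub_one_le (hadv.trans (by linarith)))).2
  rw [bias, restartedExp_of_mod_eq_zero _ _ ht, mul_comm 2 w]
  exact mul_le_mul_of_nonneg_left (by linarith) hw

theorem abs_min_one_bias_succ_sub_le {q : ℕ} {w θ : ℝ} (hw : 0 < w) (hθ : 0 ≤ θ) (hθ1 : θ ≤ 1)
    (b e : ℕ → X) {t : ℕ} (ht : (t + 1) % q ≠ 0) :
    |min 1 (bias l q w θ b e (t + 1)) - min 1 (bias l q w θ b e t)|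
      ≤ θ * min 1 (bias l q w θ b e (t + 1)) := by
  rw [bias, restartedExp_succ _ _ ht]
  exact abs_min_one_mul_exp_sub_le (restartedExp_pos q hw _ t).le hθ1
    (abs_advantage_le l q hθ hθ1 b e (t + 1))

theorem dist_mix_succ_le (q : ℕ) (w θ : ℝ) (b e : ℕ → X) (t : ℕ) (v : unitInterval) :
    dist (mix l q w θ b e v (t + 1)) (mix l q w θ b e v t)
      ≤ (if (v : ℝ) ≤ bias l q w θ b e (t + 1) then dist (e (t + 1)) (e t)
          else dist (b (t + 1)) (b t))
        + diameter X * |(if (v : ℝ) ≤ bias l q w θ b e (t + 1) then (1 : ℝ) else 0)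
          - (if (v : ℝ) ≤ bias l q w θ b e t then 1 else 0)| := by
  unfold mix
  split_ifs
  · simp
  · rw [sub_zero, abs_one, mul_one]
    linarith [dist_le_diameter (e (t + 1)) (b t), dist_nonneg (x := e (t + 1)) (y := e t)]
  · rw [zero_sub, abs_neg, abs_one, mul_one]
    linarith [dist_le_diameter (b (t + 1)) (e t), dist_nonneg (x := b (t + 1)) (y := b t)]
  · simp

end Bounded

theorem integral_loss_mix (q : ℕ) {w : ℝ} (θ : ℝ) (hw : 0 < w) (b e : ℕ → X) (t : ℕ) :
    ∫ v, (l t : X → ℝ) (mix l q w θ b e v t)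
      = min 1 (bias l q w θ b e t) * (l t : X → ℝ) (e t)
        + (1 - min 1 (bias l q w θ b e t)) * (l t : X → ℝ) (b t) := by
  simp only [mix, apply_ite]
  exact integral_ite_coe_le (restartedExp_pos q hw _ t).le _ _

section Potential

variable {q : ℕ} {w θ : ℝ} (b e : ℕ → X) {t : ℕ}

theorem mul_advantage (hθ : 0 < θ) (b e : ℕ → X) (t : ℕ) :
    4 * (1 + diameter X) / θ * advantage l q θ b e t
      = windowCost l q b t - windowCost l q e t - diameter X * θ := by
  unfold advantage
  field_simp

theorem potential_sub_le {y : ℝ} (hθ : 0 < θ) (hy : 0 < y)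
    (hbias : bias l q w θ b e t = y * Real.exp (advantage l q θ b e t)) :
    potential l q w θ b e t - 4 * (1 + diameter X) / θ * biasPotential y
      ≤ min 1 (bias l q w θ b e t)
        * (windowCost l q b t - windowCost l q e t - diameter X * θ) := by
  have hstep := biasPotential_mul_exp_sub_le hy (advantage l q θ b e t)
  rw [potential, ← mul_sub, ← mul_advantage l hθ b e t, mul_left_comm, hbias]
  exact mul_le_mul_of_nonneg_left hstep (by positivity)

theorem potential_le_of_mod_eq_zero (hw : 0 < w) (hw1 : w ≤ 1) (hθ : 0 < θ) (ht : t % q = 0) :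
    potential l q w θ b e t
      ≤ min 1 (bias l q w θ b e t) * ((l t : X → ℝ) (b t) - (l t : X → ℝ) (e t))
        + 4 * (1 + diameter X) / θ * w := by
  have hD : 0 ≤ diameter X := Metric.diam_nonneg
  have hstep := potential_sub_le l b e hθ hw
    (restartedExp_of_mod_eq_zero w (advantage l q θ b e) ht)
  rw [biasPotential, if_pos hw1, windowCost_of_mod_eq_zero l ht, windowCost_of_mod_eq_zero l ht,
    mul_sub] at hstep
  have hcharge : 0 ≤ min 1 (bias l q w θ b e t) * (diameter X * θ) :=
    mul_nonneg (le_min zero_le_one (restartedExp_pos q hw _ t).le) (mul_nonneg hD hθ.le)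
  linarith

theorem diameter_mul_min_one_bias_le_potential (hw : 0 < w) (hθ : 0 < θ) (hθ1 : θ ≤ 1) :
    diameter X * min 1 (bias l q w θ b e t) ≤ potential l q w θ b e t := by
  have hD : 0 ≤ diameter X := Metric.diam_nonneg
  have hrate : diameter X ≤ 4 * (1 + diameter X) / θ := by
    rw [le_div_iff₀ hθ]
    linarith [mul_le_of_le_one_right hD hθ1]
  exact mul_le_mul hrate (min_one_le_biasPotential _)
    (le_min zero_le_one (restartedExp_pos q hw _ t).le) (hD.trans hrate)

theorem pathCost_sub_le_potential (hw : 0 < w) (hθ : 0 < θ) {a k : ℕ} (ha : q ∣ a)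
    (hk : k + 1 ≤ q) :
    pathCost l b a (k + 1) - pathCost l e a (k + 1) - (k + 1) * (diameter X * θ)
        - 4 * (1 + diameter X) / θ * Real.log (1 / w)
      ≤ potential l q w θ b e (a + k) := by
  have hlog : ∑ t ∈ Finset.Ico a (a + (k + 1)), advantage l q θ b e t - Real.log (1 / w)
      ≤ biasPotential (bias l q w θ b e (a + k)) := by
    have htangent := mul_one_add_log_sub_le_biasPotential one_pos le_rfl
      (restartedExp_pos q hw (advantage l q θ b e) (a + k))
    rw [restartedExp_add w _ ha hk, Real.log_mul hw.ne' (Real.exp_pos _).ne', Real.log_exp,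
      Real.log_one, ← restartedExp_add w _ ha hk] at htangent
    rw [one_div, Real.log_inv, bias]
    linarith
  have hscaled := mul_le_mul_of_nonneg_left hlog (by positivity : 0 ≤ 4 * (1 + diameter X) / θ)
  simp only [mul_sub, Finset.mul_sum, mul_advantage l hθ, Finset.sum_sub_distrib,
    sum_windowCost l ha hk, Finset.sum_const, Nat.card_Ico, Nat.add_sub_cancel_left,
    nsmul_eq_mul] at hscaled
  push_cast at hscaled
  rw [potential]
  linarith

theorem integral_loss_mix_le_of_mod_eq_zero (hw : 0 < w) (hw1 : w ≤ 1) (hθ : 0 < θ)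
    (ht : t % q = 0) :
    ∫ v, (l t : X → ℝ) (mix l q w θ b e v t)
      ≤ (l t : X → ℝ) (b t) - potential l q w θ b e t + 4 * (1 + diameter X) / θ * w := by
  rw [integral_loss_mix l q θ hw b e]
  linarith [potential_le_of_mod_eq_zero l b e hw hw1 hθ ht]

end Potential

section Measurability

variable [Countable X] [MeasurableSpace X] [MeasurableSingletonClass X]

theorem measurable_windowCost {Ω : Type*} [MeasurableSpace Ω] (q : ℕ) {p : Ω → ℕ → X}
    (hp : ∀ t, Measurable fun ω => p ω t) (t : ℕ) :
    Measurable fun ω => windowCost l q (p ω) t := by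
  refine (measurable_loss l hp t).add ?_
  split_ifs
  exacts [measurable_const, measurable_dist_of_countable (hp t) (hp (t - 1))]

theorem measurable_mix {Ω : Type*} [MeasurableSpace Ω] (q : ℕ) (w θ : ℝ) {b e : Ω → ℕ → X}
    {v : Ω → unitInterval} (hb : ∀ t, Measurable fun ω => b ω t)
    (he : ∀ t, Measurable fun ω => e ω t) (hv : Measurable v) (t : ℕ) :
    Measurable fun ω => mix l q w θ (b ω) (e ω) (v ω) t := by
  have hbias : Measurable fun ω => bias l q w θ (b ω) (e ω) t :=
    measurable_restartedExp q measurable_const (fun s => ((((measurable_windowCost l q hb s).sub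
      (measurable_windowCost l q he s)).sub_const _).const_mul θ).div_const _) t
  exact Measurable.ite (measurableSet_le (measurable_subtype_coe.comp hv) hbias) (he t) (hb t)

end Measurability

section Expectation

variable [BoundedSpace X] [Countable X] [MeasurableSpace X] [MeasurableSingletonClass X] {q : ℕ}
  {w θ : ℝ} (b e : ℕ → X)

theorem integral_dist_mix_succ_le (q : ℕ) (θ : ℝ) (hw : 0 < w) (t : ℕ) :
    ∫ v, dist (mix l q w θ b e v (t + 1)) (mix l q w θ b e v t)
      ≤ min 1 (bias l q w θ b e (t + 1)) * dist (e (t + 1)) (e t)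
        + (1 - min 1 (bias l q w θ b e (t + 1))) * dist (b (t + 1)) (b t)
        + diameter X * |min 1 (bias l q w θ b e (t + 1)) - min 1 (bias l q w θ b e t)| := by
  have hpos (s : ℕ) : 0 ≤ bias l q w θ b e s := (restartedExp_pos q hw _ s).le
  have hmix (s : ℕ) : Measurable fun v => mix l q w θ b e v s :=
    measurable_ite_coe_le _ _ _
  have hstay := integrable_ite_coe_le (bias l q w θ b e (t + 1)) (dist (e (t + 1)) (e t))
    (dist (b (t + 1)) (b t))
  have hswitch : Integrable fun v : unitInterval => diameter X *
      |(if (v : ℝ) ≤ bias l q w θ b e (t + 1) then (1 : ℝ) else 0)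
        - (if (v : ℝ) ≤ bias l q w θ b e t then 1 else 0)| :=
    ((integrable_ite_coe_le _ _ _).sub (integrable_ite_coe_le _ _ _)).abs.const_mul _
  refine (integral_mono (integrable_dist_of_countable volume (hmix _) (hmix _))
    (hstay.add hswitch) (dist_mix_succ_le l q w θ b e t)).trans (le_of_eq ?_)
  simp only [Pi.add_apply]
  rw [integral_add hstay hswitch, integral_const_mul, integral_ite_coe_le (hpos (t + 1)),
    integral_abs_ite_coe_le_sub (hpos t) (hpos (t + 1))]

theorem integral_loss_mix_succ_add_dist_le_of_mod_eq_zero (hw : 0 < w) (hw1 : w ≤ 1) (hθ : 0 < θ)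
    (hθ1 : θ ≤ 1) {t : ℕ} (ht : (t + 1) % q = 0) :
    (∫ v, (l (t + 1) : X → ℝ) (mix l q w θ b e v (t + 1)))
        + ∫ v, dist (mix l q w θ b e v (t + 1)) (mix l q w θ b e v t)
      ≤ (l (t + 1) : X → ℝ) (b (t + 1)) + dist (b (t + 1)) (b t)
        - (potential l q w θ b e (t + 1) - potential l q w θ b e t) + leak X w θ := by
  have hD : 0 ≤ diameter X := Metric.diam_nonneg
  set g := min 1 (bias l q w θ b e t) with hg
  set g' := min 1 (bias l q w θ b e (t + 1)) with hg'
  have hg_nonneg : 0 ≤ g := le_min zero_le_one (restartedExp_pos q hw _ t).le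
  have hg'_nonneg : 0 ≤ g' := le_min zero_le_one (restartedExp_pos q hw _ (t + 1)).le
  have hloss := integral_loss_mix_le_of_mod_eq_zero l b e hw hw1 hθ ht
  have hmove := integral_dist_mix_succ_le l b e q θ hw t
  have hreset : diameter X * g ≤ potential l q w θ b e t :=
    diameter_mul_min_one_bias_le_potential l b e hw hθ hθ1
  have hg'_le : g' ≤ 2 * w :=
    (min_le_right _ _).trans (bias_le_of_mod_eq_zero l hw.le hθ.le hθ1 b e ht)
  have hstay : g' * dist (e (t + 1)) (e t) ≤ diameter X * g' := by
    rw [mul_comm]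
    exact mul_le_mul_of_nonneg_right (dist_le_diameter _ _) hg'_nonneg
  have hdist : 0 ≤ g' * dist (b (t + 1)) (b t) := mul_nonneg hg'_nonneg dist_nonneg
  have hswitch : diameter X * |g' - g| ≤ diameter X * (g' + g) :=
    mul_le_mul_of_nonneg_left (abs_le.2 ⟨by linarith, by linarith⟩) hD
  have hsmall : diameter X * g' ≤ diameter X * (2 * w) := mul_le_mul_of_nonneg_left hg'_le hD
  rw [← hg', ← hg] at hmove
  unfold leak
  linarith

theorem integral_loss_mix_succ_add_dist_le_of_mod_ne_zero (hw : 0 < w) (hθ : 0 < θ) (hθ1 : θ ≤ 1)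
    {t : ℕ} (ht : (t + 1) % q ≠ 0) :
    (∫ v, (l (t + 1) : X → ℝ) (mix l q w θ b e v (t + 1)))
        + ∫ v, dist (mix l q w θ b e v (t + 1)) (mix l q w θ b e v t)
      ≤ (l (t + 1) : X → ℝ) (b (t + 1)) + dist (b (t + 1)) (b t)
        - (potential l q w θ b e (t + 1) - potential l q w θ b e t) := by
  have hmove := integral_dist_mix_succ_le l b e q θ hw t
  have hstep : potential l q w θ b e (t + 1) - potential l q w θ b e t ≤ _ :=
    potential_sub_le l b e hθ (restartedExp_pos q hw (advantage l q θ b e) t)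
      (restartedExp_succ w (advantage l q θ b e) ht)
  have hswitch := mul_le_mul_of_nonneg_left (abs_min_one_bias_succ_sub_le l hw hθ.le hθ1 b e ht)
    (Metric.diam_nonneg : 0 ≤ diameter X)
  rw [windowCost_of_mod_ne_zero l ht, windowCost_of_mod_ne_zero l ht, Nat.add_sub_cancel] at hstep
  rw [integral_loss_mix l q θ hw]
  linarith

theorem integral_loss_mix_succ_add_dist_le (hw : 0 < w) (hw1 : w ≤ 1) (hθ : 0 < θ) (hθ1 : θ ≤ 1)
    (t : ℕ) :
    (∫ v, (l (t + 1) : X → ℝ) (mix l q w θ b e v (t + 1)))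
        + ∫ v, dist (mix l q w θ b e v (t + 1)) (mix l q w θ b e v t)
      ≤ (l (t + 1) : X → ℝ) (b (t + 1)) + dist (b (t + 1)) (b t)
        - (potential l q w θ b e (t + 1) - potential l q w θ b e t) + leak X w θ := by
  by_cases ht : (t + 1) % q = 0
  · exact integral_loss_mix_succ_add_dist_le_of_mod_eq_zero l b e hw hw1 hθ hθ1 ht
  · linarith [integral_loss_mix_succ_add_dist_le_of_mod_ne_zero l b e hw hθ hθ1 ht,
      leak_nonneg (X := X) hw.le hθ.le]

theorem integral_pathCost_mix_le (hw : 0 < w) (hw1 : w ≤ 1) (hθ : 0 < θ) (hθ1 : θ ≤ 1) {a : ℕ}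
    (ha : q ∣ a) (k : ℕ) :
    ∫ v, pathCost l (mix l q w θ b e v) a (k + 1)
      ≤ pathCost l b a (k + 1) - potential l q w θ b e (a + k) + (k + 1) * leak X w θ := by
  have hmix (s : ℕ) : Measurable fun v => mix l q w θ b e v s :=
    measurable_ite_coe_le _ _ _
  induction k with
  | zero =>
    have hloss := integral_loss_mix_le_of_mod_eq_zero l b e hw hw1 hθ (Nat.mod_eq_zero_of_dvd ha)
    have hleak : 4 * (1 + diameter X) / θ * w ≤ leak X w θ := by
      have hreset : 0 ≤ w * (4 * diameter X) := by positivity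
      unfold leak
      linarith
    simp only [zero_add, pathCost_one, Nat.cast_zero, one_mul, add_zero]
    exact hloss.trans (add_le_add_right hleak _)
  | succ k ih =>
    have hround := integral_loss_mix_succ_add_dist_le l b e (q := q) hw hw1 hθ hθ1 (a + k)
    rw [integral_pathCost_add_two l _ hmix, pathCost_add_two l b]
    push_cast
    rw [← Nat.add_assoc a k 1]
    linarith

theorem integral_pathCost_mix_le_pathCost_right (hw : 0 < w) (hw1 : w ≤ 1) (hθ : 0 < θ)
    (hθ1 : θ ≤ 1) {a : ℕ} (ha : q ∣ a) {k : ℕ} (hk : k + 1 ≤ q) :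
    ∫ v, pathCost l (mix l q w θ b e v) a (k + 1)
      ≤ pathCost l e a (k + 1) + (4 * (1 + diameter X) / θ * Real.log (1 / w)
        + (k + 1) * (diameter X * θ + leak X w θ)) := by
  linarith [integral_pathCost_mix_le l b e hw hw1 hθ hθ1 ha k,
    pathCost_sub_le_potential l b e hw hθ ha hk]

end Expectation

end Mix

/-! ### Resampling one coordinate of a product measure -/

section Resample

variable {ι : Type*} [DecidableEq ι] {Y : ι → Type*}

theorem preimage_update_pi_of_mem {s : Finset ι} {p : ι} (hp : p ∈ s) (A : ∀ i, Set (Y i)) :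
    (fun z : (∀ i, Y i) × Y p => Function.update z.1 p z.2) ⁻¹' Set.pi s A
      = Set.pi (s.erase p) A ×ˢ A p := by
  ext z
  simp only [Set.mem_preimage, Set.mem_pi, Set.mem_prod, Finset.mem_coe, Finset.mem_erase]
  refine ⟨fun h => ⟨fun i hi => ?_, ?_⟩, fun h i hi => ?_⟩
  · simpa only [Function.update_of_ne hi.1] using h i hi.2
  · simpa only [Function.update_self] using h p hp
  · rcases eq_or_ne i p with rfl | hip
    · simpa only [Function.update_self] using h.2
    · simpa only [Function.update_of_ne hip] using h.1 i ⟨hip, hi⟩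

theorem preimage_update_pi_of_notMem {s : Finset ι} {p : ι} (hp : p ∉ s) (A : ∀ i, Set (Y i)) :
    (fun z : (∀ i, Y i) × Y p => Function.update z.1 p z.2) ⁻¹' Set.pi s A
      = Set.pi s A ×ˢ Set.univ := by
  ext z
  simp only [Set.mem_preimage, Set.mem_pi, Set.mem_prod, Finset.mem_coe, Set.mem_univ, and_true]
  refine forall₂_congr fun i hi => ?_
  rw [Function.update_of_ne (ne_of_mem_of_not_mem hi hp)]

variable [∀ i, MeasurableSpace (Y i)] (μ : ∀ i, Measure (Y i)) [∀ i, IsProbabilityMeasure (μ i)]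

theorem measurePreserving_update (p : ι) :
    MeasurePreserving (fun z : (∀ i, Y i) × Y p => Function.update z.1 p z.2)
      ((Measure.infinitePi μ).prod (μ p)) (Measure.infinitePi μ) := by
  refine ⟨measurable_update', Measure.eq_infinitePi μ fun s A hA => ?_⟩
  rw [Measure.map_apply measurable_update' (MeasurableSet.pi s.countable_toSet fun i _ => hA i)]
  by_cases hp : p ∈ s
  · rw [preimage_update_pi_of_mem hp, Measure.prod_prod, Measure.infinitePi_pi _ fun i _ => hA i,
      mul_comm, Finset.mul_prod_erase s (fun i => μ i (A i)) hp]
  · rw [preimage_update_pi_of_notMem hp, Measure.prod_prod,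
      Measure.infinitePi_pi _ fun i _ => hA i, measure_univ, mul_one]

theorem integrable_integral_update {F : (∀ i, Y i) → ℝ} (hF : Integrable F (Measure.infinitePi μ))
    (p : ι) : Integrable (fun c => ∫ v, F (Function.update c p v) ∂μ p) (Measure.infinitePi μ) :=
  ((measurePreserving_update μ p).integrable_comp_of_integrable hF).integral_prod_left

theorem integral_integral_update {F : (∀ i, Y i) → ℝ} (hF : Integrable F (Measure.infinitePi μ))
    (p : ι) :
    ∫ c, ∫ v, F (Function.update c p v) ∂μ p ∂Measure.infinitePi μ
      = ∫ c, F c ∂Measure.infinitePi μ := by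
  have hmap := measurePreserving_update μ p
  refine (integral_prod _ (hmap.integrable_comp_of_integrable hF)).symm.trans ?_
  conv_rhs => rw [← hmap.map_eq]
  exact (integral_map hmap.aemeasurable (hmap.map_eq.symm ▸ hF.aestronglyMeasurable)).symm

theorem integral_le_of_forall_integral_update_le {F G : (∀ i, Y i) → ℝ}
    (hF : Integrable F (Measure.infinitePi μ)) (hG : Integrable G (Measure.infinitePi μ)) (p : ι)
    (h : ∀ c, ∫ v, F (Function.update c p v) ∂μ p ≤ ∫ v, G (Function.update c p v) ∂μ p) :
    ∫ c, F c ∂Measure.infinitePi μ ≤ ∫ c, G c ∂Measure.infinitePi μ := by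
  rw [← integral_integral_update μ hF p, ← integral_integral_update μ hG p]
  exact integral_mono (integrable_integral_update μ hF p) (integrable_integral_update μ hG p) h

theorem measureReal_infinitePi_le_of_forall_update {A B : Set (∀ i, Y i)} (hA : MeasurableSet A)
    (hB : MeasurableSet B) (p : ι) (r δ : ℝ)
    (h : ∀ c, (μ p).real {v | Function.update c p v ∈ A}
      ≤ r * ((μ p).real {v | Function.update c p v ∈ B} + δ)) :
    (Measure.infinitePi μ).real A ≤ r * ((Measure.infinitePi μ).real B + δ) := by
  have hint {S : Set (∀ i, Y i)} (hS : MeasurableSet S) :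
      Integrable (S.indicator (1 : (∀ i, Y i) → ℝ)) (Measure.infinitePi μ) :=
    (integrable_const (1 : ℝ)).indicator hS
  have hsection {S : Set (∀ i, Y i)} (hS : MeasurableSet S) (c : ∀ i, Y i) :
      ∫ v, S.indicator (1 : (∀ i, Y i) → ℝ) (Function.update c p v) ∂μ p
        = (μ p).real {v | Function.update c p v ∈ S} :=
    integral_indicator_one (measurable_update c hS)
  have hintA := integrable_integral_update μ (hint hA) p
  have hintB := integrable_integral_update μ (hint hB) p
  rw [← integral_indicator_one hA, ← integral_indicator_one hB,
    ← integral_integral_update μ (hint hA) p, ← integral_integral_update μ (hint hB) p]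
  simp only [hsection hA, hsection hB] at hintA hintB ⊢
  refine (integral_mono hintA ((hintB.add (integrable_const δ)).const_mul r) h).trans_eq ?_
  simp only [Pi.add_apply]
  rw [integral_const_mul, integral_add hintB (integrable_const _), integral_const, probReal_univ,
    one_smul]

end Resample

/-! ### The index of a minimum -/

section MinIndex

variable {α : Type*} [LinearOrder α]

/-- The last index of a minimum of `v 0, …, v (n - 1)`, and `0` for `n = 0`. -/
def minIndex (v : ℕ → α) : ℕ → ℕ
  | 0 => 0
  | n + 1 => if v n ≤ v (minIndex v n) then n else minIndex v n

theorem minIndex_lt (v : ℕ → α) {n : ℕ} (hn : 0 < n) : minIndex v n < n := by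
  induction n with
  | zero => exact absurd hn (lt_irrefl 0)
  | succ n ih =>
    rw [minIndex]
    split_ifs with h
    · exact n.lt_succ_self
    · rcases Nat.eq_zero_or_pos n with rfl | hn'
      · exact absurd le_rfl h
      · exact (ih hn').trans n.lt_succ_self

theorem minIndex_le (v : ℕ → α) {n i : ℕ} (hi : i < n) : v (minIndex v n) ≤ v i := by
  induction n with
  | zero => exact absurd hi i.not_lt_zero
  | succ n ih =>
    rw [minIndex]
    split_ifs with h <;> rcases Nat.lt_succ_iff_lt_or_eq.1 hi with hlt | rfl
    exacts [h.trans (ih hlt), le_rfl, ih hlt, (not_le.1 h).le]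

theorem lt_of_minIndex_lt (v : ℕ → α) {n i : ℕ} (hi : i < n) (h : minIndex v n < i) :
    v (minIndex v n) < v i := by
  induction n with
  | zero => exact absurd hi i.not_lt_zero
  | succ n ih =>
    rw [minIndex] at h ⊢
    split_ifs at h ⊢ with hle <;> rcases Nat.lt_succ_iff_lt_or_eq.1 hi with hlt | rfl
    exacts [absurd hlt h.not_gt, absurd h (lt_irrefl _), ih hlt h, not_le.1 hle]

theorem minIndex_eq_iff (v : ℕ → α) {n i : ℕ} (hi : i < n) :
    minIndex v n = i ↔ ∀ j < n, v i ≤ v j ∧ (i < j → v i < v j) := by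
  constructor
  · rintro rfl
    exact fun j hj => ⟨minIndex_le v hj, lt_of_minIndex_lt v hj⟩
  · intro h
    have hmin := h _ (minIndex_lt v (Nat.zero_lt_of_lt hi))
    rcases lt_trichotomy (minIndex v n) i with hlt | heq | hgt
    · exact absurd hmin.1 (lt_of_minIndex_lt v hi hlt).not_ge
    · exact heq
    · exact absurd (minIndex_le v hi) (hmin.2 hgt).not_ge

theorem minIndex_update_of_le {v : ℕ → α} {n i : ℕ} (hi : i < n) (h : minIndex v n = i) {r : α}
    (hr : r ≤ v i) : minIndex (Function.update v i r) n = i := by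
  rw [minIndex_eq_iff _ hi] at h ⊢
  intro j hj
  rw [Function.update_self]
  rcases eq_or_ne j i with rfl | hji
  · simp
  · rw [Function.update_of_ne hji]
    exact ⟨hr.trans (h j hj).1, fun hij => hr.trans_lt ((h j hj).2 hij)⟩

theorem minIndex_congr {v v' : ℕ → α} {n : ℕ} (h : ∀ i < n, v i = v' i) :
    minIndex v n = minIndex v' n := by
  rcases Nat.eq_zero_or_pos n with rfl | hn
  · rfl
  · rw [minIndex_eq_iff v (minIndex_lt v' hn)]
    intro j hj
    rw [h _ (minIndex_lt v' hn), h j hj]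
    exact ⟨minIndex_le v' hj, lt_of_minIndex_lt v' hj⟩

theorem measurable_minIndex {Ω : Type*} [MeasurableSpace Ω] {v : Ω → ℕ → ℝ}
    (hv : ∀ i, Measurable fun ω => v ω i) (n : ℕ) : Measurable fun ω => minIndex (v ω) n := by
  induction n with
  | zero => exact measurable_const
  | succ n ih =>
    exact Measurable.ite (measurableSet_le (hv n)
      (measurable_pick (F := fun k ω => v ω k) ih hv)) measurable_const ih

end MinIndex

/-! ### The perturbed leader -/

theorem volume_real_le_of_forall_coe_mem_Icc {A : Set unitInterval} {a b : ℝ} (hab : a ≤ b)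
    (h : ∀ x ∈ A, (x : ℝ) ∈ Set.Icc a b) : volume.real A ≤ b - a := by
  rw [measureReal_def, unitInterval.volume_apply]
  refine ENNReal.toReal_le_of_le_ofReal (sub_nonneg.2 hab) ?_
  rw [← Real.volume_Icc]
  exact measure_mono (Set.image_subset_iff.2 h)

theorem coe_le_volume_real_of_isLowerSet {B : Set unitInterval} (hB : IsLowerSet B)
    {x : unitInterval} (hx : x ∈ B) : (x : ℝ) ≤ volume.real B := by
  have hIic : volume.real (Set.Iic x) = x := by
    rw [measureReal_def, unitInterval.volume_Iic, ENNReal.toReal_ofReal x.2.1]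
  exact hIic.symm.trans_le (measureReal_mono fun y hy => hB hy hx)

theorem volume_real_le_mul_of_isLowerSet {A B : Set unitInterval} {δ η : ℝ} (hδ : 0 ≤ δ)
    (hη : 0 ≤ η) (hB : IsLowerSet B) (hAB : A ⊆ B)
    (h : ∀ x ∈ A, ∀ y ∈ B, (y : ℝ) + δ ≤ ((x : ℝ) + δ) * Real.exp η) :
    volume.real A ≤ η * (volume.real B + δ) := by
  set b := volume.real B
  have hb : 0 ≤ b := measureReal_nonneg
  have hexp : (b + δ) * Real.exp (-η) ≤ b + δ :=
    mul_le_of_le_one_right (by linarith) (Real.exp_le_one_iff.2 (by linarith))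
  have hlower : ∀ x ∈ A, (b + δ) * Real.exp (-η) - δ ≤ x := by
    intro x hx
    have hbx : b ≤ ((x : ℝ) + δ) * Real.exp η - δ - 0 :=
      volume_real_le_of_forall_coe_mem_Icc (by linarith [h x hx x (hAB hx), x.2.1])
        fun y hy => ⟨y.2.1, by linarith [h x hx y hy]⟩
    have hscaled : (b + δ) * Real.exp (-η) ≤ (x + δ) * Real.exp η * Real.exp (-η) :=
      mul_le_mul_of_nonneg_right (by linarith) (Real.exp_pos _).le
    rw [mul_assoc, ← Real.exp_add, add_neg_cancel, Real.exp_zero, mul_one] at hscaled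
    linarith
  have hvol : volume.real A ≤ b - ((b + δ) * Real.exp (-η) - δ) :=
    volume_real_le_of_forall_coe_mem_Icc (by linarith)
      fun x hx => ⟨hlower x hx, coe_le_volume_real_of_isLowerSet hB (hAB hx)⟩
  nlinarith [Real.add_one_le_exp (-η)]

theorem add_add_one_mod_ne_zero {q a k : ℕ} (ha : q ∣ a) (hk : k + 1 < q) :
    (a + k + 1) % q ≠ 0 := by
  rw [add_assoc, Nat.add_mod, Nat.mod_eq_zero_of_dvd ha, zero_add, Nat.mod_mod,
    Nat.mod_eq_of_lt hk]
  exact k.succ_ne_zero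

/-- The law of the uniform coins. -/
noncomputable abbrev coinLaw : Measure (ℕ → unitInterval) :=
  Measure.infinitePi fun _ => volume

/-- The exponential of the perturbed cumulative loss of expert `i`, where `z t i` is its loss in
round `t`: it is restarted from the noise `c i + 1 / N` every `q` rounds. -/
noncomputable def perturbedWeight (z : ℕ → ℕ → ℝ) (N q : ℕ) (η : ℝ) (c : ℕ → unitInterval)
    (t i : ℕ) : ℝ :=
  restartedExp q ((c i : ℝ) + 1 / N) (fun s => η * z s i) t

/-- The one among `N` experts that has the least perturbed cumulative loss, including the loss of
the current round. -/
noncomputable def leaderIndex (z : ℕ → ℕ → ℝ) (N q : ℕ) (η : ℝ) (c : ℕ → unitInterval) (t : ℕ) :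
    ℕ :=
  minIndex (perturbedWeight z N q η c t) N

section LeaderIndex

variable (z : ℕ → ℕ → ℝ) {N q : ℕ} {η : ℝ}

theorem perturbedWeight_succ (c : ℕ → unitInterval) {t : ℕ} (ht : (t + 1) % q ≠ 0) (i : ℕ) :
    perturbedWeight z N q η c (t + 1) i
      = perturbedWeight z N q η c t i * Real.exp (η * z (t + 1) i) :=
  restartedExp_succ _ _ ht

theorem perturbedWeight_update (c : ℕ → unitInterval) (i : ℕ) (y : unitInterval) (t : ℕ) :
    perturbedWeight z N q η (Function.update c i y) t
      = Function.update (perturbedWeight z N q η c t) i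
        (restartedExp q ((y : ℝ) + 1 / N) (fun s => η * z s i) t) := by
  funext j
  rcases eq_or_ne j i with rfl | hji
  · simp only [perturbedWeight, Function.update_self]
  · simp only [perturbedWeight, Function.update_of_ne hji]

theorem measurable_perturbedWeight (t i : ℕ) :
    Measurable fun c => perturbedWeight z N q η c t i := by
  have hnoise : Measurable fun c : ℕ → unitInterval => ((c i : unitInterval) : ℝ) :=
    measurable_subtype_coe.comp (measurable_pi_apply i)
  exact (hnoise.add_const _).mul_const _

theorem measurable_leaderIndex (t : ℕ) : Measurable fun c => leaderIndex z N q η c t :=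
  measurable_minIndex (fun i => measurable_perturbedWeight z t i) N

theorem leaderIndex_congr {c c' : ℕ → unitInterval} (h : ∀ i < N, c i = c' i) (t : ℕ) :
    leaderIndex z N q η c t = leaderIndex z N q η c' t :=
  minIndex_congr fun i hi => by simp only [perturbedWeight, h i hi]

theorem leaderIndex_update_of_le {c : ℕ → unitInterval} {i t : ℕ} (hi : i < N) {y : unitInterval}
    (hy : y ≤ c i) (h : leaderIndex z N q η c t = i) :
    leaderIndex z N q η (Function.update c i y) t = i := by
  rw [leaderIndex, perturbedWeight_update]
  refine minIndex_update_of_le hi h (mul_le_mul_of_nonneg_right ?_ (Real.exp_pos _).le)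
  exact add_le_add_left (Subtype.coe_le_coe.2 hy) _

section Positive

variable (hN : 0 < N)
include hN

theorem leaderIndex_lt (c : ℕ → unitInterval) (t : ℕ) : leaderIndex z N q η c t < N :=
  minIndex_lt _ hN

theorem coe_add_one_div_pos (x : unitInterval) : 0 < (x : ℝ) + 1 / N :=
  add_pos_of_nonneg_of_pos x.2.1 (one_div_pos.2 (Nat.cast_pos.2 hN))

theorem perturbedWeight_pos (c : ℕ → unitInterval) (t i : ℕ) :
    0 < perturbedWeight z N q η c t i :=
  restartedExp_pos _ (coe_add_one_div_pos hN (c i)) _ _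

theorem log_perturbedWeight_le (c : ℕ → unitInterval) {a k : ℕ} (ha : q ∣ a) (hk : k + 1 ≤ q)
    (x : ℕ) :
    Real.log (perturbedWeight z N q η c (a + k) x)
      ≤ Real.log 2 + η * ∑ t ∈ Finset.Ico a (a + (k + 1)), z t x := by
  have hpos := coe_add_one_div_pos hN (c x)
  have hnoise : Real.log ((c x : ℝ) + 1 / N) ≤ Real.log 2 := by
    refine Real.log_le_log hpos ?_
    have hone : (1 : ℝ) / N ≤ 1 := by
      rw [one_div]
      exact Nat.cast_inv_le_one N
    linarith [(c x).2.2]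
  rw [perturbedWeight, restartedExp_add _ _ ha hk,
    Real.log_mul hpos.ne' (Real.exp_pos _).ne', Real.log_exp, ← Finset.mul_sum]
  exact add_le_add_left hnoise _

/- The minimum over the experts only grows when the loss of the next round is added, and it grows by
the loss of the leader of that round. -/
theorem mul_sum_leaderIndex_le (c : ℕ → unitInterval) {a k : ℕ} (ha : q ∣ a) (hk : k + 1 ≤ q) :
    -Real.log N + η * ∑ t ∈ Finset.Ico a (a + (k + 1)), z t (leaderIndex z N q η c t)
      ≤ Real.log (perturbedWeight z N q η c (a + k) (leaderIndex z N q η c (a + k))) := by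
  set i := leaderIndex z N q η c
  induction k with
  | zero =>
    have hnoise : -Real.log N ≤ Real.log ((c (i a) : ℝ) + 1 / N) := by
      rw [← Real.log_inv, ← one_div]
      exact Real.log_le_log (one_div_pos.2 (Nat.cast_pos.2 hN))
        (le_add_of_nonneg_left (c (i a)).2.1)
    rw [perturbedWeight, restartedExp_add _ _ ha hk, add_zero,
      Real.log_mul (coe_add_one_div_pos hN _).ne' (Real.exp_pos _).ne', Real.log_exp, zero_add,
      Nat.Ico_succ_singleton, Finset.sum_singleton, Finset.sum_singleton]
    exact add_le_add_left hnoise _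
  | succ k ih =>
    have hmin := Real.log_le_log (perturbedWeight_pos z hN c (a + k) (i (a + k)))
      (minIndex_le (perturbedWeight z N q η c (a + k))
        (leaderIndex_lt z (q := q) (η := η) hN c (a + k + 1)))
    rw [← add_assoc a k 1] at ih
    rw [← add_assoc a k 1, ← add_assoc a (k + 1) 1, Finset.sum_Ico_succ_top (by omega),
      ← add_assoc a k 1, perturbedWeight_succ z c (add_add_one_mod_ne_zero ha hk),
      Real.log_mul (perturbedWeight_pos z hN c _ _).ne' (Real.exp_pos _).ne', Real.log_exp, mul_add]
    linarith [ih (by omega)]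

theorem sum_leaderIndex_le (hη : 0 < η) (c : ℕ → unitInterval) {a k : ℕ} (ha : q ∣ a)
    (hk : k + 1 ≤ q) {x : ℕ} (hx : x < N) :
    ∑ t ∈ Finset.Ico a (a + (k + 1)), z t (leaderIndex z N q η c t)
      ≤ ∑ t ∈ Finset.Ico a (a + (k + 1)), z t x + Real.log (2 * N) / η := by
  have hlead := (mul_sum_leaderIndex_le z (η := η) hN c ha hk).trans ((Real.log_le_log
    (perturbedWeight_pos z hN c _ _) (minIndex_le _ hx)).trans
      (log_perturbedWeight_le z hN c ha hk x))
  rw [Real.log_mul two_ne_zero (Nat.cast_pos.2 hN).ne']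
  refine le_of_mul_le_mul_left ?_ hη
  rw [mul_add, mul_div_cancel₀ _ hη.ne']
  linarith

section Move

variable (hz : ∀ t i, 0 ≤ z t i) (hz1 : ∀ t i, z t i ≤ 1) (hη : 0 ≤ η) {t : ℕ}
  (ht : (t + 1) % q ≠ 0)
include hz hz1 hη ht

theorem coe_add_le_of_leaderIndex_succ_ne {c : ℕ → unitInterval} {i : ℕ} (hi : i < N)
    (hlost : leaderIndex z N q η c (t + 1) ≠ i) {y : unitInterval}
    (hlead : leaderIndex z N q η (Function.update c i y) t = i) :
    (y : ℝ) + 1 / N ≤ ((c i : ℝ) + 1 / N) * Real.exp η := by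
  set j := leaderIndex z N q η c (t + 1)
  set E := Real.exp (∑ s ∈ Finset.Ico (q * (t / q)) (t + 1), η * z s i)
  have hchain : ((y : ℝ) + 1 / N) * E ≤ ((c i : ℝ) + 1 / N) * E * Real.exp (η * z (t + 1) i) := by
    calc ((y : ℝ) + 1 / N) * E
        ≤ perturbedWeight z N q η c t j := by
          have hmin := ((minIndex_eq_iff _ hi).1 hlead j (leaderIndex_lt z hN c (t + 1))).1
          rwa [perturbedWeight_update, Function.update_self, Function.update_of_ne hlost] at hmin
      _ ≤ perturbedWeight z N q η c (t + 1) j := by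
          rw [perturbedWeight_succ z c ht]
          exact le_mul_of_one_le_right (perturbedWeight_pos z hN c t j).le
            (Real.one_le_exp (mul_nonneg hη (hz _ _)))
      _ ≤ perturbedWeight z N q η c (t + 1) i := minIndex_le _ hi
      _ = ((c i : ℝ) + 1 / N) * E * Real.exp (η * z (t + 1) i) := perturbedWeight_succ z c ht i
  rw [mul_right_comm] at hchain
  refine (le_of_mul_le_mul_right hchain (Real.exp_pos _)).trans
    (mul_le_mul_of_nonneg_left (Real.exp_le_exp.2 (mul_le_of_le_one_right hη (hz1 _ _))) ?_)
  exact (coe_add_one_div_pos hN (c i)).le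

/- With all other noise fixed, the noise values for which `i` leads form a lower interval, and those
for which it loses the lead in the next round lie close to its upper end. -/
theorem volume_real_leaderIndex_succ_ne_le (c : ℕ → unitInterval) {i : ℕ} (hi : i < N) :
    volume.real {v : unitInterval | leaderIndex z N q η (Function.update c i v) t = i ∧
        leaderIndex z N q η (Function.update c i v) (t + 1) ≠ i}
      ≤ η * (volume.real {v : unitInterval | leaderIndex z N q η (Function.update c i v) t = i}
        + 1 / N) := by
  refine volume_real_le_mul_of_isLowerSet (by positivity) hη (fun x y hyx hx => ?_)
    (fun v hv => hv.1) fun x hx y hy => ?_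
  · have hlead := leaderIndex_update_of_le z hi (by rwa [Function.update_self]) hx (y := y)
    rwa [Function.update_idem] at hlead
  · have hclose := coe_add_le_of_leaderIndex_succ_ne z hN hz hz1 hη ht hi hx.2 (y := y)
      (by rwa [Function.update_idem])
    rwa [Function.update_self] at hclose

theorem coinLaw_real_leaderIndex_succ_ne_le :
    coinLaw.real {c | leaderIndex z N q η c (t + 1) ≠ leaderIndex z N q η c t} ≤ 2 * η := by
  let leads (i : ℕ) : Set (ℕ → unitInterval) := {c | leaderIndex z N q η c t = i}
  let losesLead (i : ℕ) : Set (ℕ → unitInterval) :=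
    {c | leaderIndex z N q η c t = i ∧ leaderIndex z N q η c (t + 1) ≠ i}
  have hleads (i : ℕ) : MeasurableSet (leads i) :=
    measurable_leaderIndex z t (MeasurableSet.singleton i)
  have hlosesLead (i : ℕ) : MeasurableSet (losesLead i) :=
    (hleads i).inter (measurable_leaderIndex z (t + 1) (MeasurableSet.singleton i).compl)
  have hdisjoint : Set.PairwiseDisjoint (Finset.range N : Set ℕ) leads := fun i _ j _ hij =>
    Set.disjoint_left.2 fun c hi hj => hij (Eq.trans (Eq.symm hi) hj)
  have hsum : ∑ i ∈ Finset.range N, coinLaw.real (leads i) ≤ 1 := by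
    rw [← measureReal_biUnion_finset hdisjoint fun i _ => hleads i]
    exact measureReal_le_one
  have hcover : {c | leaderIndex z N q η c (t + 1) ≠ leaderIndex z N q η c t}
      ⊆ ⋃ i ∈ Finset.range N, losesLead i := fun c hc =>
    Set.mem_biUnion (Finset.mem_coe.2 (Finset.mem_range.2 (leaderIndex_lt z hN c t))) ⟨rfl, hc⟩
  calc coinLaw.real {c | leaderIndex z N q η c (t + 1) ≠ leaderIndex z N q η c t}
      ≤ ∑ i ∈ Finset.range N, coinLaw.real (losesLead i) :=
        (measureReal_mono hcover (measure_ne_top _ _)).trans (measureReal_biUnion_finset_le _ _)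
    _ ≤ ∑ i ∈ Finset.range N, η * (coinLaw.real (leads i) + 1 / N) :=
        Finset.sum_le_sum fun i hi => measureReal_infinitePi_le_of_forall_update _
          (hlosesLead i) (hleads i) i η _ fun c =>
            volume_real_leaderIndex_succ_ne_le z hN hz hz1 hη ht c (Finset.mem_range.1 hi)
    _ = η * (∑ i ∈ Finset.range N, coinLaw.real (leads i) + 1) := by
        rw [← Finset.mul_sum, Finset.sum_add_distrib, Finset.sum_const, Finset.card_range,
          nsmul_eq_mul, mul_one_div_cancel (Nat.cast_pos.2 hN).ne']
    _ ≤ 2 * η := by linarith [mul_le_mul_of_nonneg_left hsum hη]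

end Move

end Positive

end LeaderIndex

section Leader

variable {X : Type*} [Fintype X] [Nonempty X] {M : MTS X} (l : ℕ → M.losses)
  (e : X ≃ Fin (Fintype.card X))

/-- The path that follows the perturbed leader among the states. -/
noncomputable def leader (q : ℕ) (η : ℝ) (c : ℕ → unitInterval) (t : ℕ) : X :=
  decode e (leaderIndex (fun s i => (l s : X → ℝ) (decode e i)) (Fintype.card X) q η c t)

theorem decode_apply (x : X) : decode e (e x) = x := by
  simp [decode]

theorem leader_congr {q : ℕ} {η : ℝ} {c c' : ℕ → unitInterval}
    (h : ∀ i < Fintype.card X, c i = c' i) (t : ℕ) :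
    leader l e q η c t = leader l e q η c' t :=
  congrArg (decode e) (leaderIndex_congr _ h t)

theorem sum_loss_leader_le {q : ℕ} {η : ℝ} (hη : 0 < η) (c : ℕ → unitInterval) {a k : ℕ}
    (ha : q ∣ a) (hk : k + 1 ≤ q) (x : X) :
    ∑ t ∈ Finset.Ico a (a + (k + 1)), (l t : X → ℝ) (leader l e q η c t)
      ≤ ∑ t ∈ Finset.Ico a (a + (k + 1)), (l t : X → ℝ) x
        + Real.log (2 * Fintype.card X) / η := by
  have hlead := sum_leaderIndex_le (fun s i => (l s : X → ℝ) (decode e i)) Fintype.card_pos hη c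
    ha hk (e x).2
  simp only [decode_apply] at hlead
  exact hlead

variable [MeasurableSpace X]

theorem measurable_leader (q : ℕ) (η : ℝ) (t : ℕ) : Measurable fun c => leader l e q η c t :=
  (measurable_of_countable (decode e)).comp (measurable_leaderIndex _ t)

variable [PseudoMetricSpace X] [MeasurableSingletonClass X] {q : ℕ} {η : ℝ}

theorem integral_dist_leader_succ_le (hη : 0 ≤ η) {t : ℕ} (ht : (t + 1) % q ≠ 0) :
    ∫ c, dist (leader l e q η c (t + 1)) (leader l e q η c t) ∂coinLaw
      ≤ diameter X * (2 * η) := by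
  let z (s i : ℕ) : ℝ := (l s : X → ℝ) (decode e i)
  let switches : Set (ℕ → unitInterval) :=
    {c | leaderIndex z (Fintype.card X) q η c (t + 1) ≠ leaderIndex z (Fintype.card X) q η c t}
  have hswitches : MeasurableSet switches :=
    (measurableSet_eq_fun (measurable_leaderIndex z (t + 1)) (measurable_leaderIndex z t)).compl
  have hdist (c : ℕ → unitInterval) : dist (leader l e q η c (t + 1)) (leader l e q η c t)
      ≤ switches.indicator (fun _ => diameter X) c := by
    by_cases hc : c ∈ switches
    · rw [Set.indicator_of_mem hc]
      exact dist_le_diameter _ _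
    · rw [Set.indicator_of_notMem hc, leader, leader, not_not.1 hc, dist_self]
  refine (integral_mono (integrable_dist_of_countable _ (measurable_leader l e q η _)
    (measurable_leader l e q η _)) ((integrable_const _).indicator hswitches) hdist).trans ?_
  rw [integral_indicator_const _ hswitches, smul_eq_mul, mul_comm]
  exact mul_le_mul_of_nonneg_left (coinLaw_real_leaderIndex_succ_ne_le z Fintype.card_pos
    (fun s i => loss_nonneg l s _) (fun s i => loss_le_one l s _) hη ht) Metric.diam_nonneg

theorem integral_pathCost_leader_le (hη : 0 < η) {a k : ℕ} (ha : q ∣ a) (hk : k + 1 ≤ q) (x : X) :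
    ∫ c, pathCost l (leader l e q η c) a (k + 1) ∂coinLaw
      ≤ ∑ t ∈ Finset.Ico a (a + (k + 1)), (l t : X → ℝ) x
        + (Real.log (2 * Fintype.card X) / η + (k + 1) * (diameter X * (2 * η))) := by
  have hleader := measurable_leader l e q η
  have hloss : Integrable (fun c => ∑ t ∈ Finset.Ico a (a + (k + 1)),
      (l t : X → ℝ) (leader l e q η c t)) coinLaw :=
    integrable_finsetSum _ fun t _ => integrable_loss l _ hleader t
  have hmove (t : ℕ) : Integrable (fun c => dist (leader l e q η c t) (leader l e q η c (t - 1)))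
      coinLaw := integrable_dist_of_countable _ (hleader _) (hleader _)
  have hsum_loss := integral_mono hloss (integrable_const _)
    fun c => sum_loss_leader_le l e hη c ha hk x
  have hsum_move : ∑ t ∈ Finset.Ico (a + 1) (a + (k + 1)),
      ∫ c, dist (leader l e q η c t) (leader l e q η c (t - 1)) ∂coinLaw
        ≤ k * (diameter X * (2 * η)) := by
    refine (Finset.sum_le_card_nsmul _ _ (diameter X * (2 * η)) fun t ht => ?_).trans_eq ?_
    · obtain ⟨s, rfl⟩ := Nat.exists_eq_add_of_le (Finset.mem_Ico.1 ht).1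
      rw [show a + 1 + s = a + s + 1 by omega, Nat.add_sub_cancel]
      refine integral_dist_leader_succ_le l e hη.le (add_add_one_mod_ne_zero ha ?_)
      have hs := (Finset.mem_Ico.1 ht).2
      omega
    · rw [Nat.card_Ico, nsmul_eq_mul, show a + (k + 1) - (a + 1) = k by omega]
  have hD : 0 ≤ diameter X * (2 * η) := mul_nonneg Metric.diam_nonneg (by linarith)
  unfold pathCost
  rw [integral_add hloss (integrable_finsetSum _ fun t _ => hmove t),
    integral_finsetSum _ fun t _ => hmove t]
  rw [integral_const, probReal_univ, one_smul] at hsum_loss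
  linarith

end Leader

/-! ### Stacking mixtures over all dyadic scales -/

section Rates

/-- The learning rate of the mixture on the time scale `2 ^ j`. -/
noncomputable def mixRate (L j : ℕ) : ℝ := √(L / (2 ^ j + L))

/-- The learning rate of the perturbed leader on the time scale `2 ^ j`. -/
noncomputable def leaderRate (X : Type*) [PseudoMetricSpace X] (m j : ℕ) : ℝ :=
  √(m / ((diameter X + 1) * 2 ^ j))

variable {L : ℕ}

theorem mixRate_pos (hL : 0 < L) (j : ℕ) : 0 < mixRate L j := by
  have hL' : (0 : ℝ) < L := by exact_mod_cast hL
  exact Real.sqrt_pos.2 (by positivity)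

theorem mixRate_le_one (L j : ℕ) : mixRate L j ≤ 1 :=
  Real.sqrt_le_one.2 (div_le_one_of_le₀ (le_add_of_nonneg_left (by positivity)) (by positivity))

theorem mixRate_mul_sqrt_le (L j : ℕ) : mixRate L j * √(2 ^ j) ≤ √L := by
  rw [mixRate, ← Real.sqrt_mul (by positivity)]
  refine Real.sqrt_le_sqrt ?_
  rw [div_mul_eq_mul_div, div_le_iff₀ (by positivity)]
  exact mul_le_mul_of_nonneg_left (le_add_of_nonneg_right L.cast_nonneg) L.cast_nonneg

theorem sqrt_le_two_mul_mixRate_mul_sqrt {j : ℕ} (h : L ≤ 2 ^ j) :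
    √L ≤ 2 * (mixRate L j * √(2 ^ j)) := by
  have h' : (L : ℝ) ≤ 2 ^ j := by exact_mod_cast h
  rw [mixRate, ← Real.sqrt_mul (by positivity)]
  refine Real.sqrt_le_iff.2 ⟨by positivity, ?_⟩
  rw [mul_pow, Real.sq_sqrt (by positivity), div_mul_eq_mul_div, ← mul_div_assoc,
    le_div_iff₀ (by positivity)]
  nlinarith [(L.cast_nonneg : (0 : ℝ) ≤ L)]

theorem div_mixRate_le (hL : 0 < L) {j : ℕ} (h : L ≤ 2 ^ j) :
    L / mixRate L j ≤ 2 * (√L * √(2 ^ j)) := by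
  rw [div_le_iff₀ (mixRate_pos hL j)]
  calc (L : ℝ) = √L * √L := (Real.mul_self_sqrt L.cast_nonneg).symm
    _ ≤ √L * (2 * (mixRate L j * √(2 ^ j))) :=
      mul_le_mul_of_nonneg_left (sqrt_le_two_mul_mixRate_mul_sqrt h) (Real.sqrt_nonneg _)
    _ = 2 * (√L * √(2 ^ j)) * mixRate L j := by ring

theorem one_div_pow_three_pos {T : ℕ} (hT : 0 < T) : 0 < 1 / (T : ℝ) ^ 3 := by
  have hT' : (0 : ℝ) < T := by exact_mod_cast hT
  positivity

theorem one_div_pow_three_le_one (T : ℕ) : 1 / (T : ℝ) ^ 3 ≤ 1 := by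
  rw [one_div]
  exact_mod_cast Nat.cast_inv_le_one (α := ℝ) (T ^ 3)

theorem log_le_size (T : ℕ) : Real.log T ≤ T.size := by
  rcases T.eq_zero_or_pos with rfl | hT
  · simp
  have hlog : Real.log T ≤ Real.log (2 ^ T.size) :=
    Real.log_le_log (by exact_mod_cast hT) (by exact_mod_cast T.lt_size_self.le)
  rw [Real.log_pow] at hlog
  exact hlog.trans (mul_le_of_le_one_right T.size.cast_nonneg (by linarith [Real.log_two_lt_d9]))

variable {X : Type*} [PseudoMetricSpace X]

theorem leak_mixRate_le {T j : ℕ} (hT : 0 < T) (hL : 0 < L) (hj : 2 ^ j ≤ T) :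
    leak X (1 / (T : ℝ) ^ 3) (mixRate L j) ≤ 12 * (1 + diameter X) / (T : ℝ) ^ 2 := by
  have hD : 0 ≤ diameter X := Metric.diam_nonneg
  have hT1 : (1 : ℝ) ≤ T := by exact_mod_cast hT
  have hL1 : (1 : ℝ) ≤ L := by exact_mod_cast hL
  have hjT : (2 : ℝ) ^ j ≤ T := by exact_mod_cast hj
  have hθ := mixRate_pos hL j
  have hθ_large : 1 ≤ 2 * T * mixRate L j := by
    calc (1 : ℝ) ≤ 2 * T * (L / (2 ^ j + L)) := by
          rw [← mul_div_assoc, le_div_iff₀ (by positivity)]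
          nlinarith
      _ = 2 * T * mixRate L j ^ 2 := by rw [mixRate, Real.sq_sqrt (by positivity)]
      _ ≤ 2 * T * mixRate L j := by
          gcongr
          exact pow_le_of_le_one hθ.le (mixRate_le_one L j) two_ne_zero
  have hmove : 4 * (1 + diameter X) / mixRate L j ≤ 8 * (1 + diameter X) * T := by
    rw [div_le_iff₀ hθ]
    nlinarith
  have htotal : 4 * (1 + diameter X) / mixRate L j + 4 * diameter X
      ≤ 12 * (1 + diameter X) * T := by
    nlinarith
  unfold leak
  calc 1 / (T : ℝ) ^ 3 * (4 * (1 + diameter X) / mixRate L j + 4 * diameter X)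
      ≤ 1 / (T : ℝ) ^ 3 * (12 * (1 + diameter X) * T) := by gcongr
    _ = 12 * (1 + diameter X) / (T : ℝ) ^ 2 := by field_simp

theorem two_pow_mul_leak_mixRate_le {T j : ℕ} (hT : 0 < T) (hL : 0 < L) (hj : 2 ^ j ≤ T) :
    2 ^ j * leak X (1 / (T : ℝ) ^ 3) (mixRate L j) ≤ 12 * (1 + diameter X) := by
  have hD : 0 ≤ diameter X := Metric.diam_nonneg
  have hT1 : (1 : ℝ) ≤ T := by exact_mod_cast hT
  have hjT : (2 : ℝ) ^ j ≤ (T : ℝ) ^ 2 :=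
    le_trans (by exact_mod_cast hj) (le_self_pow₀ hT1 two_ne_zero)
  calc (2 : ℝ) ^ j * leak X (1 / (T : ℝ) ^ 3) (mixRate L j)
      ≤ (T : ℝ) ^ 2 * (12 * (1 + diameter X) / (T : ℝ) ^ 2) :=
        mul_le_mul hjT (leak_mixRate_le hT hL hj)
          (leak_nonneg (one_div_pow_three_pos hT).le (mixRate_pos hL j).le) (by positivity)
    _ = 12 * (1 + diameter X) := by field_simp

theorem one_le_sqrt_size_mul_sqrt_two_pow {T : ℕ} (hT : 0 < T) (j : ℕ) :
    1 ≤ √T.size * √(2 ^ j) :=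
  one_le_mul_of_one_le_of_one_le (Real.one_le_sqrt.2 (by exact_mod_cast Nat.size_pos.2 hT))
    (Real.one_le_sqrt.2 (one_le_pow₀ one_le_two))

theorem mix_regret_le {T j : ℕ} (hT : 0 < T) (hj : 2 ^ j ≤ T) (hL : T.size ≤ 2 ^ j) :
    4 * (1 + diameter X) / mixRate T.size j * Real.log (1 / (1 / (T : ℝ) ^ 3))
      + 2 ^ j * (diameter X * mixRate T.size j + leak X (1 / (T : ℝ) ^ 3) (mixRate T.size j))
      ≤ 37 * ((1 + diameter X) * (√T.size * √(2 ^ j))) := by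
  have hD : 0 ≤ diameter X := Metric.diam_nonneg
  have hL0 : 0 < T.size := Nat.size_pos.2 hT
  have hθ := mixRate_pos hL0 j
  have hlog : Real.log (1 / (1 / (T : ℝ) ^ 3)) ≤ 3 * T.size := by
    rw [one_div_one_div, Real.log_pow]
    push_cast
    linarith [log_le_size T]
  have hlearn : 4 * (1 + diameter X) / mixRate T.size j * Real.log (1 / (1 / (T : ℝ) ^ 3))
      ≤ 24 * ((1 + diameter X) * (√T.size * √(2 ^ j))) := by
    calc 4 * (1 + diameter X) / mixRate T.size j * Real.log (1 / (1 / (T : ℝ) ^ 3))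
        ≤ 4 * (1 + diameter X) / mixRate T.size j * (3 * T.size) := by gcongr
      _ = 12 * (1 + diameter X) * (T.size / mixRate T.size j) := by ring
      _ ≤ 12 * (1 + diameter X) * (2 * (√T.size * √(2 ^ j))) := by
          gcongr
          exact div_mixRate_le hL0 hL
      _ = 24 * ((1 + diameter X) * (√T.size * √(2 ^ j))) := by ring
  have hmove : 2 ^ j * (diameter X * mixRate T.size j)
      ≤ (1 + diameter X) * (√T.size * √(2 ^ j)) := by
    calc 2 ^ j * (diameter X * mixRate T.size j)
        = diameter X * (mixRate T.size j * √(2 ^ j) * √(2 ^ j)) := by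
          rw [mul_assoc (mixRate _ _), Real.mul_self_sqrt (by positivity)]
          ring
      _ ≤ (1 + diameter X) * (√T.size * √(2 ^ j)) := by
          gcongr
          exacts [le_add_of_nonneg_left zero_le_one, mixRate_mul_sqrt_le _ _]
  have hone : 1 + diameter X ≤ (1 + diameter X) * (√T.size * √(2 ^ j)) :=
    le_mul_of_one_le_right (by positivity) (one_le_sqrt_size_mul_sqrt_two_pow hT j)
  rw [mul_add ((2 : ℝ) ^ j)]
  linarith [two_pow_mul_leak_mixRate_le (X := X) hT hL0 hj]

theorem leaderRate_mul_sqrt_two_pow (m j : ℕ) :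
    leaderRate X m j * √(2 ^ j) = √(m / (diameter X + 1)) := by
  have hD : 0 ≤ diameter X := Metric.diam_nonneg
  rw [leaderRate, ← Real.sqrt_mul (by positivity)]
  congr 1
  field_simp

theorem leader_regret_le {m : ℕ} (hm : 0 < m) {H : ℝ} (hHm : H ≤ m) (j : ℕ) :
    H / leaderRate X m j + 2 ^ j * (diameter X * (2 * leaderRate X m j))
      ≤ 3 * (√((diameter X + 1) * m) * √(2 ^ j)) := by
  have hD : 0 ≤ diameter X := Metric.diam_nonneg
  have hm0 : (0 : ℝ) < m := by exact_mod_cast hm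
  have hη : 0 < leaderRate X m j := Real.sqrt_pos.2 (by positivity)
  have hmul : (diameter X + 1) * √(m / (diameter X + 1)) = √((diameter X + 1) * m) := by
    rw [← Real.sqrt_sq (by positivity : 0 ≤ diameter X + 1), ← Real.sqrt_mul (by positivity),
      Real.sqrt_sq (by positivity)]
    congr 1
    field_simp
  have hlearn : H / leaderRate X m j ≤ √((diameter X + 1) * m) * √(2 ^ j) := by
    rw [div_le_iff₀ hη]
    calc H ≤ m := hHm
      _ = (diameter X + 1) * (√(m / (diameter X + 1)) * √(m / (diameter X + 1))) := by
        rw [Real.mul_self_sqrt (by positivity)]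
        field_simp
      _ = √((diameter X + 1) * m) * (leaderRate X m j * √(2 ^ j)) := by
        rw [leaderRate_mul_sqrt_two_pow, ← hmul, mul_assoc]
      _ = √((diameter X + 1) * m) * √(2 ^ j) * leaderRate X m j := by ring
  have hmove : 2 ^ j * (diameter X * (2 * leaderRate X m j))
      ≤ 2 * (√((diameter X + 1) * m) * √(2 ^ j)) := by
    calc 2 ^ j * (diameter X * (2 * leaderRate X m j))
        = 2 * (diameter X * (leaderRate X m j * √(2 ^ j)) * √(2 ^ j)) := by
          rw [mul_assoc (diameter X), mul_assoc (leaderRate X m j),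
            Real.mul_self_sqrt (by positivity)]
          ring
      _ ≤ 2 * ((diameter X + 1) * (leaderRate X m j * √(2 ^ j)) * √(2 ^ j)) := by
          gcongr
          exact le_add_of_nonneg_right zero_le_one
      _ = 2 * (√((diameter X + 1) * m) * √(2 ^ j)) := by
          rw [leaderRate_mul_sqrt_two_pow, hmul]
  linarith

end Rates

section Stack

variable {X : Type*} [Fintype X] [Nonempty X] [PseudoMetricSpace X] {M : MTS X}
  (l : ℕ → M.losses) (e : X ≃ Fin (Fintype.card X))

/-- The path that follows the perturbed leader on the time scale `2 ^ j`. -/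
noncomputable def scaleLeader (m j : ℕ) (c : ℕ → unitInterval) : ℕ → X :=
  leader l e (2 ^ j) (leaderRate X m j) c

/-- Starting from `b`, mix in the perturbed leaders on the time scales `2 ^ (L - 1), 2 ^ (L - 2), …`
one after the other. The coins with the codes of the states are the noise of the leaders, and coin
`Fintype.card X + j` is the threshold on the time scale `2 ^ j`. -/
noncomputable def stack (L m : ℕ) (w : ℝ) (b : ℕ → X) (c : ℕ → unitInterval) : ℕ → ℕ → X
  | 0 => b
  | n + 1 => mix l (2 ^ (L - (n + 1))) w (mixRate L (L - (n + 1))) (stack L m w b c n)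
      (scaleLeader l e m (L - (n + 1)) c) (c (Fintype.card X + (L - (n + 1))))

variable {L m : ℕ} {w : ℝ} (b : ℕ → X)

theorem stack_succ {j n : ℕ} (hj : j + n + 1 = L) (c : ℕ → unitInterval) :
    stack l e L m w b c (n + 1) = mix l (2 ^ j) w (mixRate L j) (stack l e L m w b c n)
      (scaleLeader l e m j c) (c (Fintype.card X + j)) := by
  obtain rfl : j = L - (n + 1) := by omega
  rfl

theorem scaleLeader_update (m j : ℕ) {p : ℕ} (hp : Fintype.card X ≤ p) (c : ℕ → unitInterval)
    (v : unitInterval) : scaleLeader l e m j (Function.update c p v) = scaleLeader l e m j c :=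
  funext fun t => leader_congr l e
    (fun _ hi => Function.update_of_ne (hi.trans_le hp).ne _ _) t

theorem stack_update {j n : ℕ} (hj : j + n < L) (c : ℕ → unitInterval) (v : unitInterval) :
    stack l e L m w b (Function.update c (Fintype.card X + j) v) n = stack l e L m w b c n := by
  induction n with
  | zero => rfl
  | succ n ih =>
    simp only [stack]
    rw [ih (by omega), scaleLeader_update l e m _ (by omega), Function.update_of_ne (by omega)]

variable [MeasurableSpace X] [MeasurableSingletonClass X]

theorem measurable_stack (n t : ℕ) : Measurable fun c => stack l e L m w b c n t := by
  induction n generalizing t with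
  | zero => exact measurable_const
  | succ n ih =>
    exact measurable_mix l _ w _ ih (fun s => measurable_leader l e _ _ s) (measurable_pi_apply _) t

theorem integrable_pathCost_stack (n a k : ℕ) :
    Integrable (fun c => pathCost l (stack l e L m w b c n) a k) coinLaw :=
  integrable_pathCost l _ (measurable_stack l e b n) a k

theorem integral_pathCost_stack_succ_le_of_forall {j n : ℕ} (hj : j + n + 1 = L)
    {G : (ℕ → unitInterval) → ℝ} (hG : Integrable G coinLaw)
    (hG_update : ∀ c v, G (Function.update c (Fintype.card X + j) v) = G c) {a k : ℕ} {R : ℝ}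
    (h : ∀ c, ∫ v, pathCost l (mix l (2 ^ j) w (mixRate L j) (stack l e L m w b c n)
      (scaleLeader l e m j c) v) a k ≤ G c + R) :
    ∫ c, pathCost l (stack l e L m w b c (n + 1)) a k ∂coinLaw ≤ (∫ c, G c ∂coinLaw) + R := by
  have hR : (∫ c, (G c + R) ∂coinLaw) = (∫ c, G c ∂coinLaw) + R := by
    rw [integral_add hG (integrable_const _), integral_const, probReal_univ, one_smul]
  rw [← hR]
  refine integral_le_of_forall_integral_update_le _ (integrable_pathCost_stack l e b (n + 1) a k)
    (hG.add (integrable_const R)) (Fintype.card X + j) fun c => ?_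
  simp only [stack_succ l e b hj, stack_update l e b (show j + n < L by omega),
    scaleLeader_update l e m j (Nat.le_add_right _ j), Function.update_self, hG_update,
    integral_const, probReal_univ, one_smul]
  exact h c

theorem integral_pathCost_stack_succ_le (hw : 0 < w) (hw1 : w ≤ 1) {j n : ℕ}
    (hj : j + n + 1 = L) {a : ℕ} (ha : 2 ^ j ∣ a) (k : ℕ) :
    ∫ c, pathCost l (stack l e L m w b c (n + 1)) a k ∂coinLaw
      ≤ (∫ c, pathCost l (stack l e L m w b c n) a k ∂coinLaw) + k * leak X w (mixRate L j) := by
  have hθ := mixRate_pos (show 0 < L by omega) j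
  refine integral_pathCost_stack_succ_le_of_forall l e b hj
    (integrable_pathCost_stack l e b n a k)
    (fun c v => by rw [stack_update l e b (show j + n < L by omega)]) fun c => ?_
  rcases k with _ | k
  · simp only [pathCost_zero, integral_zero, Nat.cast_zero, zero_mul, add_zero, le_refl]
  · refine (integral_pathCost_mix_le l _ _ hw hw1 hθ (mixRate_le_one L j) ha k).trans ?_
    push_cast
    refine add_le_add_left (sub_le_self _ ?_) _
    exact (mul_nonneg Metric.diam_nonneg (le_min zero_le_one (restartedExp_pos _ hw _ _).le)).trans
      (diameter_mul_min_one_bias_le_potential l _ _ hw hθ (mixRate_le_one L j))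

theorem integral_pathCost_stack_succ_le_leader (hw : 0 < w) (hw1 : w ≤ 1) {j n : ℕ}
    (hj : j + n + 1 = L) {a : ℕ} (ha : 2 ^ j ∣ a) :
    ∫ c, pathCost l (stack l e L m w b c (n + 1)) a (2 ^ j) ∂coinLaw
      ≤ (∫ c, pathCost l (scaleLeader l e m j c) a (2 ^ j) ∂coinLaw)
        + (4 * (1 + diameter X) / mixRate L j * Real.log (1 / w)
          + 2 ^ j * (diameter X * mixRate L j + leak X w (mixRate L j))) := by
  have hθ := mixRate_pos (show 0 < L by omega) j
  refine integral_pathCost_stack_succ_le_of_forall l e b hj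
    (G := fun c => pathCost l (scaleLeader l e m j c) a (2 ^ j))
    (integrable_pathCost l _ (measurable_leader l e _ _) a _)
    (fun c v => by rw [scaleLeader_update l e m j (Nat.le_add_right _ j)]) fun c => ?_
  obtain ⟨k, hk⟩ := Nat.exists_eq_succ_of_ne_zero (Nat.two_pow_pos j).ne'
  have hmix := integral_pathCost_mix_le_pathCost_right l (stack l e L m w b c n)
    (scaleLeader l e m j c) hw hw1 hθ (mixRate_le_one L j) ha (k := k) hk.ge
  have hk' : (k : ℝ) + 1 = 2 ^ j := by exact_mod_cast hk.symm
  rwa [hk', ← Nat.succ_eq_add_one, ← hk] at hmix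

end Stack

/-! ### Decomposing an interval into dyadic ones -/

section Dyadic

theorem sqrt_add_three_mul_sqrt_le {r s : ℝ} (hr : 0 ≤ r) (hrs : r ≤ s) :
    √s + 3 * √r ≤ 3 * √(s + r) := by
  have hs : 0 ≤ s := hr.trans hrs
  have hsq := Real.sq_sqrt (add_nonneg hs hr)
  refine (abs_le_of_sq_le_sq' ?_ (by positivity)).2
  nlinarith [Real.sq_sqrt hs, Real.sq_sqrt hr, Real.sqrt_le_sqrt hrs, Real.sqrt_nonneg r]

theorem exists_lt_dvd_add {q : ℕ} (hq : 0 < q) (a : ℕ) : ∃ s < q, q ∣ a + s := by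
  refine ⟨a * (q - 1) % q, Nat.mod_lt _ hq, Nat.dvd_of_mod_eq_zero ?_⟩
  rw [Nat.add_mod_mod, ← mul_one_add, add_tsub_cancel_of_le (Nat.one_le_of_lt hq),
    Nat.mul_mod_left]

variable {ρ : ℕ → ℕ → ℝ} {W : ℝ} {T : ℕ}

theorem add_le_three_mul_sqrt_of_le {i r : ℕ} {A B : ℝ} (hW : 0 ≤ W) (hr : r ≤ 2 ^ i)
    (hA : A ≤ W * √(2 ^ i)) (hB : B ≤ 3 * W * √r) : A + B ≤ 3 * W * √(2 ^ i + r : ℕ) := by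
  have hroot := sqrt_add_three_mul_sqrt_le (r := r) (s := 2 ^ i) r.cast_nonneg
    (by exact_mod_cast hr)
  push_cast
  linarith [mul_le_mul_of_nonneg_left hroot hW]

theorem le_three_mul_sqrt_of_dvd_left (hW : 0 ≤ W)
    (hadd : ∀ a k n, ρ a (k + n) ≤ ρ a k + ρ (a + k) n)
    (hdyadic : ∀ j a, 2 ^ j ≤ T → 2 ^ j ∣ a → ρ a (2 ^ j) ≤ W * √(2 ^ j)) (j : ℕ) {a k : ℕ}
    (ha : 2 ^ j ∣ a) (hk : 0 < k) (hkT : k ≤ T) (hkj : k < 2 ^ (j + 1)) :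
    ρ a k ≤ 3 * W * √k := by
  have hpos (i : ℕ) : 0 ≤ W * √(2 ^ i) := by positivity
  induction j generalizing a k with
  | zero =>
    obtain rfl : k = 1 := by omega
    have hone := hdyadic 0 a hkT ha
    simp only [pow_zero, Nat.cast_one, Real.sqrt_one, mul_one] at hone ⊢
    linarith
  | succ j ih =>
    rcases lt_or_ge k (2 ^ (j + 1)) with hlt | hge
    · exact ih ((pow_dvd_pow 2 j.le_succ).trans ha) hk hkT hlt
    obtain ⟨r, rfl⟩ := Nat.exists_eq_add_of_le hge
    have hr : r < 2 ^ (j + 1) := by rw [pow_succ 2 (j + 1)] at hkj; omega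
    have hfirst := hdyadic (j + 1) a (by omega) ha
    rcases r.eq_zero_or_pos with rfl | hr0
    · rw [add_zero, Nat.cast_pow, Nat.cast_ofNat]
      linarith [hpos (j + 1)]
    · exact (hadd a _ r).trans (add_le_three_mul_sqrt_of_le hW hr.le hfirst
        (ih ((pow_dvd_pow 2 j.le_succ).trans (ha.add dvd_rfl)) hr0 (by omega) hr))

theorem le_three_mul_sqrt_of_dvd_right (hW : 0 ≤ W)
    (hadd : ∀ a k n, ρ a (k + n) ≤ ρ a k + ρ (a + k) n)
    (hdyadic : ∀ j a, 2 ^ j ≤ T → 2 ^ j ∣ a → ρ a (2 ^ j) ≤ W * √(2 ^ j)) (j : ℕ) {a k : ℕ}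
    (ha : 2 ^ j ∣ a + k) (hk : 0 < k) (hkT : k ≤ T) (hkj : k ≤ 2 ^ j) :
    ρ a k ≤ 3 * W * √k := by
  have hpos (i : ℕ) : 0 ≤ W * √(2 ^ i) := by positivity
  induction j generalizing a k with
  | zero =>
    obtain rfl : k = 1 := by omega
    have hone := hdyadic 0 a hkT (one_dvd a)
    simp only [pow_zero, Nat.cast_one, Real.sqrt_one, mul_one] at hone ⊢
    linarith
  | succ j ih =>
    have ha' : 2 ^ j ∣ a + k := (pow_dvd_pow 2 j.le_succ).trans ha
    rcases le_or_gt k (2 ^ j) with hle | hgt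
    · exact ih ha' hk hkT hle
    obtain ⟨r, rfl⟩ := Nat.exists_eq_add_of_lt hgt
    have har : 2 ^ j ∣ a + (r + 1) := by
      rw [show a + (2 ^ j + r + 1) = 2 ^ j + (a + (r + 1)) by omega] at ha'
      exact (Nat.dvd_add_right dvd_rfl).1 ha'
    have hr : r + 1 ≤ 2 ^ j := by rw [pow_succ] at hkj; omega
    have hsplit := hadd a (r + 1) (2 ^ j)
    have hsum := add_le_three_mul_sqrt_of_le hW hr (hdyadic j _ (by omega) har)
      (ih har r.succ_pos (by omega) hr)
    rw [add_assoc (2 ^ j), add_comm (2 ^ j) (r + 1)] at *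
    linarith

theorem le_six_mul_sqrt_of_dyadic (hW : 0 ≤ W)
    (hadd : ∀ a k n, ρ a (k + n) ≤ ρ a k + ρ (a + k) n)
    (hdyadic : ∀ j a, 2 ^ j ≤ T → 2 ^ j ∣ a → ρ a (2 ^ j) ≤ W * √(2 ^ j)) {a k : ℕ}
    (hk : 0 < k) (hkT : k ≤ T) : ρ a k ≤ 6 * W * √k := by
  have hmono {n : ℕ} (hn : n ≤ k) : 3 * W * √n ≤ 3 * W * √k := by gcongr
  have hlog := Nat.pow_log_le_self 2 hk.ne'
  have hlog' := Nat.lt_pow_succ_log_self one_lt_two k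
  obtain ⟨s, hs, has⟩ := exists_lt_dvd_add (Nat.two_pow_pos (Nat.log 2 k)) a
  obtain ⟨r, hr⟩ := Nat.exists_eq_add_of_le (hs.le.trans hlog)
  have hright := (le_three_mul_sqrt_of_dvd_left hW hadd hdyadic _ has (k := r) (by omega)
    (by omega) (by omega)).trans (hmono (by omega))
  rcases s.eq_zero_or_pos with rfl | hs0
  · obtain rfl : k = r := by omega
    rw [add_zero] at hright
    linarith [mul_nonneg hW (Real.sqrt_nonneg k)]
  · have hleft := (le_three_mul_sqrt_of_dvd_right hW hadd hdyadic _ has hs0 (by omega)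
      hs.le).trans (hmono (by omega))
    have hsplit := hadd a s r
    rw [← hr] at hsplit
    linarith

end Dyadic

/-! ### The regret of the stack -/

section Output

variable {X : Type*} [Fintype X] [Nonempty X] [PseudoMetricSpace X] {M : MTS X}
  (l : ℕ → M.losses) (e : X ≃ Fin (Fintype.card X))

/-- The path that results from mixing in the perturbed leaders on all time scales below `T`. -/
noncomputable def output (T : ℕ) (b : ℕ → X) (c : ℕ → unitInterval) : ℕ → X :=
  stack l e T.size (Fintype.card X * T).size (1 / (T : ℝ) ^ 3) b c T.size

variable [MeasurableSpace X] [MeasurableSingletonClass X] {T : ℕ} (b : ℕ → X)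

theorem integral_pathCost_stack_add_le (hT : 0 < T) {m n i a k : ℕ} (hni : n + i ≤ T.size)
    (ha : 2 ^ (T.size - (n + 1)) ∣ a) (hk : k ≤ T) :
    ∫ c, pathCost l (stack l e T.size m (1 / (T : ℝ) ^ 3) b c (n + i)) a k ∂coinLaw
      ≤ (∫ c, pathCost l (stack l e T.size m (1 / (T : ℝ) ^ 3) b c n) a k ∂coinLaw)
        + i * (T * (12 * (1 + diameter X) / (T : ℝ) ^ 2)) := by
  have hD : 0 ≤ diameter X := Metric.diam_nonneg
  have hL : 0 < T.size := Nat.size_pos.2 hT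
  induction i with
  | zero => simp only [add_zero, Nat.cast_zero, zero_mul, le_refl]
  | succ i ih =>
    obtain ⟨j, hj⟩ := Nat.exists_eq_add_of_lt (show n + i < T.size by omega)
    have hstep := integral_pathCost_stack_succ_le l e b (L := T.size) (m := m) (j := j)
      (n := n + i) (one_div_pow_three_pos hT) (one_div_pow_three_le_one T) (by omega)
      ((pow_dvd_pow 2 (by omega)).trans ha) k
    have hleak : k * leak X (1 / (T : ℝ) ^ 3) (mixRate T.size j)
        ≤ T * (12 * (1 + diameter X) / (T : ℝ) ^ 2) :=
      mul_le_mul (by exact_mod_cast hk) (leak_mixRate_le hT hL (Nat.lt_size.1 (by omega)))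
        (leak_nonneg (one_div_pow_three_pos hT).le (mixRate_pos hL j).le) (by positivity)
    rw [← add_assoc n i 1]
    push_cast
    linarith [ih (by omega)]

theorem integral_pathCost_output_le_stack (hT : 0 < T) {n a k : ℕ} (hn : n ≤ T.size)
    (ha : 2 ^ (T.size - (n + 1)) ∣ a) (hk : k ≤ T) :
    ∫ c, pathCost l (output l e T b c) a k ∂coinLaw
      ≤ (∫ c, pathCost l (stack l e T.size (Fintype.card X * T).size (1 / (T : ℝ) ^ 3) b c n)
        a k ∂coinLaw) + 12 * (1 + diameter X) := by
  have hD : 0 ≤ diameter X := Metric.diam_nonneg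
  obtain ⟨i, hi⟩ := Nat.exists_eq_add_of_le hn
  have hiT : (i : ℝ) ≤ T := by
    exact_mod_cast (show i ≤ T.size by omega).trans (Nat.size_le.2 Nat.lt_two_pow_self)
  have hstack := integral_pathCost_stack_add_le l e b hT (m := (Fintype.card X * T).size) hi.ge
    ha hk
  rw [← hi] at hstack
  refine hstack.trans (add_le_add_right ?_ _)
  calc i * (T * (12 * (1 + diameter X) / (T : ℝ) ^ 2))
      ≤ T * (T * (12 * (1 + diameter X) / (T : ℝ) ^ 2)) := by gcongr
    _ = 12 * (1 + diameter X) := by field_simp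

theorem integral_pathCost_output_le_base (hT : 0 < T) :
    ∫ c, pathCost l (output l e T b c) 0 T ∂coinLaw
      ≤ pathCost l b 0 T + 12 * (1 + diameter X) := by
  have h := integral_pathCost_output_le_stack l e b hT T.size.zero_le (dvd_zero _) le_rfl
  simpa only [stack, integral_const, probReal_univ, one_smul] using h

theorem integrable_pathCost_output (a k : ℕ) :
    Integrable (fun c => pathCost l (output l e T b c) a k) coinLaw :=
  integrable_pathCost_stack l e b _ a k

theorem integral_pathCost_output_le_of_lt_size {j : ℕ} (hj : 2 ^ j ≤ T.size) (a : ℕ) :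
    ∫ c, pathCost l (output l e T b c) a (2 ^ j) ∂coinLaw
      ≤ (1 + diameter X) * (√T.size * √(2 ^ j)) := by
  have hD : 0 ≤ diameter X := Metric.diam_nonneg
  calc ∫ c, pathCost l (output l e T b c) a (2 ^ j) ∂coinLaw
      ≤ ∫ _, (1 + diameter X) * (2 ^ j : ℕ) ∂coinLaw :=
        integral_mono (integrable_pathCost_output l e b _ _) (integrable_const _)
          fun c => pathCost_le l _ _ _
    _ = (1 + diameter X) * (√(2 ^ j) * √(2 ^ j)) := by
        rw [integral_const, probReal_univ, one_smul, Real.mul_self_sqrt (by positivity)]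
        push_cast
        rfl
    _ ≤ (1 + diameter X) * (√T.size * √(2 ^ j)) := by
        gcongr
        exact_mod_cast hj

theorem integral_pathCost_scaleLeader_le {m : ℕ} (hm : 0 < m) (j : ℕ) {a : ℕ} (ha : 2 ^ j ∣ a)
    (x : X) :
    ∫ c, pathCost l (scaleLeader l e m j c) a (2 ^ j) ∂coinLaw
      ≤ ∑ t ∈ Finset.Ico a (a + 2 ^ j), (l t : X → ℝ) x
        + (Real.log (2 * Fintype.card X) / leaderRate X m j
          + 2 ^ j * (diameter X * (2 * leaderRate X m j))) := by
  have hD : 0 ≤ diameter X := Metric.diam_nonneg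
  have hη : 0 < leaderRate X m j := Real.sqrt_pos.2 (by positivity)
  obtain ⟨k, hk⟩ := Nat.exists_eq_succ_of_ne_zero (Nat.two_pow_pos j).ne'
  have hleader := integral_pathCost_leader_le l e hη ha (k := k) hk.ge x
  have hk' : (k : ℝ) + 1 = 2 ^ j := by exact_mod_cast hk.symm
  rwa [hk', ← Nat.succ_eq_add_one, ← hk] at hleader

theorem integral_pathCost_output_le_of_dvd (hT : 0 < T)
    (hm : Real.log (2 * Fintype.card X) ≤ (Fintype.card X * T).size) {j a : ℕ} (hj : 2 ^ j ≤ T)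
    (ha : 2 ^ j ∣ a) (x : X) :
    ∫ c, pathCost l (output l e T b c) a (2 ^ j) ∂coinLaw
      ≤ ∑ t ∈ Finset.Ico a (a + 2 ^ j), (l t : X → ℝ) x
        + (49 * ((1 + diameter X) * √T.size)
          + 3 * √((diameter X + 1) * (Fintype.card X * T).size)) * √(2 ^ j) := by
  have hD : 0 ≤ diameter X := Metric.diam_nonneg
  rw [add_mul, mul_assoc 49, mul_assoc (1 + diameter X), mul_assoc 3]
  rcases le_or_gt (2 ^ j) T.size with hle | hgt
  · have hloss : 0 ≤ ∑ t ∈ Finset.Ico a (a + 2 ^ j), (l t : X → ℝ) x :=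
      Finset.sum_nonneg fun t _ => loss_nonneg l t x
    have hscale : 0 ≤ √((diameter X + 1) * (Fintype.card X * T).size) * √(2 ^ j) := by positivity
    have hprod : 0 ≤ (1 + diameter X) * (√T.size * √(2 ^ j)) := by positivity
    linarith [integral_pathCost_output_le_of_lt_size l e b hle a]
  · have hm0 : 0 < (Fintype.card X * T).size :=
      Nat.size_pos.2 (Nat.mul_pos Fintype.card_pos hT)
    obtain ⟨n, hn⟩ := Nat.exists_eq_add_of_lt (Nat.lt_size.2 hj)
    have hfine := integral_pathCost_output_le_stack l e b hT (n := n + 1) (by omega)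
      ((pow_dvd_pow 2 (by omega)).trans ha) hj
    have hmix := integral_pathCost_stack_succ_le_leader l e b (m := (Fintype.card X * T).size)
      (one_div_pow_three_pos hT) (one_div_pow_three_le_one T) hn.symm ha
    have hone : 1 + diameter X ≤ (1 + diameter X) * (√T.size * √(2 ^ j)) :=
      le_mul_of_one_le_right (by positivity) (one_le_sqrt_size_mul_sqrt_two_pow hT j)
    linarith [integral_pathCost_scaleLeader_le l e hm0 j ha x, mix_regret_le (X := X) hT hj hgt.le,
      leader_regret_le (X := X) hm0 hm j]

theorem integral_pathCost_output_add_le (a k n : ℕ) :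
    ∫ c, pathCost l (output l e T b c) a (k + n) ∂coinLaw
      ≤ ((∫ c, pathCost l (output l e T b c) a k ∂coinLaw)
        + ∫ c, pathCost l (output l e T b c) (a + k) n ∂coinLaw) + diameter X := by
  have hint := integrable_pathCost_output l e (T := T) b
  have hadd := integral_mono (hint a (k + n))
    (((hint a k).add (hint (a + k) n)).add (integrable_const (diameter X)))
    fun c => pathCost_add_le l (output l e T b c) a k n
  rwa [integral_add' ((hint a k).add (hint (a + k) n)) (integrable_const _),
    integral_add' (hint a k) (hint (a + k) n), integral_const, probReal_univ, one_smul] at hadd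

theorem integral_pathCost_output_le (hT : 0 < T)
    (hm : Real.log (2 * Fintype.card X) ≤ (Fintype.card X * T).size) {k : ℕ} (hk : k ≤ T)
    (a : ℕ) (x : X) :
    ∫ c, pathCost l (output l e T b c) a k ∂coinLaw
      ≤ ∑ t ∈ Finset.Ico a (a + k), (l t : X → ℝ) x
        + 6 * (50 * ((1 + diameter X) * √T.size)
          + 3 * √((diameter X + 1) * (Fintype.card X * T).size)) * √k := by
  have hD : 0 ≤ diameter X := Metric.diam_nonneg
  rcases k.eq_zero_or_pos with rfl | hk0
  · simp [pathCost_zero]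
  have hregret := le_six_mul_sqrt_of_dyadic (T := T)
    (ρ := fun a k => ((∫ c, pathCost l (output l e T b c) a k ∂coinLaw)
      - ∑ t ∈ Finset.Ico a (a + k), (l t : X → ℝ) x) + diameter X)
    (W := 50 * ((1 + diameter X) * √T.size)
      + 3 * √((diameter X + 1) * (Fintype.card X * T).size))
    (by positivity) (fun a k n => ?_) (fun j a hj ha => ?_) (a := a) hk0 hk
  · linarith
  · have hcost := integral_pathCost_output_add_le l e (T := T) b a k n
    have hloss := Finset.sum_Ico_consecutive (fun t => (l t : X → ℝ) x)
      (show a ≤ a + k by omega) (show a + k ≤ a + (k + n) by omega)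
    simp only [add_assoc] at hcost hloss ⊢
    linarith
  · have hcost := integral_pathCost_output_le_of_dvd l e b hT hm hj ha x
    have hone := mul_le_mul_of_nonneg_left (one_le_sqrt_size_mul_sqrt_two_pow hT j)
      (by positivity : 0 ≤ 1 + diameter X)
    linarith

end Output

/-! ### Reasoning about programs -/

/-- `s'` differs from `s` at most in the integer arrays `I`, the real arrays `R`, the number of
draws, and the time. -/
structure Store.Frame (I R : List ℕ) (s s' : Store) : Prop where
  int : ∀ a ∉ I, s'.int a = s.int a
  real : ∀ a ∉ R, s'.real a = s.real a

namespace Store.Frame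

variable {I R : List ℕ} {s s' : Store}

theorem refl (I R : List ℕ) (s : Store) : Store.Frame I R s s :=
  ⟨fun _ _ => rfl, fun _ _ => rfl⟩

theorem tick (h : Store.Frame I R s s') (k : ℕ) : Store.Frame I R s (s'.tick k) :=
  ⟨h.int, h.real⟩

theorem setInt (h : Store.Frame I R s s') {a : ℕ} (ha : a ∈ I) (i v : ℕ) :
    Store.Frame I R s (s'.setInt a i v) where
  int c hc := (Function.update_of_ne (ne_of_mem_of_not_mem ha hc).symm _ _).trans (h.int c hc)
  real := h.real

theorem setReal (h : Store.Frame I R s s') {a : ℕ} (ha : a ∈ R) (i : ℕ) (v : ℝ) :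
    Store.Frame I R s (s'.setReal a i v) where
  int := h.int
  real c hc := (Function.update_of_ne (ne_of_mem_of_not_mem ha hc).symm _ _).trans (h.real c hc)

theorem whileUpTo (b : Test) {body : Store → Store}
    (hbody : ∀ s', Store.Frame I R s s' → Store.Frame I R s (body s')) (n : ℕ)
    (h : Store.Frame I R s s') : Store.Frame I R s (whileUpTo b body n s') := by
  induction n generalizing s' with
  | zero => exact h
  | succ n ih =>
    rw [_root_.whileUpTo]
    split_ifs
    · exact ih (hbody _ (h.tick _))
    · exact h.tick _

end Store.Frame

@[simp] theorem IExp.eval_tick (i : IExp) (s : Store) (k : ℕ) : i.eval (s.tick k) = i.eval s := by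
  induction i with
  | lit n => rfl
  | get a i ih => simp only [IExp.eval, ih]; rfl
  | add i j hi hj => simp only [IExp.eval, hi, hj]
  | sub i j hi hj => simp only [IExp.eval, hi, hj]
  | mul i j hi hj => simp only [IExp.eval, hi, hj]

@[simp] theorem RExp.eval_tick (x : RExp) (s : Store) (k : ℕ) : x.eval (s.tick k) = x.eval s := by
  induction x with
  | ofInt i => simp only [RExp.eval, IExp.eval_tick]
  | get a i => simp only [RExp.eval, IExp.eval_tick]; rfl
  | add x y hx hy => simp only [RExp.eval, hx, hy]
  | sub x y hx hy => simp only [RExp.eval, hx, hy]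
  | mul x y hx hy => simp only [RExp.eval, hx, hy]
  | div x y hx hy => simp only [RExp.eval, hx, hy]
  | exp x hx => simp only [RExp.eval, hx]
  | pow x y hx hy => simp only [RExp.eval, hx, hy]
  | erf x hx => simp only [RExp.eval, hx]

namespace Program

/-- The integer arrays that a program may write to. -/
def intArrays : Program → List ℕ
  | skip | setReal _ _ _ | draw _ _ => []
  | setInt a _ _ => [a]
  | seq c d | ite _ c d => c.intArrays ++ d.intArrays
  | loop _ _ c => c.intArrays

/-- The real arrays that a program may write to. -/
def realArrays : Program → List ℕ
  | skip | setInt _ _ _ => []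
  | setReal a _ _ | draw a _ => [a]
  | seq c d | ite _ c d => c.realArrays ++ d.realArrays
  | loop _ _ c => c.realArrays

/-- Programs without loops. -/
def Flat : Program → Prop
  | skip | setInt _ _ _ | setReal _ _ _ | draw _ _ => True
  | seq c d | ite _ c d => c.Flat ∧ d.Flat
  | loop _ _ _ => False

/-- A bound on the time of a program without loops. -/
def flatCost : Program → ℕ
  | skip => 1
  | setInt _ i v => i.cost + v.cost + 1
  | setReal _ i v => i.cost + v.cost + 1
  | draw _ i => i.cost + 1
  | seq c d => c.flatCost + d.flatCost
  | ite b c d => b.cost + (c.flatCost + d.flatCost)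
  | loop _ _ _ => 0

/-- Assign to an integer entry if `b` holds. -/
def condInt (b : Test) (a : ℕ) (i v : IExp) : Program := ite b (setInt a i v) skip

/-- Assign to a real entry if `b` holds. -/
def condReal (b : Test) (a : ℕ) (i : IExp) (v : RExp) : Program := ite b (setReal a i v) skip

variable (coins : ℕ → unitInterval) (s : Store)

theorem _root_.Store.Frame.exec {I R : List ℕ} {c : Program} (hI : c.intArrays ⊆ I)
    (hR : c.realArrays ⊆ R) {s s' : Store} (h : Store.Frame I R s s') :
    Store.Frame I R s (c.exec coins s') := by
  induction c generalizing s' with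
  | skip => exact h.tick 1
  | setInt a i v => exact (h.setInt (hI (List.mem_singleton_self a)) _ _).tick _
  | setReal a i v => exact (h.setReal (hR (List.mem_singleton_self a)) _ _).tick _
  | draw a i =>
    have hset := h.setReal (hR (List.mem_singleton_self a)) (i.eval s') (coins s'.drawn)
    exact ⟨hset.int, hset.real⟩
  | seq c d ihc ihd =>
    rw [intArrays, List.append_subset] at hI
    rw [realArrays, List.append_subset] at hR
    exact ihd hI.2 hR.2 (ihc hI.1 hR.1 h)
  | ite b c d ihc ihd =>
    rw [intArrays, List.append_subset] at hI
    rw [realArrays, List.append_subset] at hR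
    rw [Program.exec]
    split_ifs
    · exact ihc hI.1 hR.1 (h.tick _)
    · exact ihd hI.2 hR.2 (h.tick _)
  | loop n b c ih => exact (h.tick _).whileUpTo b (fun s' => ih hI hR) _

theorem exec_seq (c d : Program) : (seq c d).exec coins s = d.exec coins (c.exec coins s) := rfl

theorem int_setInt (a : ℕ) (i v : IExp) : ((setInt a i v).exec coins s).int
    = Function.update s.int a (Function.update (s.int a) (i.eval s) (v.eval s)) := rfl

theorem real_setInt (a : ℕ) (i v : IExp) : ((setInt a i v).exec coins s).real = s.real := rfl

theorem int_setReal (a : ℕ) (i : IExp) (v : RExp) :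
    ((setReal a i v).exec coins s).int = s.int := rfl

theorem real_setReal (a : ℕ) (i : IExp) (v : RExp) : ((setReal a i v).exec coins s).real
    = Function.update s.real a (Function.update (s.real a) (i.eval s) (v.eval s)) := rfl

theorem int_draw (a : ℕ) (i : IExp) : ((draw a i).exec coins s).int = s.int := rfl

theorem real_draw (a : ℕ) (i : IExp) : ((draw a i).exec coins s).real
    = Function.update s.real a (Function.update (s.real a) (i.eval s) (coins s.drawn)) := rfl

open Classical in
theorem int_condInt (b : Test) (a : ℕ) (i v : IExp) : ((condInt b a i v).exec coins s).int
    = Function.update s.int a (Function.update (s.int a) (i.eval s)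
      (if b.Holds s then v.eval s else s.int a (i.eval s))) := by
  by_cases hb : b.Holds s
  · simp only [condInt, exec, if_pos hb, IExp.eval_tick]
    rfl
  · simp only [condInt, exec, if_neg hb, Function.update_eq_self]
    rfl

theorem real_condInt (b : Test) (a : ℕ) (i v : IExp) :
    ((condInt b a i v).exec coins s).real = s.real := by
  simp only [condInt, exec]
  split_ifs <;> rfl

theorem drawn_condInt (b : Test) (a : ℕ) (i v : IExp) :
    ((condInt b a i v).exec coins s).drawn = s.drawn := by
  simp only [condInt, exec]
  split_ifs <;> rfl

theorem int_condReal (b : Test) (a : ℕ) (i : IExp) (v : RExp) :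
    ((condReal b a i v).exec coins s).int = s.int := by
  simp only [condReal, exec]
  split_ifs <;> rfl

open Classical in
theorem real_condReal (b : Test) (a : ℕ) (i : IExp) (v : RExp) :
    ((condReal b a i v).exec coins s).real
    = Function.update s.real a (Function.update (s.real a) (i.eval s)
      (if b.Holds s then v.eval s else s.real a (i.eval s))) := by
  by_cases hb : b.Holds s
  · simp only [condReal, exec, if_pos hb, IExp.eval_tick, RExp.eval_tick]
    rfl
  · simp only [condReal, exec, if_neg hb, Function.update_eq_self]
    rfl

theorem time_exec_le {c : Program} (hc : c.Flat) :
    (c.exec coins s).time ≤ s.time + c.flatCost := by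
  induction c generalizing s with
  | skip => exact le_rfl
  | setInt a i v => exact le_rfl
  | setReal a i v => exact le_rfl
  | draw a i => exact (Nat.add_assoc _ _ _).le
  | seq c d ihc ihd =>
    have hfirst := ihc s hc.1
    have hsecond := ihd (c.exec coins s) hc.2
    simp only [exec_seq, flatCost]
    omega
  | ite b c d ihc ihd =>
    have hthen := ihc (s.tick b.cost) hc.1
    have helse := ihd (s.tick b.cost) hc.2
    simp only [exec, flatCost, Store.tick] at *
    split_ifs <;> omega
  | loop n b c => exact hc.elim

end Program

/-- A test that always holds. -/
def Test.always : Test := .intLE (.lit 0) (.lit 0)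

theorem Test.holds_always (s : Store) : Test.always.Holds s := le_refl 0

section Loops

variable {b : Test} {body : Store → Store} {s : Store}

theorem exists_whileUpTo_eq_tick (I : ℕ → Store → Prop) {k n : ℕ} (hkn : k ≤ n) (hs : I 0 s)
    (hstep : ∀ i < k, ∀ s, I i s → b.Holds s ∧ I (i + 1) (body (s.tick b.cost)))
    (hend : ∀ s, I k s → ¬ b.Holds s) :
    ∃ s' c, I k s' ∧ c ≤ b.cost ∧ whileUpTo b body n s = s'.tick c := by
  induction k generalizing n s I with
  | zero =>
    cases n with
    | zero => exact ⟨s, 0, hs, Nat.zero_le _, rfl⟩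
    | succ n => exact ⟨s, b.cost, hs, le_rfl, by rw [whileUpTo, if_neg (hend s hs)]⟩
  | succ k ih =>
    obtain ⟨n, rfl⟩ := Nat.exists_eq_add_of_lt hkn
    obtain ⟨hb, hnext⟩ := hstep 0 k.succ_pos s hs
    rw [whileUpTo, if_pos hb]
    exact ih (fun i => I (i + 1)) (Nat.le_add_right k n) hnext
      (fun i hi => hstep (i + 1) (Nat.succ_lt_succ hi)) hend

theorem whileUpTo_always (I : ℕ → Store → Prop) {n : ℕ} (hs : I 0 s)
    (hstep : ∀ i < n, ∀ s, I i s → I (i + 1) (body (s.tick 3))) :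
    I n (whileUpTo .always body n s) := by
  induction n generalizing s I with
  | zero => exact hs
  | succ n ih =>
    rw [whileUpTo, if_pos (Test.holds_always s)]
    exact ih (fun i => I (i + 1)) (hstep 0 n.succ_pos s hs)
      fun i hi => hstep (i + 1) (Nat.succ_lt_succ hi)

theorem time_whileUpTo_always_le {I : Store → Prop} {c : ℕ}
    (hbody : ∀ s, I s → I (body (s.tick 3)) ∧ (body (s.tick 3)).time ≤ s.time + c) (hs : I s)
    (n : ℕ) : (whileUpTo .always body n s).time ≤ s.time + n * c :=
  (whileUpTo_always (fun i s' => I s' ∧ s'.time ≤ s.time + i * c) ⟨hs, by simp⟩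
    fun i _ s' ⟨hI, htime⟩ => ⟨(hbody s' hI).1, by linarith [(hbody s' hI).2]⟩).2

end Loops

/-! ### The program -/

namespace Overlay

local infixr:30 " ;; " => Program.seq

/-- Entry `0` of an integer array. -/
def cell (a : ℕ) : IExp := .get a (.lit 0)

def states : IExp := cell 0

def horizon : IExp := cell 1

/-- The output of the finest layer that has been computed so far. -/
def current : IExp := cell 3

/-- The number of the state that a loop over the states has reached. -/
def index : IExp := cell 11

/-- The exponent `j` of the time scale `2 ^ j` that the loop over the time scales has reached. -/
def scale : IExp := cell 12

/-- The state of least perturbed weight among those that the loop over the states has passed. -/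
def best : IExp := cell 13

def scaleLength : IExp := .get 4 scale

def one : RExp := .ofInt (.lit 1)

def diameterExp : RExp := .get 0 (.lit 0)

def sqrt (x : RExp) : RExp := .pow x (.div one (.ofInt (.lit 2)))

def sizeStep : Program :=
  .setInt 4 (cell 9) (cell 10) ;;
  .condInt (.intLE (cell 10) horizon) 8 (.lit 0) (.add (cell 8) (.lit 1)) ;;
  .setInt 9 (.lit 0) (.add (cell 9) (.lit 1)) ;;
  .setInt 10 (.lit 0) (.mul (cell 10) (.lit 2))

/-- Compute the binary lengths of `T` and of `N * T`, and the powers of `2` up to `N * T`. -/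
def computeSizes : Program :=
  .setInt 10 (.lit 0) (.lit 1) ;;
  .loop (.mul states horizon) (.intLE (cell 10) (.mul states horizon)) sizeStep

def drawStep : Program := .draw 3 index ;; .setInt 11 (.lit 0) (.add index (.lit 1))

/-- Draw one coin for each state and one for each time scale. -/
def drawCoins : Program :=
  .setInt 11 (.lit 0) (.lit 0) ;; .loop (.add states (cell 8)) .always drawStep

/-- The test whether the current round is a multiple of the length of the time scale. -/
def restart : Test := .intLE (.get 5 scale) (.lit 0)

def weightIndex (i : IExp) : IExp := .add (.mul scale states) i

def leaderRateExp : RExp :=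
  sqrt (.div (.ofInt (cell 9)) (.mul (.add diameterExp one) (.ofInt scaleLength)))

def leaderStep : Program :=
  .condReal restart 4 (weightIndex index) (.add (.get 3 index) (.div one (.ofInt states))) ;;
  .setReal 4 (weightIndex index)
    (.mul (.get 4 (weightIndex index)) (.exp (.mul leaderRateExp (.get 2 index)))) ;;
  .condInt (.realLE (.get 4 (weightIndex index)) (.get 4 (weightIndex best))) 13 (.lit 0) index ;;
  .setInt 11 (.lit 0) (.add index (.lit 1))

/-- Compute the perturbed leader on the current time scale. -/
def computeLeader : Program := .loop states .always leaderStep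

def mixRateExp : RExp :=
  sqrt (.div (.ofInt (cell 8)) (.add (.ofInt scaleLength) (.ofInt (cell 8))))

/-- The cost of being in the state `i` after the state `j`. -/
def stateCost (i j : IExp) : RExp := .add (.get 2 i) (.get 1 (.add (.mul i states) j))

/-- The advantage of the expert with cost `y` over the base path with cost `x`. -/
def advantageExp (x y : RExp) : RExp :=
  .div (.mul mixRateExp (.sub (.sub x y) (.mul diameterExp mixRateExp)))
    (.mul (.ofInt (.lit 4)) (.add one diameterExp))

def initialBias : RExp :=
  .div one (.mul (.mul (.ofInt horizon) (.ofInt horizon)) (.ofInt horizon))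

def updateBias : Program :=
  .ite restart
    (.setReal 5 scale (.mul initialBias (.exp (advantageExp (.get 2 current) (.get 2 best)))))
    (.setReal 5 scale (.mul (.get 5 scale) (.exp
      (advantageExp (stateCost current (.get 6 scale)) (stateCost best (.get 7 scale))))))

def remember : Program := .setInt 6 scale current ;; .setInt 7 scale best

def choose : Program :=
  .condInt (.realLE (.get 3 (.add states scale)) (.get 5 scale)) 3 (.lit 0) best

def updateCount : Program :=
  .setInt 5 scale (.add (.get 5 scale) (.lit 1)) ;;
  .condInt (.intLE scaleLength (.get 5 scale)) 5 scale (.lit 0)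

def beginScale : Program :=
  .setInt 12 (.lit 0) (.sub scale (.lit 1)) ;;
  .setInt 11 (.lit 0) (.lit 0) ;;
  .setInt 13 (.lit 0) (.lit 0)

def endScale : Program := updateBias ;; remember ;; choose ;; updateCount

/-- Mix in the perturbed leader on the next time scale. -/
def scaleStep : Program := beginScale ;; computeLeader ;; endScale

def mixScales : Program := .loop (cell 8) .always scaleStep

def beginRound : Program := .setInt 3 (.lit 0) (cell 2) ;; .setInt 12 (.lit 0) (cell 8)

/-- The program of one round. Its integer arrays are: `4` the powers of `2`; for each time scale,
`5` the position of the round in its window, `6` and `7` the states of the base path and of the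
leader in the previous round; `8` and `9` the binary lengths of `T` and `N * T`; `10` to `13` the
variables of the loops. Its real arrays are: `3` the coins; `4` the perturbed weights, one row for
each time scale; `5` the biases. -/
def program : Program :=
  .ite (.intLE (cell 8) (.lit 0)) (computeSizes ;; drawCoins) .skip ;; beginRound ;; mixScales

end Overlay

/-! ### Correctness of the program -/

theorem apply_decode {X : Type*} [Fintype X] [Nonempty X] (e : X ≃ Fin (Fintype.card X)) {n : ℕ}
    (hn : n < Fintype.card X) : (e (decode e n) : ℕ) = n := by
  simp [decode, hn]

theorem restartedExp_eq_ite {q : ℕ} {w y : ℝ} {z : ℕ → ℝ} {t : ℕ}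
    (hy : t % q ≠ 0 → y = restartedExp q w z (t - 1)) :
    restartedExp q w z t = (if t % q = 0 then w else y) * Real.exp (z t) := by
  split_ifs with ht
  · exact restartedExp_of_mod_eq_zero w z ht
  · obtain _ | t := t
    · exact absurd (Nat.zero_mod q) ht
    · rw [restartedExp_succ w z ht, hy ht, Nat.add_sub_cancel]

theorem succ_mod_eq_ite (t : ℕ) {q : ℕ} (hq : 0 < q) :
    (t + 1) % q = if q ≤ t % q + 1 then 0 else t % q + 1 := by
  rw [← Nat.mod_add_mod]
  split_ifs with h
  · rw [le_antisymm (Nat.mod_lt t hq) h, Nat.mod_self]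
  · exact Nat.mod_eq_of_lt (not_le.1 h)

theorem mul_add_ne_mul_add {N i j k m : ℕ} (hij : i ≠ j) (hk : k < N) (hm : m < N) :
    i * N + k ≠ j * N + m := by
  have hdiv : ∀ a, ∀ c < N, (a * N + c) / N = a := fun a c hc => by
    rw [mul_comm, Nat.mul_add_div (by omega), Nat.div_eq_of_lt hc, add_zero]
  exact fun h => hij (by rw [← hdiv i k hk, h, hdiv j m hm])

namespace Overlay

open Fintype (card)

attribute [local simp] IExp.eval RExp.eval Test.Holds cell states horizon current index scale best
  scaleLength one diameterExp restart weightIndex stateCost Program.exec_seq Program.int_setInt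
  Program.real_setInt Program.int_setReal Program.real_setReal Program.int_condInt
  Program.real_condInt Program.int_condReal Program.real_condReal

@[local simp] theorem eval_sqrt (x : RExp) (s : Store) : (sqrt x).eval s = √(x.eval s) := by
  simp only [sqrt, RExp.eval, one, IExp.eval, positivePow]
  split_ifs with h
  · rw [Real.sqrt_eq_rpow]
    norm_num
  · rw [Real.sqrt_eq_zero_of_nonpos (not_lt.1 h)]

variable {X : Type*} [Fintype X] [PseudoMetricSpace X] {M : MTS X} (l : ℕ → M.losses)
  (e : X ≃ Fin (card X)) (T : ℕ) (b : ℕ → X) (U : ℕ → unitInterval)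

/-- The store contains the input of round `t`. -/
structure Input (t : ℕ) (s : Store) : Prop where
  states : s.int 0 0 = card X
  horizon : s.int 1 0 = T
  diameter : s.real 0 0 = diameter X
  dist : ∀ x y : X, s.real 1 (e x * card X + e y) = dist x y
  loss : ∀ x : X, s.real 2 (e x) = (l t : X → ℝ) x

/-- The store contains the input of round `t` and the results of the preparations that are made in
the first round. -/
structure Prepared (t : ℕ) (s : Store) : Prop extends Input l e T t s where
  scaleCount : s.int 8 0 = T.size
  size : s.int 9 0 = (card X * T).size
  power : ∀ j < T.size, s.int 4 j = 2 ^ j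
  coins : ∀ i < card X + T.size, s.real 3 i = U i

/-- Two stores contain the same data of the time scale `2 ^ j` if there are `N` states. -/
structure SameScale (N j : ℕ) (s s' : Store) : Prop where
  count : s'.int 5 j = s.int 5 j
  coarse : s'.int 6 j = s.int 6 j
  lead : s'.int 7 j = s.int 7 j
  bias : s'.real 5 j = s.real 5 j
  weight : ∀ i < N, s'.real 4 (j * N + i) = s.real 4 (j * N + i)

section Frame

variable {l e T U} {t : ℕ} {s s' : Store} {I R : List ℕ}

theorem Input.of_frame (h : Input l e T t s) (hf : Store.Frame I R s s')
    (hI : 0 ∉ I ∧ 1 ∉ I) (hR : 0 ∉ R ∧ 1 ∉ R ∧ 2 ∉ R) : Input l e T t s' where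
  states := by rw [hf.int 0 hI.1, h.states]
  horizon := by rw [hf.int 1 hI.2, h.horizon]
  diameter := by rw [hf.real 0 hR.1, h.diameter]
  dist := by rw [hf.real 1 hR.2.1]; exact h.dist
  loss := by rw [hf.real 2 hR.2.2]; exact h.loss

theorem Prepared.of_frame (h : Prepared l e T U t s) (hf : Store.Frame I R s s')
    (hI : 0 ∉ I ∧ 1 ∉ I ∧ 4 ∉ I ∧ 8 ∉ I ∧ 9 ∉ I) (hR : 0 ∉ R ∧ 1 ∉ R ∧ 2 ∉ R ∧ 3 ∉ R) :
    Prepared l e T U t s' where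
  toInput := h.toInput.of_frame hf ⟨hI.1, hI.2.1⟩ ⟨hR.1, hR.2.1, hR.2.2.1⟩
  scaleCount := by rw [hf.int 8 hI.2.2.2.1, h.scaleCount]
  size := by rw [hf.int 9 hI.2.2.2.2, h.size]
  power := by rw [hf.int 4 hI.2.2.1]; exact h.power
  coins := by rw [hf.real 3 hR.2.2.2]; exact h.coins

theorem SameScale.of_frame (hf : Store.Frame I R s s') (hI : 5 ∉ I ∧ 6 ∉ I ∧ 7 ∉ I)
    (hR : 4 ∉ R ∧ 5 ∉ R) (N j : ℕ) : SameScale N j s s' where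
  count := by rw [hf.int 5 hI.1]
  coarse := by rw [hf.int 6 hI.2.1]
  lead := by rw [hf.int 7 hI.2.2]
  bias := by rw [hf.real 5 hR.2]
  weight i _ := by rw [hf.real 4 hR.1]

end Frame

variable [Nonempty X]

/-- The path into which the leader on the time scale `2 ^ j` is mixed. -/
noncomputable def coarse (j : ℕ) : ℕ → X :=
  stack l e T.size (card X * T).size (1 / (T : ℝ) ^ 3) b U (T.size - (j + 1))

/-- The leader on the time scale `2 ^ j`. -/
noncomputable def lead (j : ℕ) : ℕ → X :=
  scaleLeader l e (card X * T).size j U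

/-- The perturbed weights of the states on the time scale `2 ^ j`. -/
noncomputable def weights (j t : ℕ) : ℕ → ℝ :=
  perturbedWeight (fun s i => (l s : X → ℝ) (decode e i)) (card X) (2 ^ j)
    (leaderRate X (card X * T).size j) U t

/-- The bias towards the leader on the time scale `2 ^ j`. -/
noncomputable def scaleBias (j : ℕ) : ℕ → ℝ :=
  bias l (2 ^ j) (1 / (T : ℝ) ^ 3) (mixRate T.size j) (coarse l e T b U j) (lead l e T U j)

/-- The store contains the data of the time scale `2 ^ j` that are needed in round `t`. -/
structure ScaleData (j t : ℕ) (s : Store) : Prop where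
  count : s.int 5 j = t % 2 ^ j
  coarse : t % 2 ^ j ≠ 0 → s.int 6 j = e (coarse l e T b U j (t - 1))
  lead : t % 2 ^ j ≠ 0 → s.int 7 j = e (lead l e T U j (t - 1))
  bias : t % 2 ^ j ≠ 0 → s.real 5 j = scaleBias l e T b U j (t - 1)
  weight : t % 2 ^ j ≠ 0 → ∀ i < card X, s.real 4 (j * card X + i) = weights l e T U j (t - 1) i

variable {l e T b U} {t : ℕ} {s s' : Store}

theorem ScaleData.congr {j : ℕ} (h : ScaleData l e T b U j t s) (hs : SameScale (card X) j s s') :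
    ScaleData l e T b U j t s' where
  count := by rw [hs.count, h.count]
  coarse ht := by rw [hs.coarse, h.coarse ht]
  lead ht := by rw [hs.lead, h.lead ht]
  bias ht := by rw [hs.bias, h.bias ht]
  weight ht i hi := by rw [hs.weight i hi, h.weight ht i hi]

section Leader

variable (coins : ℕ → unitInterval) {i j : ℕ}

theorem real_leaderStep (hi : i < card X) (hj : j < T.size) (hpr : Prepared l e T U t s)
    (hscale : s.int 12 0 = j) (hindex : s.int 11 0 = i) (hcount : s.int 5 j = t % 2 ^ j)
    (hweight : t % 2 ^ j ≠ 0 → s.real 4 (j * card X + i) = weights l e T U j (t - 1) i) :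
    (leaderStep.exec coins s).real 4
      = Function.update (s.real 4) (j * card X + i) (weights l e T U j t i) := by
  have hloss : s.real 2 i = (l t : X → ℝ) (decode e i) := by rw [← hpr.loss, apply_decode e hi]
  have hval : weights l e T U j t i
      = (if t % 2 ^ j = 0 then (U i : ℝ) + 1 / card X else s.real 4 (j * card X + i))
        * Real.exp (leaderRate X (card X * T).size j * (l t : X → ℝ) (decode e i)) :=
    restartedExp_eq_ite hweight
  simp [leaderStep, leaderRateExp, hpr.states, hpr.diameter, hloss, hpr.size, hpr.power j hj,
    hpr.coins i (by omega), hscale, hindex, hcount, hval, leaderRate]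

theorem int_leaderStep_index : (leaderStep.exec coins s).int 11 0 = s.int 11 0 + 1 := by
  simp [leaderStep]

open Classical in
theorem int_leaderStep_best : (leaderStep.exec coins s).int 13 0
    = if (leaderStep.exec coins s).real 4 (s.int 12 0 * s.int 0 0 + s.int 11 0)
        ≤ (leaderStep.exec coins s).real 4 (s.int 12 0 * s.int 0 0 + s.int 13 0)
      then s.int 11 0 else s.int 13 0 := by
  simp [leaderStep]

variable (l e T U) in
/-- The store `s'` arises from `s` by `i` steps of the computation of the leader. -/
structure LeaderLoop (j t i : ℕ) (s s' : Store) : Prop where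
  frame : Store.Frame [11, 13] [4] s s'
  index : s'.int 11 0 = i
  best : s'.int 13 0 = minIndex (weights l e T U j t) i
  weight : ∀ k < i, s'.real 4 (j * card X + k) = weights l e T U j t k
  rest : ∀ x, (∀ k < i, x ≠ j * card X + k) → s'.real 4 x = s.real 4 x

theorem LeaderLoop.tick (h : LeaderLoop l e T U j t i s s') (k : ℕ) :
    LeaderLoop l e T U j t i s (s'.tick k) :=
  ⟨h.frame.tick k, h.index, h.best, h.weight, h.rest⟩

theorem LeaderLoop.step (h : LeaderLoop l e T U j t i s s') (hi : i < card X) (hj : j < T.size)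
    (hpr : Prepared l e T U t s) (hscale : s.int 12 0 = j) (hdata : ScaleData l e T b U j t s) :
    LeaderLoop l e T U j t (i + 1) s (leaderStep.exec coins s') := by
  have hpr' : Prepared l e T U t s' := hpr.of_frame h.frame (by decide) (by decide)
  have hscale' : s'.int 12 0 = j := by rw [h.frame.int 12 (by decide), hscale]
  have hreal := real_leaderStep coins hi hj hpr' hscale' h.index
    (by rw [h.frame.int 5 (by decide), hdata.count])
    fun ht => by rw [h.rest _ fun k hk => by omega, hdata.weight ht i hi]
  have hbest : Function.update (s'.real 4) (j * card X + i) (weights l e T U j t i)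
      (j * card X + minIndex (weights l e T U j t) i)
      = weights l e T U j t (minIndex (weights l e T U j t) i) := by
    rcases Nat.eq_zero_or_pos i with rfl | hpos
    · simp [minIndex]
    · have hlt := minIndex_lt (weights l e T U j t) hpos
      rw [Function.update_of_ne (by omega), h.weight _ hlt]
  refine ⟨h.frame.exec coins (by decide) (by decide), by rw [int_leaderStep_index, h.index],
    ?_, fun k hk => ?_, fun x hx => ?_⟩
  · rw [int_leaderStep_best, hreal, hscale', hpr'.states, h.index, h.best, hbest,
      Function.update_self, minIndex]
  · rw [hreal]
    rcases Nat.lt_succ_iff_lt_or_eq.1 hk with hki | rfl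
    · rw [Function.update_of_ne (by omega), h.weight k hki]
    · rw [Function.update_self]
  · rw [hreal, Function.update_of_ne (hx i i.lt_succ_self), h.rest x fun k hk => hx k (by omega)]

theorem leaderLoop_computeLeader (hj : j < T.size) (hpr : Prepared l e T U t s)
    (hscale : s.int 12 0 = j) (hdata : ScaleData l e T b U j t s) (hindex : s.int 11 0 = 0)
    (hbest : s.int 13 0 = 0) : LeaderLoop l e T U j t (card X) s (computeLeader.exec coins s) := by
  have hexec : computeLeader.exec coins s
      = whileUpTo .always (leaderStep.exec coins) (card X) (s.tick 3) := by
    simp only [computeLeader, Program.exec, states, cell, IExp.eval, hpr.states, IExp.cost]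
  rw [hexec]
  refine whileUpTo_always (fun i s' => LeaderLoop l e T U j t i s s') ?_ fun i hi s' h =>
    (h.tick 3).step coins hi hj hpr hscale hdata
  exact ⟨(Store.Frame.refl _ _ s).tick 3, hindex, hbest, fun _ hk => absurd hk (Nat.not_lt_zero _),
    fun _ _ => rfl⟩

theorem coe_lead_apply (j t : ℕ) :
    (e (lead l e T U j t) : ℕ) = minIndex (weights l e T U j t) (card X) :=
  apply_decode e (minIndex_lt _ Fintype.card_pos)

end Leader

section Scale

variable (coins : ℕ → unitInterval) {j : ℕ}

section EndScale

theorem frame_endScale (s : Store) :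
    Store.Frame [3, 5, 6, 7] [5] s (endScale.exec coins s) :=
  (Store.Frame.refl _ _ s).exec coins (by decide) (by decide)

theorem frame_updateBias (s : Store) : Store.Frame [] [5] s (updateBias.exec coins s) :=
  (Store.Frame.refl _ _ s).exec coins (by decide) (by decide)

variable (hscale : s.int 12 0 = j) (hloop : LeaderLoop l e T U j t (card X) s s')

include hscale hloop

theorem int_endScale_lead : (endScale.exec coins s').int 7
    = Function.update (s.int 7) j (e (lead l e T U j t)) := by
  have hupdate := frame_updateBias coins s'
  simp [endScale, remember, choose, updateCount, hupdate.int, hloop.frame.int 12,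
    hloop.frame.int 7, hscale, hloop.best, coe_lead_apply]

theorem int_endScale_coarse (hcurrent : s.int 3 0 = e (coarse l e T b U j t)) :
    (endScale.exec coins s').int 6
      = Function.update (s.int 6) j (e (coarse l e T b U j t)) := by
  have hupdate := frame_updateBias coins s'
  simp [endScale, remember, choose, updateCount, hupdate.int, hloop.frame.int 12,
    hloop.frame.int 6, hloop.frame.int 3, hscale, hcurrent]

theorem int_endScale_count (hj : j < T.size) (hpr : Prepared l e T U t s)
    (hdata : ScaleData l e T b U j t s) : (endScale.exec coins s').int 5
    = Function.update (s.int 5) j ((t + 1) % 2 ^ j) := by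
  have hupdate := frame_updateBias coins s'
  have hpower : s'.int 4 j = 2 ^ j := by rw [hloop.frame.int 4 (by decide), hpr.power j hj]
  simp [endScale, remember, choose, updateCount, hupdate.int, hloop.frame.int 12,
    hloop.frame.int 5, hscale, hdata.count, hpower, succ_mod_eq_ite t (Nat.two_pow_pos j)]

variable (hj : j < T.size) (hpr : Prepared l e T U t s) (hdata : ScaleData l e T b U j t s)
  (hcurrent : s.int 3 0 = e (coarse l e T b U j t))

include hj hpr hdata hcurrent

theorem real_updateBias : (updateBias.exec coins s').real 5
    = Function.update (s.real 5) j (scaleBias l e T b U j t) := by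
  have hpr' : Prepared l e T U t s' := hpr.of_frame hloop.frame (by decide) (by decide)
  have hbest : s'.int 13 0 = e (lead l e T U j t) := by rw [hloop.best, coe_lead_apply]
  have hval : scaleBias l e T b U j t = _ := restartedExp_eq_ite hdata.bias
  have hcube : (T : ℝ) * T * T = (T : ℝ) ^ 3 := by ring
  have hrestart : restart.Holds s' ↔ t % 2 ^ j = 0 := by
    simp [hloop.frame.int 12, hloop.frame.int 5, hscale, hdata.count]
  have hscale' : s'.int 12 0 = j := by rw [hloop.frame.int 12 (by decide), hscale]
  have hcurrent' : s'.int 3 0 = e (coarse l e T b U j t) := by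
    rw [hloop.frame.int 3 (by decide), hcurrent]
  rw [hval, updateBias, Program.exec]
  by_cases ht : t % 2 ^ j = 0
  · rw [if_pos (hrestart.2 ht)]
    simp [advantageExp, mixRateExp, initialBias, Store.tick, hloop.frame.real 5, hscale', hcurrent',
      hbest, hpr'.horizon, hpr'.diameter, hpr'.scaleCount, hpr'.power j hj, hpr'.loss, hcube, ht,
      advantage, windowCost_of_mod_eq_zero, mixRate]
  · rw [if_neg (mt hrestart.1 ht)]
    simp [advantageExp, mixRateExp, Store.tick, hloop.frame.real 5, hscale', hcurrent', hbest,
      hpr'.states, hpr'.diameter, hpr'.scaleCount, hpr'.power j hj, hpr'.loss, hpr'.dist,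
      hloop.frame.int 6, hloop.frame.int 7, hdata.coarse ht, hdata.lead ht, ht, advantage,
      windowCost_of_mod_ne_zero, mixRate]

theorem real_endScale : (endScale.exec coins s').real 5
    = Function.update (s.real 5) j (scaleBias l e T b U j t) := by
  rw [← real_updateBias coins hscale hloop hj hpr hdata hcurrent]
  simp [endScale, remember, choose, updateCount]

theorem int_endScale_current : (endScale.exec coins s').int 3 0
    = e (stack l e T.size (card X * T).size (1 / (T : ℝ) ^ 3) b U (T.size - j) t) := by
  have hupdate := frame_updateBias coins s'
  have hbias := real_updateBias coins hscale hloop hj hpr hdata hcurrent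
  have hcoin : s'.real 3 (card X + j) = U (card X + j) := by
    rw [hloop.frame.real 3 (by decide), hpr.coins _ (by omega)]
  have hmix : stack l e T.size (card X * T).size (1 / (T : ℝ) ^ 3) b U (T.size - j) t
      = if (U (card X + j) : ℝ) ≤ scaleBias l e T b U j t then lead l e T U j t
        else coarse l e T b U j t := by
    rw [show T.size - j = T.size - (j + 1) + 1 by omega, stack_succ l e b (j := j) (by omega)]
    rfl
  rw [hmix, apply_ite e, apply_ite Fin.val]
  simp [endScale, remember, choose, updateCount, hupdate.int, hupdate.real, hloop.frame.int 12,
    hloop.frame.int 0, hloop.frame.int 3, hscale, hcurrent, hbias, hcoin, hpr.states, hloop.best,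
    coe_lead_apply]

theorem scaleData_endScale : ScaleData l e T b U j (t + 1) (endScale.exec coins s') where
  count := by
    rw [int_endScale_count coins hscale hloop hj hpr hdata, Function.update_self]
  coarse _ := by
    rw [int_endScale_coarse coins hscale hloop hcurrent, Function.update_self, Nat.add_sub_cancel]
  lead _ := by
    rw [int_endScale_lead coins hscale hloop, Function.update_self, Nat.add_sub_cancel]
  bias _ := by
    rw [real_endScale coins hscale hloop hj hpr hdata hcurrent, Function.update_self,
      Nat.add_sub_cancel]
  weight _ i hi := by
    rw [(frame_endScale coins s').real 4 (by decide), hloop.weight i hi, Nat.add_sub_cancel]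

theorem sameScale_endScale {i : ℕ} (hij : i ≠ j) :
    SameScale (card X) i s (endScale.exec coins s') where
  count := by
    rw [int_endScale_count coins hscale hloop hj hpr hdata, Function.update_of_ne hij]
  coarse := by
    rw [int_endScale_coarse coins hscale hloop hcurrent, Function.update_of_ne hij]
  lead := by
    rw [int_endScale_lead coins hscale hloop, Function.update_of_ne hij]
  bias := by
    rw [real_endScale coins hscale hloop hj hpr hdata hcurrent, Function.update_of_ne hij]
  weight k hk := by
    rw [(frame_endScale coins s').real 4 (by decide),
      hloop.rest _ fun m hm => mul_add_ne_mul_add hij hk hm]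

end EndScale

theorem int_beginScale_scale : (beginScale.exec coins s).int 12 0 = s.int 12 0 - 1 := by
  simp [beginScale]

theorem int_beginScale_index : (beginScale.exec coins s).int 11 0 = 0 := by
  simp [beginScale]

theorem int_beginScale_best : (beginScale.exec coins s).int 13 0 = 0 := by
  simp [beginScale]

variable (l e T b U) in
/-- In round `t`, the loop over the time scales has dealt with all scales `2 ^ i` with `j ≤ i`. -/
structure ScaleLoop (t j : ℕ) (s : Store) : Prop extends Prepared l e T U t s where
  scale : s.int 12 0 = j
  current : s.int 3 0
    = e (stack l e T.size (card X * T).size (1 / (T : ℝ) ^ 3) b U (T.size - j) t)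
  pending : ∀ i < j, ScaleData l e T b U i t s
  done : ∀ i < T.size, j ≤ i → ScaleData l e T b U i (t + 1) s

theorem ScaleLoop.step (hj : j < T.size) (h : ScaleLoop l e T b U t (j + 1) s) :
    ScaleLoop l e T b U t j (scaleStep.exec coins s) := by
  set s₁ := beginScale.exec coins s
  set s₂ := computeLeader.exec coins s₁
  have hbegin : Store.Frame [11, 12, 13] [] s s₁ :=
    (Store.Frame.refl _ _ s).exec coins (by decide) (by decide)
  have hpr : Prepared l e T U t s₁ := h.toPrepared.of_frame hbegin (by decide) (by decide)
  have hscale : s₁.int 12 0 = j := by rw [int_beginScale_scale, h.scale, Nat.add_sub_cancel]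
  have hsame : ∀ i, SameScale (card X) i s s₁ := .of_frame hbegin (by decide) (by decide) _
  have hdata : ScaleData l e T b U j t s₁ := (h.pending j j.lt_succ_self).congr (hsame j)
  have hcurrent : s₁.int 3 0 = e (coarse l e T b U j t) := by
    rw [hbegin.int 3 (by decide), h.current, coarse]
  have hloop : LeaderLoop l e T U j t (card X) s₁ s₂ :=
    leaderLoop_computeLeader coins hj hpr hscale hdata (int_beginScale_index coins)
      (int_beginScale_best coins)
  have hframe : Store.Frame [3, 5, 6, 7, 11, 13] [4, 5] s₁ (endScale.exec coins s₂) :=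
    ((Store.Frame.refl _ _ s₁).exec coins (c := computeLeader) (by decide) (by decide)).exec
      coins (by decide) (by decide)
  have hother : ∀ i ≠ j, SameScale (card X) i s₁ (endScale.exec coins s₂) := fun i hij =>
    sameScale_endScale coins hscale hloop hj hpr hdata hcurrent hij
  refine ⟨hpr.of_frame hframe (by decide) (by decide), ?_, ?_, fun i hi => ?_, fun i hi hji => ?_⟩
  · exact (hframe.int 12 (by decide) ▸ hscale)
  · exact int_endScale_current coins hscale hloop hj hpr hdata hcurrent
  · exact ((h.pending i (by omega)).congr (hsame i)).congr (hother i hi.ne)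
  · rcases hji.eq_or_lt with rfl | hlt
    · exact scaleData_endScale coins hscale hloop hj hpr hdata hcurrent
    · exact ((h.done i hi hlt).congr (hsame i)).congr (hother i hlt.ne')

theorem ScaleLoop.tick {j : ℕ} (h : ScaleLoop l e T b U t j s) (k : ℕ) :
    ScaleLoop l e T b U t j (s.tick k) := by
  have hf : Store.Frame [] [] s (s.tick k) := (Store.Frame.refl _ _ s).tick k
  have hsame : ∀ i, SameScale (card X) i s (s.tick k) := .of_frame hf (by decide) (by decide) _
  exact ⟨h.toPrepared.of_frame hf (by decide) (by decide), h.scale, h.current,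
    fun i hi => (h.pending i hi).congr (hsame i), fun i hi hji => (h.done i hi hji).congr (hsame i)⟩

theorem scaleLoop_mixScales (h : ScaleLoop l e T b U t T.size s) :
    ScaleLoop l e T b U t 0 (mixScales.exec coins s) := by
  have hexec : mixScales.exec coins s
      = whileUpTo .always (scaleStep.exec coins) T.size (s.tick 3) := by
    simp only [mixScales, Program.exec, cell, IExp.eval, h.scaleCount, IExp.cost]
  rw [hexec, ← Nat.sub_self T.size]
  refine whileUpTo_always (fun i => ScaleLoop l e T b U t (T.size - i)) (h.tick 3)
    fun i hi s' hs' => ScaleLoop.step coins (by omega) ?_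
  rw [show T.size - (i + 1) + 1 = T.size - i by omega]
  exact hs'.tick 3

theorem scaleLoop_beginRound (hpr : Prepared l e T U t s)
    (hdata : ∀ j < T.size, ScaleData l e T b U j t s) (hbase : s.int 2 0 = e (b t)) :
    ScaleLoop l e T b U t T.size (beginRound.exec coins s) := by
  have hf : Store.Frame [3, 12] [] s (beginRound.exec coins s) :=
    (Store.Frame.refl _ _ s).exec coins (by decide) (by decide)
  refine ⟨hpr.of_frame hf (by decide) (by decide), ?_, ?_, fun j hj => (hdata j hj).congr
    (.of_frame hf (by decide) (by decide) _ _), fun i hi hji => absurd hji (not_le.2 hi)⟩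
  · simp [beginRound, hpr.scaleCount]
  · rw [Nat.sub_self, stack]
    simp [beginRound, hbase]

end Scale

section Preparations

variable (coins : ℕ → unitInterval) {N k : ℕ}

variable (T) in
/-- The store `s'` arises from `s` by `k` steps of the computation of the binary lengths. -/
structure SizeLoop (k : ℕ) (s s' : Store) : Prop where
  frame : Store.Frame [4, 8, 9, 10] [] s s'
  drawn : s'.drawn = s.drawn
  power : ∀ i < k, s'.int 4 i = 2 ^ i
  scaleCount : s'.int 8 0 = min k T.size
  size : s'.int 9 0 = k
  next : s'.int 10 0 = 2 ^ k

theorem SizeLoop.tick (h : SizeLoop T k s s') (m : ℕ) : SizeLoop T k s (s'.tick m) :=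
  ⟨h.frame.tick m, h.drawn, h.power, h.scaleCount, h.size, h.next⟩

theorem SizeLoop.step (hhorizon : s.int 1 0 = T) (h : SizeLoop T k s s') :
    SizeLoop T (k + 1) s (sizeStep.exec coins s') := by
  have hhorizon' : s'.int 1 0 = T := by rw [h.frame.int 1 (by decide), hhorizon]
  refine ⟨h.frame.exec coins (by decide) (by decide),
    (Program.drawn_condInt coins _ _ _ _ _).trans h.drawn, fun i hi => ?_, ?_, ?_, ?_⟩
  · rcases Nat.lt_succ_iff_lt_or_eq.1 hi with hik | rfl
    · simp [sizeStep, h.size, h.power i hik, hik.ne]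
    · simp [sizeStep, h.size, h.next]
  · simp [sizeStep, h.scaleCount, h.next, hhorizon', ← Nat.lt_size]
    split_ifs <;> omega
  · simp [sizeStep, h.size]
  · simp [sizeStep, h.next, pow_succ]

theorem sizeLoop_computeSizes (hstates : s.int 0 0 = N) (hhorizon : s.int 1 0 = T)
    (hcount : s.int 8 0 = 0) (hsize : s.int 9 0 = 0) :
    SizeLoop T (N * T).size s (computeSizes.exec coins s) ∧
      (computeSizes.exec coins s).time ≤ s.time + (17 + 37 * (N * T).size) := by
  set test : Test := .intLE (cell 10) (.mul states horizon) with htest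
  set s₀ := ((Program.setInt 10 (.lit 0) (.lit 1)).exec coins s).tick 6
  have hexec : computeSizes.exec coins s = whileUpTo test (sizeStep.exec coins) (N * T) s₀ := by
    rw [← hstates, ← hhorizon]
    rfl
  have hholds : ∀ i s', SizeLoop T i s s' → (test.Holds s' ↔ i < (N * T).size) := fun i s' h => by
    simp [htest, h.next, h.frame.int 0 (by decide), h.frame.int 1 (by decide), hstates, hhorizon,
      Nat.lt_size]
  have hinit : SizeLoop T 0 s s₀ :=
    ⟨((Store.Frame.refl _ _ s).exec coins (by decide) (by decide)).tick 6, rfl,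
      fun i hi => absurd hi i.not_lt_zero, hcount, hsize, rfl⟩
  have hstep : ∀ (i : ℕ) (s' : Store), s'.time ≤ s.time + (9 + 37 * i) →
      (sizeStep.exec coins (s'.tick test.cost)).time ≤ s.time + (9 + 37 * (i + 1)) :=
    fun i s' htime => (Program.time_exec_le coins (s'.tick test.cost) (c := sizeStep)
      (by simp [sizeStep, Program.Flat, Program.condInt])).trans (by
        have hcost : sizeStep.flatCost + test.cost = 37 := rfl
        simp only [Store.tick]
        omega)
  obtain ⟨s', c, ⟨hloop, htime⟩, hc, heq⟩ := exists_whileUpTo_eq_tick (b := test)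
    (body := sizeStep.exec coins) (n := N * T) (s := s₀)
    (fun i s' => SizeLoop T i s s' ∧ s'.time ≤ s.time + (9 + 37 * i))
    (Nat.size_le.2 Nat.lt_two_pow_self) ⟨hinit, le_rfl⟩
    (fun i hi s' h => ⟨(hholds i s' h.1).2 hi, .step coins hhorizon (h.1.tick _),
      hstep i s' h.2⟩)
    (fun s' h => by simp [hholds _ s' h.1])
  have hcost : test.cost = 8 := rfl
  refine hexec ▸ heq ▸ ⟨hloop.tick c, ?_⟩
  simp only [Store.tick]
  omega

/-- The store `s'` arises from `s` by `k` steps of drawing the coins. -/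
structure CoinLoop (coins : ℕ → unitInterval) (k : ℕ) (s s' : Store) : Prop where
  frame : Store.Frame [11] [3] s s'
  index : s'.int 11 0 = k
  drawn : s'.drawn = s.drawn + k
  coin : ∀ i < k, s'.real 3 i = coins (s.drawn + i)

theorem CoinLoop.tick (h : CoinLoop coins k s s') (m : ℕ) : CoinLoop coins k s (s'.tick m) :=
  ⟨h.frame.tick m, h.index, h.drawn, h.coin⟩

theorem CoinLoop.step (h : CoinLoop coins k s s') :
    CoinLoop coins (k + 1) s (drawStep.exec coins s') := by
  refine ⟨h.frame.exec coins (by decide) (by decide), ?_, congrArg (· + 1) h.drawn, fun i hi => ?_⟩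
  · simp [drawStep, Program.int_draw, h.index]
  · rcases Nat.lt_succ_iff_lt_or_eq.1 hi with hik | rfl
    · simp [drawStep, Program.real_draw, h.index, hik.ne, h.coin i hik]
    · simp [drawStep, Program.real_draw, h.index, h.drawn]

theorem coinLoop_drawCoins :
    CoinLoop coins (s.int 0 0 + s.int 8 0) s (drawCoins.exec coins s) := by
  set s₀ := ((Program.setInt 11 (.lit 0) (.lit 0)).exec coins s).tick 6
  have hinit : CoinLoop coins 0 s s₀ :=
    ⟨((Store.Frame.refl _ _ s).exec coins (by decide) (by decide)).tick 6, rfl, rfl,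
      fun i hi => absurd hi i.not_lt_zero⟩
  exact whileUpTo_always (fun k => CoinLoop coins k s) hinit
    fun i _ s' h => CoinLoop.step coins (CoinLoop.tick coins h 3)

theorem prepared_drawCoins_computeSizes (hin : Input l e T t s) (hcount : s.int 8 0 = 0)
    (hsize : s.int 9 0 = 0) (hdrawn : s.drawn = 0) :
    Prepared l e T coins t (drawCoins.exec coins (computeSizes.exec coins s)) := by
  set s₁ := computeSizes.exec coins s
  have hsizes : SizeLoop T (card X * T).size s s₁ :=
    (sizeLoop_computeSizes coins hin.states hin.horizon hcount hsize).1
  have hle : T.size ≤ (card X * T).size :=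
    Nat.size_le_size (Nat.le_mul_of_pos_left T Fintype.card_pos)
  have hin₁ : Input l e T t s₁ := hin.of_frame hsizes.frame (by decide) (by decide)
  have hscales : s₁.int 8 0 = T.size := hsizes.scaleCount.trans (min_eq_right hle)
  have hcoins : CoinLoop coins (card X + T.size) s₁ (drawCoins.exec coins s₁) := by
    rw [← hin₁.states, ← hscales]
    exact coinLoop_drawCoins coins
  refine ⟨hin₁.of_frame hcoins.frame (by decide) (by decide), ?_, ?_, fun j hj => ?_,
    fun i hi => ?_⟩
  · rw [hcoins.frame.int 8 (by decide), hscales]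
  · rw [hcoins.frame.int 9 (by decide), hsizes.size]
  · rw [hcoins.frame.int 4 (by decide), hsizes.power j (hj.trans_le hle)]
  · rw [hcoins.coin i hi, hsizes.drawn, hdrawn, zero_add]

end Preparations

section Time

variable (coins : ℕ → unitInterval)

theorem time_drawCoins_le :
    (drawCoins.exec coins s).time ≤ s.time + (9 + (s.int 0 0 + s.int 8 0) * 12) := by
  have hloop := time_whileUpTo_always_le (I := fun _ => True) (body := drawStep.exec coins)
    (s := ((Program.setInt 11 (.lit 0) (.lit 0)).exec coins s).tick 6) (c := 12)
    (fun s' _ => ⟨trivial, Program.time_exec_le coins (s'.tick 3) (c := drawStep)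
      ⟨trivial, trivial⟩⟩) trivial (s.int 0 0 + s.int 8 0)
  exact hloop.trans (Nat.add_assoc s.time 9 _).le

theorem time_computeLeader_le :
    (computeLeader.exec coins s).time ≤ s.time + (3 + s.int 0 0 * 102) := by
  have hloop := time_whileUpTo_always_le (I := fun _ => True) (body := leaderStep.exec coins)
    (s := s.tick 3) (c := 102)
    (fun s' _ => ⟨trivial, Program.time_exec_le coins (s'.tick 3) (c := leaderStep)
      (by simp [leaderStep, Program.Flat, Program.condInt, Program.condReal])⟩) trivial
    (s.int 0 0)
  exact hloop.trans (Nat.add_assoc _ _ _).le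

theorem time_scaleStep_le :
    (scaleStep.exec coins s).time ≤ s.time + (228 + s.int 0 0 * 102) := by
  have hbegin := Program.time_exec_le coins s (c := beginScale) ⟨trivial, trivial, trivial⟩
  have hleader := time_computeLeader_le (s := beginScale.exec coins s) coins
  have hend := Program.time_exec_le coins (computeLeader.exec coins (beginScale.exec coins s))
    (c := endScale) (by simp [endScale, updateBias, remember, choose, updateCount, Program.Flat,
      Program.condInt])
  have hstates : (beginScale.exec coins s).int 0 0 = s.int 0 0 := by simp [beginScale]
  have hcosts : beginScale.flatCost = 12 ∧ endScale.flatCost = 213 := ⟨rfl, rfl⟩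
  simp only [scaleStep, Program.exec_seq]
  omega

theorem time_mixScales_le :
    (mixScales.exec coins s).time ≤ s.time + (3 + s.int 8 0 * (231 + s.int 0 0 * 102)) := by
  have hloop := time_whileUpTo_always_le (I := fun s' => s'.int 0 0 = s.int 0 0)
    (body := scaleStep.exec coins) (s := s.tick 3) (c := 231 + s.int 0 0 * 102)
    (fun s' h => ⟨?_, ?_⟩) rfl (s.int 8 0)
  · exact hloop.trans (Nat.add_assoc _ _ _).le
  · have hf : Store.Frame [3, 5, 6, 7, 11, 12, 13] [4, 5] s' (scaleStep.exec coins (s'.tick 3)) :=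
      ((Store.Frame.refl _ _ s').tick 3).exec coins (by decide) (by decide)
    rw [hf.int 0 (by decide), h]
  · have hstep := time_scaleStep_le (s := s'.tick 3) coins
    simp only [Store.tick] at hstep ⊢
    omega

theorem time_mixScales_beginRound_le : (mixScales.exec coins (beginRound.exec coins s)).time
    ≤ s.time + (11 + s.int 8 0 * (231 + s.int 0 0 * 102)) := by
  have hbegin := Program.time_exec_le coins s (c := beginRound) ⟨trivial, trivial⟩
  have hmix := time_mixScales_le (s := beginRound.exec coins s) coins
  have hf : Store.Frame [3, 12] [] s (beginRound.exec coins s) :=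
    (Store.Frame.refl _ _ s).exec coins (by decide) (by decide)
  have hcost : beginRound.flatCost = 8 := rfl
  rw [hf.int 0 (by decide), hf.int 8 (by decide)] at hmix
  omega

end Time

section Round

theorem exec_program_first (coins : ℕ → unitInterval) (hcount : s.int 8 0 = 0) :
    program.exec coins s = mixScales.exec coins (beginRound.exec coins
      (drawCoins.exec coins (computeSizes.exec coins (s.tick 4)))) := by
  have htest : Test.Holds (.intLE (cell 8) (.lit 0)) s := by simp [hcount]
  simp only [program, Program.exec, if_pos htest]
  rfl

theorem exec_program_later (coins : ℕ → unitInterval) (hcount : s.int 8 0 ≠ 0) :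
    program.exec coins s = mixScales.exec coins (beginRound.exec coins (s.tick 5)) := by
  have htest : ¬ Test.Holds (.intLE (cell 8) (.lit 0)) s := by simp [hcount]
  simp only [program, Program.exec, if_neg htest]
  rfl

theorem size_mul_le (N T : ℕ) : (N * T).size ≤ N + T.size := by
  rw [Nat.size_le, pow_add]
  exact Nat.mul_lt_mul'' Nat.lt_two_pow_self (Nat.lt_size_self T)

theorem time_program_first_le (coins : ℕ → unitInterval) {N : ℕ} (hN : 0 < N) (hT : 0 < T)
    (hstates : s.int 0 0 = N) (hhorizon : s.int 1 0 = T) (hcount : s.int 8 0 = 0)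
    (hsize : s.int 9 0 = 0) : (program.exec coins s).time ≤ s.time + 472 * (N * T.size) := by
  set s₁ := computeSizes.exec coins (s.tick 4)
  obtain ⟨hloop, hsizes⟩ : SizeLoop T (N * T).size (s.tick 4) s₁ ∧
      s₁.time ≤ s.time + 4 + (17 + 37 * (N * T).size) :=
    sizeLoop_computeSizes coins hstates hhorizon hcount hsize
  have hscales : s₁.int 8 0 = T.size := hloop.scaleCount.trans
    (min_eq_right (Nat.size_le_size (Nat.le_mul_of_pos_left T hN)))
  have hstates₁ : s₁.int 0 0 = N := by rw [hloop.frame.int 0 (by decide), ← hstates]; rfl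
  have hdraw := time_drawCoins_le (s := s₁) coins
  have hmix := time_mixScales_beginRound_le (s := drawCoins.exec coins s₁) coins
  have hframe : Store.Frame [11] [3] s₁ (drawCoins.exec coins s₁) :=
    (Store.Frame.refl _ _ s₁).exec coins (by decide) (by decide)
  rw [hframe.int 0 (by decide), hframe.int 8 (by decide), hstates₁, hscales] at hmix
  rw [hstates₁, hscales] at hdraw
  have hadd := size_mul_le N T
  have hN_le : N ≤ N * T.size := Nat.le_mul_of_pos_right N (Nat.size_pos.2 hT)
  have hsize_le : T.size ≤ N * T.size := Nat.le_mul_of_pos_left T.size hN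
  rw [exec_program_first coins hcount]
  linarith

theorem time_program_later_le (coins : ℕ → unitInterval) {N : ℕ} (hN : 0 < N) (hT : 0 < T)
    (hstates : s.int 0 0 = N) (hcount : s.int 8 0 = T.size) :
    (program.exec coins s).time ≤ s.time + 472 * (N * T.size) := by
  have hm : 0 < T.size := Nat.size_pos.2 hT
  have hmix := time_mixScales_beginRound_le (s := s.tick 5) coins
  rw [exec_program_later coins (by omega)]
  simp only [Store.tick, hstates, hcount] at hmix ⊢
  nlinarith

theorem scaleData_zero {j : ℕ} (hcount : s.int 5 j = 0) : ScaleData l e T b U j 0 s := by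
  have hzero : 0 % 2 ^ j = 0 := Nat.zero_mod _
  exact ⟨hcount.trans hzero.symm, absurd hzero, absurd hzero, absurd hzero, absurd hzero⟩

theorem scaleLoop_program_first (hin : Input l e T 0 s) (hcount : s.int 8 0 = 0)
    (hsize : s.int 9 0 = 0) (hdrawn : s.drawn = 0) (hstart : ∀ j, s.int 5 j = 0)
    (hbase : s.int 2 0 = e (b 0)) : ScaleLoop l e T b U 0 0 (program.exec U s) := by
  set s₁ := drawCoins.exec U (computeSizes.exec U (s.tick 4))
  have hframe : Store.Frame [4, 8, 9, 10, 11] [3] s s₁ :=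
    (((Store.Frame.refl _ _ s).tick 4).exec U (by decide) (by decide)).exec U (by decide)
      (by decide)
  have hin' : Input l e T 0 (s.tick 4) :=
    hin.of_frame ((Store.Frame.refl [] [] s).tick 4) (by decide) (by decide)
  rw [exec_program_first U hcount]
  refine scaleLoop_mixScales U (scaleLoop_beginRound U
    (prepared_drawCoins_computeSizes U hin' hcount hsize hdrawn)
    (fun j _ => scaleData_zero ?_) ?_)
  · rw [hframe.int 5 (by decide), hstart]
  · rw [hframe.int 2 (by decide), hbase]

theorem scaleLoop_program_later (hT : 0 < T) (coins : ℕ → unitInterval)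
    (hpr : Prepared l e T U t s) (hdata : ∀ j < T.size, ScaleData l e T b U j t s)
    (hbase : s.int 2 0 = e (b t)) : ScaleLoop l e T b U t 0 (program.exec coins s) := by
  have hframe : Store.Frame [] [] s (s.tick 5) := (Store.Frame.refl _ _ s).tick 5
  rw [exec_program_later coins (hpr.scaleCount ▸ (Nat.size_pos.2 hT).ne')]
  exact scaleLoop_mixScales coins (scaleLoop_beginRound coins
    (hpr.of_frame hframe (by decide) (by decide))
    (fun j hj => (hdata j hj).congr (.of_frame hframe (by decide) (by decide) _ _)) hbase)

theorem input_feed_startStore (x : X) :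
    Input l e T 0 (feed e (l 0) x (startStore e T)) := by
  refine ⟨rfl, rfl, rfl, fun x y => ?_, fun x => by simp [feed, decode]⟩
  have hentry : (e x : ℕ) * card X + e y < card X * card X := by
    nlinarith [(e x).isLt, (e y).isLt]
  have hdiv : ((e x : ℕ) * card X + e y) / card X = e x := by
    rw [mul_comm, Nat.mul_add_div Fintype.card_pos, Nat.div_eq_of_lt (e y).isLt, add_zero]
  have hmod : ((e x : ℕ) * card X + e y) % card X = e y := by
    rw [mul_comm, Nat.mul_add_mod, Nat.mod_eq_of_lt (e y).isLt]
  simp [feed, startStore, hentry, hdiv, hmod, decode_apply]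

theorem prepared_feed (h : Prepared l e T U t s) (x : X) :
    Prepared l e T U (t + 1) (feed e (l (t + 1)) x s) :=
  ⟨⟨h.states, h.horizon, h.diameter, h.dist, fun x => by simp [feed, decode_apply]⟩,
    h.scaleCount, h.size, h.power, h.coins⟩

theorem scaleData_feed {j : ℕ} (h : ScaleData l e T b U j t s) (f : X → ℝ) (x : X) :
    ScaleData l e T b U j t (feed e f x s) :=
  ⟨h.count, h.coarse, h.lead, h.bias, h.weight⟩

theorem scaleLoop_runRounds (hT : 0 < T) (l : ℕ → M.losses) (b : ℕ → X) (t : ℕ) :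
    ScaleLoop l e T b U t 0 (runRounds program e T (fun s => (l s : X → ℝ)) b U (t + 1)) := by
  induction t with
  | zero =>
    exact scaleLoop_program_first (input_feed_startStore (b 0)) rfl rfl rfl (fun _ => rfl) rfl
  | succ t ih =>
    exact scaleLoop_program_later hT U (prepared_feed ih.toPrepared (b (t + 1)))
      (fun j hj => scaleData_feed (ih.done j hj j.zero_le) _ _) rfl

theorem runRounds_output (hT : 0 < T) (l : ℕ → M.losses) (b : ℕ → X) (t : ℕ) :
    decode e ((runRounds program e T (fun s => (l s : X → ℝ)) b U (t + 1)).int 3 0)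
      = output l e T b U t := by
  rw [(scaleLoop_runRounds hT l b t).current, decode_apply]
  rfl

theorem overheadTime_program_le (hT : 0 < T) (l : ℕ → M.losses) (b : ℕ → X) (t : ℕ) :
    overheadTime program e T (fun s => (l s : X → ℝ)) b U t ≤ 472 * (card X * T.size) := by
  rw [← zero_add (472 * _)]
  cases t with
  | zero => exact time_program_first_le U Fintype.card_pos hT rfl rfl rfl rfl
  | succ t =>
    have hpr := (scaleLoop_runRounds (e := e) (U := U) hT l b t).toPrepared
    exact time_program_later_le U Fintype.card_pos hT hpr.states hpr.scaleCount

end Round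

end Overlay

/-! ### The algorithm on top of a base algorithm -/

theorem size_le_three_mul_log {n : ℕ} (hn : 2 ≤ n) : (n.size : ℝ) ≤ 3 * Real.log n := by
  have hpos : 0 < n.size := Nat.size_pos.2 (by omega)
  have hpow : 2 ^ (n.size - 1) ≤ n := Nat.lt_size.1 (by omega)
  have hsize : (n.size - 1 : ℝ) * Real.log 2 ≤ Real.log n := by
    rw [← Nat.cast_pred hpos, ← Real.log_pow]
    exact Real.log_le_log (by positivity) (by exact_mod_cast hpow)
  have hlog : Real.log 2 ≤ Real.log n := Real.log_le_log two_pos (by exact_mod_cast hn)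
  have hone : (1 : ℝ) ≤ n.size := by exact_mod_cast hpos
  nlinarith [Real.log_two_gt_d9]

theorem sqrt_mul_sqrt_le_two_mul {x y k : ℝ} (hk : 0 ≤ k) (hy : 0 ≤ y) (h : x ≤ 3 * y) :
    √x * √k ≤ 2 * √(k * y) := by
  have hsq : 2 * √(k * y) = √(4 * (k * y)) := by
    rw [Real.sqrt_mul (by norm_num : (0 : ℝ) ≤ 4), show (4 : ℝ) = 2 ^ 2 by norm_num,
      Real.sqrt_sq two_pos.le]
  rw [hsq, ← Real.sqrt_mul' x hk]
  refine Real.sqrt_le_sqrt ?_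
  linarith [mul_le_mul_of_nonneg_right h hk, mul_nonneg hk hy]

theorem interval_regret_le {D L m A B k : ℝ} (hD : 0 ≤ D) (hk : 0 ≤ k) (hA : 0 ≤ A)
    (hAB : A ≤ B) (hL : L ≤ 3 * A) (hm : m ≤ 3 * B) :
    6 * (50 * ((1 + D) * √L) + 3 * √((D + 1) * m)) * √k
      ≤ 636 * (D * √(k * A) + √((D + 1) * k * B)) := by
  have hB : 0 ≤ B := hA.trans hAB
  have hcoarse : (1 + D) * (√L * √k) ≤ (1 + D) * (2 * √(k * A)) :=
    mul_le_mul_of_nonneg_left (sqrt_mul_sqrt_le_two_mul hk hA hL) (by positivity)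
  have hfine : √((D + 1) * m) * √k ≤ 2 * √((D + 1) * k * B) := by
    rw [show (D + 1) * k * B = k * ((D + 1) * B) by ring]
    refine sqrt_mul_sqrt_le_two_mul hk (by positivity) ?_
    linarith [mul_le_mul_of_nonneg_left hm (by positivity : 0 ≤ D + 1)]
  have hmono : √(k * A) ≤ √((D + 1) * k * B) := by
    refine Real.sqrt_le_sqrt ((mul_le_mul_of_nonneg_left hAB hk).trans ?_)
    rw [mul_assoc]
    exact le_mul_of_one_le_left (by positivity) (by linarith)
  have hprod : 0 ≤ D * √(k * A) := by positivity
  linarith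

theorem OnlineAlgorithm.measurable {X : Type u} [Countable X] [MeasurableSpace X] {M : MTS X}
    (A : OnlineAlgorithm.{u, w} M) (l : ℕ → M.losses) (t : ℕ) : Measurable (A.act l t) :=
  measurable_to_countable' (A.measurable_act l t)

section Expectation

variable {X : Type u} [PseudoMetricSpace X] {M : MTS X}

theorem OnlineAlgorithm.expectedCost_zero (A : OnlineAlgorithm.{u, w} M) (l : ℕ → M.losses)
    (a : ℕ) : A.expectedCost l a 0 = 0 := by
  simp only [OnlineAlgorithm.expectedCost, pathCost_zero, integral_zero]

theorem HasCompetitiveRatio.of_expectedCost_le_add {A A' : ℕ → OnlineAlgorithm.{u, w} M} {α c : ℝ}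
    (h : HasCompetitiveRatio A α) (hc : 0 ≤ c)
    (hle : ∀ T l, (A' T).expectedCost l 0 T ≤ (A T).expectedCost l 0 T + c) :
    HasCompetitiveRatio A' α := by
  obtain ⟨β, hβ, hA⟩ := h
  exact ⟨β + c, by positivity, fun T l p => by linarith [hle T l, hA T l p]⟩

variable [Countable X] [MeasurableSpace X] [MeasurableSingletonClass X] [BoundedSpace X]

theorem OnlineAlgorithm.integrable_pathCost (A : OnlineAlgorithm.{u, w} M) (l : ℕ → M.losses)
    (a k : ℕ) : Integrable (fun ω => pathCost l (fun t => A.act l t ω) a k) A.law :=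
  _root_.integrable_pathCost l A.law (A.measurable l) a k

theorem OnlineAlgorithm.expectedCost_one_le (A : OnlineAlgorithm.{u, w} M) (l : ℕ → M.losses)
    (a : ℕ) {c : ℝ} (hc : ∀ x, (l a : X → ℝ) x ≤ c) : A.expectedCost l a 1 ≤ c := by
  have hmono := integral_mono (A.integrable_pathCost l a 1) (integrable_const c) fun ω =>
    (pathCost_one l (fun t => A.act l t ω) a).trans_le (hc _)
  rwa [integral_const, probReal_univ, one_smul] at hmono

theorem OnlineAlgorithm.regretLE_one {X : Type u} [Fintype X] [PseudoMetricSpace X]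
    [MeasurableSpace X] [MeasurableSingletonClass X] {M : MTS X} (A : OnlineAlgorithm.{u, w} M)
    (a : ℕ) : A.RegretLE a 1 (2 * √((diameter X + 1) * Real.log (Fintype.card X))) := by
  intro l x
  have hsum : ∑ t ∈ Finset.Ico a (a + 1), (l t : X → ℝ) x = (l a : X → ℝ) x := by simp
  rw [hsum]
  rcases subsingleton_or_nontrivial X with hX | hX
  · have hle := A.expectedCost_one_le l a (c := (l a : X → ℝ) x)
      fun y => (congrArg _ (Subsingleton.elim y x)).le
    exact hle.trans (le_add_of_nonneg_right (by positivity))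
  · have hcard : Real.log 2 ≤ Real.log (Fintype.card X) :=
      Real.log_le_log two_pos (by exact_mod_cast Fintype.one_lt_card (α := X))
    have hsqrt : 1 / 2 ≤ √((diameter X + 1) * Real.log (Fintype.card X)) := by
      refine Real.le_sqrt_of_sq_le ?_
      have hD : 0 ≤ diameter X := Metric.diam_nonneg
      nlinarith [Real.log_two_gt_d9]
    linarith [A.expectedCost_one_le l a (loss_le_one l a), loss_nonneg l a x]

end Expectation

namespace Overlay

open Fintype (card)

variable {X : Type u} [Fintype X] [Nonempty X] [PseudoMetricSpace X] {M : MTS X} {T : ℕ}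

theorem act_overlay_program (hT : 0 < T) (e : X ≃ Fin (card X)) (B : OnlineAlgorithm.{u, w} M)
    (l : ℕ → M.losses) (ω : B.Seed × (ℕ → unitInterval)) :
    (fun t => (overlay program e T B).act l t ω)
      = output l e T (fun t => B.act l t ω.1) ω.2 :=
  funext (runRounds_output hT l _)

theorem overheadTime_program_le_log (e : X ≃ Fin (card X)) (l : ℕ → M.losses) (b : ℕ → X)
    (coins : ℕ → unitInterval) {t : ℕ} (ht : t < T) :
    (overheadTime program e T (fun s => (l s : X → ℝ)) b coins t : ℝ)
      ≤ 1416 * (card X * Real.log (T + 1)) := by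
  have hsize : (T.size : ℝ) ≤ 3 * Real.log (T + 1) := by
    have hlog := size_le_three_mul_log (n := T + 1) (by omega)
    rw [Nat.cast_succ] at hlog
    exact (Nat.cast_le.2 (Nat.size_le_size T.le_succ)).trans hlog
  calc (overheadTime program e T (fun s => (l s : X → ℝ)) b coins t : ℝ)
      ≤ 472 * (card X * T.size) := by exact_mod_cast overheadTime_program_le (by omega) l b t
    _ ≤ 472 * (card X * (3 * Real.log (T + 1))) := by gcongr
    _ = 1416 * (card X * Real.log (T + 1)) := by ring

variable [MeasurableSpace X] [MeasurableSingletonClass X]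

theorem expectedCost_overlay_program_le (hT : 0 < T) (e : X ≃ Fin (card X))
    (B : OnlineAlgorithm.{u, w} M) (l : ℕ → M.losses) {a k : ℕ} {F : B.Seed → ℝ}
    (hF : Integrable F B.law)
    (h : ∀ ω, ∫ c, pathCost l (output l e T (fun s => B.act l s ω) c) a k ∂coinLaw ≤ F ω) :
    (overlay program e T B).expectedCost l a k ≤ ∫ ω, F ω ∂B.law := by
  have hact := act_overlay_program hT e B l
  have hint : Integrable (fun ω : B.Seed × (ℕ → unitInterval) =>
      pathCost l (output l e T (fun t => B.act l t ω.1) ω.2) a k) (B.law.prod coinLaw) :=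
    ((overlay program e T B).integrable_pathCost l a k).congr
      (.of_forall fun ω => congrArg (pathCost l · a k) (hact ω))
  have hcost : (overlay program e T B).expectedCost l a k
      = ∫ ω, pathCost l (output l e T (fun t => B.act l t ω.1) ω.2) a k ∂B.law.prod coinLaw :=
    integral_congr_ae (.of_forall fun ω => congrArg (pathCost l · a k) (hact ω))
  rw [hcost, integral_prod _ hint]
  exact integral_mono hint.integral_prod_left hF h

theorem expectedCost_overlay_program_le_add (T : ℕ) (e : X ≃ Fin (card X))
    (B : OnlineAlgorithm.{u, w} M) (l : ℕ → M.losses) :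
    (overlay program e T B).expectedCost l 0 T
      ≤ B.expectedCost l 0 T + 12 * (1 + diameter X) := by
  rcases T.eq_zero_or_pos with rfl | hT
  · rw [OnlineAlgorithm.expectedCost_zero, OnlineAlgorithm.expectedCost_zero]
    have hD : 0 ≤ diameter X := Metric.diam_nonneg
    positivity
  · have hbase := B.integrable_pathCost l 0 T
    refine (expectedCost_overlay_program_le hT e B l (hbase.add (integrable_const _)) fun ω =>
      integral_pathCost_output_le_base l e (fun t => B.act l t ω) hT).trans_eq ?_
    rw [integral_add' hbase (integrable_const _), integral_const, probReal_univ, one_smul]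
    rfl

theorem regretLE_overlay_program_of_two_le (hT : 2 ≤ T) (e : X ≃ Fin (card X))
    (B : OnlineAlgorithm.{u, w} M) (a : ℕ) {k : ℕ} (hk : k ≤ T) :
    (overlay program e T B).RegretLE a k (636 * (diameter X * √(k * Real.log T)
      + √((diameter X + 1) * k * Real.log (card X * T)))) := by
  intro l x
  have hT' : (2 : ℝ) ≤ T := by exact_mod_cast hT
  have hN : (1 : ℝ) ≤ card X := by exact_mod_cast Fintype.card_pos (α := X)
  have hNT := size_le_three_mul_log (n := card X * T)
    (hT.trans (Nat.le_mul_of_pos_left T Fintype.card_pos))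
  have hlogNT := log_le_size (card X * T)
  rw [Nat.cast_mul] at hNT hlogNT
  have hm : Real.log (2 * card X) ≤ (card X * T).size :=
    (Real.log_le_log (by positivity) (by nlinarith)).trans hlogNT
  refine (expectedCost_overlay_program_le (by omega) e B l (integrable_const _) fun ω =>
    integral_pathCost_output_le l e (fun t => B.act l t ω) (by omega) hm hk a x).trans ?_
  rw [integral_const, probReal_univ, one_smul]
  exact add_le_add le_rfl (interval_regret_le Metric.diam_nonneg k.cast_nonneg
    (Real.log_nonneg (by linarith)) (Real.log_le_log (by positivity) (by nlinarith))
    (size_le_three_mul_log hT) hNT)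

theorem regretLE_overlay_program (e : X ≃ Fin (card X)) (B : OnlineAlgorithm.{u, w} M) {a k : ℕ}
    (hak : a + k ≤ T) :
    (overlay program e T B).RegretLE a k (636 * (diameter X * √(k * Real.log T)
      + √((diameter X + 1) * k * Real.log (card X * T)))) := by
  rcases le_or_gt 2 T with hT | hT
  · exact regretLE_overlay_program_of_two_le hT e B a (by omega)
  intro l x
  rcases k.eq_zero_or_pos with rfl | hk
  · simp [OnlineAlgorithm.expectedCost_zero]
  · obtain ⟨rfl, rfl⟩ : T = 1 ∧ k = 1 := by omega
    have hone := (overlay program e 1 B).regretLE_one a l x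
    simp only [Nat.cast_one, Real.log_one, mul_zero, Real.sqrt_zero, zero_add, mul_one]
    linarith [Real.sqrt_nonneg ((diameter X + 1) * Real.log (card X))]

end Overlay

theorem mainTheorem4_general :
    ∃ (P : Program) (C : ℝ), 0 < C ∧
      ∀ (X : Type u) [Fintype X] [Nonempty X] [PseudoMetricSpace X] (M : MTS X)
        (e : X ≃ Fin (Fintype.card X)) (T : ℕ),
        (∀ (B : OnlineAlgorithm.{u, w} M),
          (∀ l : ℕ → M.losses, (overlay P e T B).expectedCost l 0 T
            ≤ B.expectedCost l 0 T + C * (1 + diameter X)) ∧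
          ∀ a k : ℕ, a + k ≤ T →
            (overlay P e T B).RegretLE a k
              (C * (diameter X * √(k * Real.log T)
                + √((diameter X + 1) * k * Real.log (Fintype.card X * T))))) ∧
        ∀ (l : ℕ → M.losses) (b : ℕ → X) (coins : ℕ → unitInterval) (t : ℕ), t < T →
          (overheadTime P e T (fun s => (l s : X → ℝ)) b coins t : ℝ)
            ≤ C * (Fintype.card X * Real.log (T + 1)) := by
  refine ⟨Overlay.program, 1416, by norm_num, fun X _ _ _ M e T => ⟨fun B => ?_,
    fun l b coins t ht => Overlay.overheadTime_program_le_log e l b coins ht⟩⟩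
  let _ : MeasurableSpace X := ⊤
  have : MeasurableSingletonClass X := ⟨fun _ => trivial⟩
  have hD : 0 ≤ diameter X := Metric.diam_nonneg
  constructor
  · refine fun l => (Overlay.expectedCost_overlay_program_le_add T e B l).trans ?_
    gcongr
    norm_num
  · refine fun a k hak l x => (Overlay.regretLE_overlay_program e B hak l x).trans ?_
    gcongr
    norm_num

theorem mainTheorem4 :
    ∃ (P : Program) (C : ℝ), 0 < C ∧
      ∀ (X : Type u) [Fintype X] [Nonempty X] [PseudoMetricSpace X] (M : MTS X)
        (e : X ≃ Fin (Fintype.card X)) (base : ℕ → OnlineAlgorithm.{u, w} M) (α : ℝ),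
        1 ≤ α → HasCompetitiveRatio base α →
          HasCompetitiveRatio (fun T => overlay P e T (base T)) α ∧
          (∀ T a k : ℕ, a + k ≤ T →
            (overlay P e T (base T)).RegretLE a k
              (C * (Metric.diam (Set.univ : Set X) * Real.sqrt (k * Real.log T)
                + Real.sqrt ((Metric.diam (Set.univ : Set X) + 1) * k
                    * Real.log (Fintype.card X * T))))) ∧
          (∀ (T : ℕ) (l : ℕ → M.losses) (ω : (base T).Seed) (coins : ℕ → unitInterval) (t : ℕ),
            t < T →
            (overheadTime P e T (fun s => (l s : X → ℝ)) (fun s => (base T).act l s ω) coins t : ℝ)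
              ≤ C * (Fintype.card X * Real.log (T + 1))) := by
  obtain ⟨P, C, hC, h⟩ := mainTheorem4_general.{u, w}
  refine ⟨P, C, hC, fun X _ _ _ M e base α _ hbase => ⟨?_, ?_, ?_⟩⟩
  · have hD : 0 ≤ diameter X := Metric.diam_nonneg
    exact hbase.of_expectedCost_le_add (c := C * (1 + diameter X)) (by positivity)
      fun T => ((h X M e T).1 (base T)).1
  · exact fun T a k hak => ((h X M e T).1 (base T)).2 a k hak
  · exact fun T l ω coins t ht => (h X M e T).2 l _ coins t ht
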